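/- Let $d\in\{2,3\}$. For $r\in\{f,s\}$ let $\Omega_r\subset\mathbb R^d$ be a bounded domain (nonempty, open, connected, with $\operatorname{int}\overline{\Omega_r}=\Omega_r$, as is the case for a Lipschitz boundary) that can be triangulated by simplices, and let $\Gamma_D^r\subset\partial\Omega_r$ have nonzero $(d-1)$-dimensional measure. Let $\rho_f,\nu_f,\rho_s,\nu_s,\lambda>0$. Consider a quasi-uniform family of conforming simplicial triangulations of $\overline{\Omega_f}$ (mesh sizes $h_1$) and one of $\overline{\Omega_s}$ (mesh sizes $h_2$), where the mesh size is the largest cell diameter. On each triangulation let a scalar finite element space be given with global shape functions $\phi_1,\dots,\phi_N$ that are continuous on $\overline{\Omega_r}$ and vanish on $\Gamma_D^r$; for each family they are affine equivalent to one fixed polynomial reference element with linearly independent shape functions. That is, each cell is the image of the reference simplex under an affine map, and each $\phi_i$ belongs to a face of the mesh (a vertex, an edge, ..., or a cell): on the cells that contain this face $\phi_i$ is a reference shape function transported by the affine map, with distinct $i$ giving distinct reference shape functions, and on all other cells $\phi_i=0$. Let $\{v_i\}$ and $\{\varphi_i\}$ be the resulting bases $\phi_k e_l$ ($e_l$ the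 unit vectors of $\mathbb R^d$) of the vector-valued spaces for the fluid velocity and the structure displacement. With $D(v)=\frac12(\nabla v+(\nabla v)^T)$ put $$(M_f)_{ij}=\rho_f(v_j,v_i)_{\Omega_f},\quad (K_f)_{ij}=2\nu_f(D(v_j),D(v_i))_{\Omega_f},$$ $$(M_s)_{ij}=\rho_s(\varphi_j,\varphi_i)_{\Omega_s},\quad (K_s)_{ij}=2\nu_s(D(\varphi_j),D(\varphi_i))_{\Omega_s},\quad L_{ij}=\lambda(\nabla\cdot\varphi_j,\nabla\cdot\varphi_i)_{\Omega_s},$$ where $(\cdot,\cdot)_{\Omega_r}$ is the $L^2$ inner product, and for a time step $\Delta t>0$ let $$W=\begin{bmatrix} M_f+\Delta t\,K_f & 0\\ 0 & M_s+\Delta t^2(K_s+L)\end{bmatrix}.$$ Then there are constants $C_{\min,f},C_{\max,f},C_{\min,s},C_{\max,s}>0$, independent of the triangulations in the two families (hence of $h_1,h_2$) and of $\Delta t$, such that for every choice of a triangulation from each family and every $\Delta t>0$ the matrix $W$ is symmetric positive definite, each eigenvalue $\mu$ of $W$ satisfies $$\min\{C_{\min,f}h_1^d(1+\Delta t),\,C_{\min,s}h_2^d(1+\Delta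 t^2)\}\le\mu\le\max\{C_{\max,f}h_1^d(1+\Delta t\,h_1^{-2}),\,C_{\max,s}h_2^d(1+\Delta t^2h_2^{-2})\},$$ and the condition number $\kappa(W)=|W|\,|W^{-1}|$ (in the matrix norm induced by the Euclidean norm) satisfies $$\kappa(W)=\frac{\mu_{\max}(W)}{\mu_{\min}(W)}\le\frac{\max\{C_{\max,f}h_1^d(1+\Delta t\,h_1^{-2}),\,C_{\max,s}h_2^d(1+\Delta t^2h_2^{-2})\}}{\min\{C_{\min,f}h_1^d(1+\Delta t),\,C_{\min,s}h_2^d(1+\Delta t^2)\}}.$$ -/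

import Mathlib

open MeasureTheory
open scoped Matrix Matrix.Norms.L2Operator

noncomputable section

namespace FSI

/-- Points of `ℝ^d` with the Euclidean norm. -/
abbrev Pt (d : ℕ) : Type := EuclideanSpace ℝ (Fin d)

/-! ### Triangulations -/

/-- A (conforming, simplicial) triangulation of `closure Ω`: a finite simplicial complex, all of
whose faces are faces of `d`-simplices, and whose simplices cover exactly `closure Ω`. -/
structure Triangulation {d : ℕ} (Ω : Set (Pt d)) where
  complex : Geometry.SimplicialComplex ℝ (Pt d)
  finite_faces : complex.faces.Finite
  pure : ∀ s ∈ complex.faces, ∃ K ∈ complex.faces, s ⊆ K ∧ K.card = d + 1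
  space_eq : complex.space = closure Ω

namespace Triangulation

variable {d : ℕ} {Ω : Set (Pt d)}

/-- The cells (`d`-simplices) of a triangulation, each given by its set of `d + 1` vertices. -/
def cells (T : Triangulation Ω) : Set (Finset (Pt d)) :=
  {K | K ∈ T.complex.faces ∧ K.card = d + 1}

/-- The diameter `h_K` of a cell. -/
def cellDiam (K : Finset (Pt d)) : ℝ := Metric.diam (convexHull ℝ (K : Set (Pt d)))

/-- The mesh size `h = max_K h_K`. -/
def meshSize (T : Triangulation Ω) : ℝ := sSup (cellDiam '' T.cells)

end Triangulation

/-- Quasi-uniform family of triangulations: the cells are uniformly shape regular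
(`h_K ≤ σ ρ_K`, where `ρ_K` is the diameter of a ball contained in `K`) and uniformly
comparable in size (`h ≤ τ h_K`). -/
def QuasiUniform {d : ℕ} {Ω : Set (Pt d)} {ι : Type*} (T : ι → Triangulation Ω) : Prop :=
  ∃ σ τ : ℝ, 0 < σ ∧ 0 < τ ∧ ∀ i, ∀ K ∈ (T i).cells,
    (∃ (c : Pt d) (r : ℝ), Metric.closedBall c r ⊆ convexHull ℝ (K : Set (Pt d)) ∧
      Triangulation.cellDiam K ≤ σ * (2 * r)) ∧
    (T i).meshSize ≤ τ * Triangulation.cellDiam K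

/-! ### Finite element spaces -/

/-- The reference simplex with vertices `0, e_1, …, e_d`. -/
def refSimplex (d : ℕ) : Set (Pt d) := {x | (∀ a, 0 ≤ x a) ∧ ∑ a, x a ≤ 1}

/-- A polynomial reference element on the reference simplex, given by its shape functions, which
form a basis of the local polynomial space (all `P_k` elements, the mini element, …). -/
structure RefElement (d : ℕ) where
  m : ℕ
  shape : Fin m → MvPolynomial (Fin d) ℝ
  linearIndependent : LinearIndependent ℝ shape

/-- A conforming (scalar) finite element space over a triangulation of `closure Ω`, of functions
vanishing on `ΓD`, presented by its global shape functions `φ 0, …, φ (N - 1)`.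

The family of cells is affine equivalent to the reference element: every cell `K` is the image of
the reference simplex under an affine map `cellMap K`, and every global shape function is on `K`
either zero or one of the reference shape functions transported by `cellMap K`, distinct global
shape functions giving distinct local ones. Every degree of freedom `i` belongs to a face
`carrier i` of the mesh (a vertex, an edge, …, or a cell), and `φ i` lives on the cells containing
that face. Degrees of freedom on the Dirichlet boundary are left out. -/
structure FESpace {d : ℕ} (R : RefElement d) (Ω ΓD : Set (Pt d)) where
  mesh : Triangulation Ω
  N : ℕ
  φ : Fin N → Pt d → ℝ
  continuousOn : ∀ i, ContinuousOn (φ i) (closure Ω)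
  vanish : ∀ i, ∀ x ∈ ΓD, φ i x = 0
  cellMap : Finset (Pt d) → (Pt d →ᵃ[ℝ] Pt d)
  cellMap_image : ∀ K ∈ mesh.cells, cellMap K '' refSimplex d = convexHull ℝ (K : Set (Pt d))
  carrier : Fin N → Finset (Pt d)
  carrier_mem : ∀ i, carrier i ∈ mesh.complex.faces
  localIndex : Finset (Pt d) → Fin N → Fin R.m
  localIndex_injOn : ∀ K ∈ mesh.cells, Set.InjOn (localIndex K) {i | carrier i ⊆ K}
  φ_on_cell : ∀ K ∈ mesh.cells, ∀ i, carrier i ⊆ K → ∀ x ∈ refSimplex d,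
    φ i (cellMap K x) = MvPolynomial.eval (fun a => x a) (R.shape (localIndex K i))
  φ_off_carrier : ∀ K ∈ mesh.cells, ∀ i, ¬ carrier i ⊆ K →
    ∀ x ∈ convexHull ℝ (K : Set (Pt d)), φ i x = 0

namespace FESpace

variable {d : ℕ} {R : RefElement d} {Ω ΓD : Set (Pt d)}

/-- The mesh size of a finite element space. -/
def h (V : FESpace R Ω ΓD) : ℝ := V.mesh.meshSize

/-- The basis `φ_i e_r` of the vector-valued finite element space `V^d`. -/
def basisField (V : FESpace R Ω ΓD) (p : Fin V.N × Fin d) : Pt d → Pt d :=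
  fun x => V.φ p.1 x • EuclideanSpace.single p.2 (1 : ℝ)

end FESpace

/-! ### Differential operators

Finite element functions are continuous and smooth inside every cell, so that their weak
derivatives are the classical derivatives, which exist off a null set. -/

/-- `∂_b u_a (x)`. -/
def partialDeriv {d : ℕ} (u : Pt d → Pt d) (x : Pt d) (a b : Fin d) : ℝ :=
  fderiv ℝ u x (EuclideanSpace.single b (1 : ℝ)) a

/-- The strain tensor `D(u) = (∇u + (∇u)ᵀ) / 2`. -/
def strain {d : ℕ} (u : Pt d → Pt d) (x : Pt d) : Matrix (Fin d) (Fin d) ℝ :=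
  Matrix.of fun a b => (partialDeriv u x a b + partialDeriv u x b a) / 2

/-- The divergence `∇ · u`. -/
def divergence {d : ℕ} (u : Pt d → Pt d) (x : Pt d) : ℝ := ∑ a, partialDeriv u x a a

/-! ### The matrices -/

namespace FESpace

variable {d : ℕ} {R : RefElement d} {Ω ΓD : Set (Pt d)}

/-- Mass matrix `M`, with entries `ρ (ψ_q, ψ_p)_Ω`. -/
def massMatrix (V : FESpace R Ω ΓD) (ρ : ℝ) :
    Matrix (Fin V.N × Fin d) (Fin V.N × Fin d) ℝ :=
  Matrix.of fun p q => ρ * ∫ x in Ω, inner ℝ (V.basisField q x) (V.basisField p x)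

/-- Stiffness matrix `K`, with entries `2 ν (D(ψ_q), D(ψ_p))_Ω`. -/
def stiffnessMatrix (V : FESpace R Ω ΓD) (ν : ℝ) :
    Matrix (Fin V.N × Fin d) (Fin V.N × Fin d) ℝ :=
  Matrix.of fun p q => 2 * ν * ∫ x in Ω, ∑ a, ∑ b,
    strain (V.basisField q) x a b * strain (V.basisField p) x a b

/-- Divergence matrix `L`, with entries `lam (∇ · ψ_q, ∇ · ψ_p)_Ω`. -/
def divMatrix (V : FESpace R Ω ΓD) (lam : ℝ) :
    Matrix (Fin V.N × Fin d) (Fin V.N × Fin d) ℝ :=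
  Matrix.of fun p q => lam * ∫ x in Ω,
    divergence (V.basisField q) x * divergence (V.basisField p) x

/-- Fluid block `W_f = M_f + Δt K_f`. -/
def fluidBlock (U : FESpace R Ω ΓD) (ρ ν Δt : ℝ) :
    Matrix (Fin U.N × Fin d) (Fin U.N × Fin d) ℝ :=
  U.massMatrix ρ + Δt • U.stiffnessMatrix ν

/-- Structure block `W_s = M_s + Δt² (K_s + L)`. -/
def structureBlock (X : FESpace R Ω ΓD) (ρ ν lam Δt : ℝ) :
    Matrix (Fin X.N × Fin d) (Fin X.N × Fin d) ℝ :=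
  X.massMatrix ρ + Δt ^ 2 • (X.stiffnessMatrix ν + X.divMatrix lam)

end FESpace

/-- The block diagonal matrix `W = diag(W_f, W_s)`. -/
def matrixW {d : ℕ} {Rf Rs : RefElement d} {Ωf ΓDf Ωs ΓDs : Set (Pt d)}
    (U : FESpace Rf Ωf ΓDf) (X : FESpace Rs Ωs ΓDs) (ρf νf ρs νs lam Δt : ℝ) :
    Matrix ((Fin U.N × Fin d) ⊕ (Fin X.N × Fin d)) ((Fin U.N × Fin d) ⊕ (Fin X.N × Fin d)) ℝ :=
  Matrix.fromBlocks (U.fluidBlock ρf νf Δt) 0 0 (X.structureBlock ρs νs lam Δt)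

/-! ### Eigenvalues and condition number -/

/-- The (finite) set of real eigenvalues of a real square matrix. -/
def eigenvalueSet {n : Type*} [Fintype n] (A : Matrix n n ℝ) : Set ℝ :=
  {μ | ∃ v : n → ℝ, v ≠ 0 ∧ A *ᵥ v = μ • v}

/-- The largest eigenvalue. -/
def muMax {n : Type*} [Fintype n] (A : Matrix n n ℝ) : ℝ := sSup (eigenvalueSet A)

/-- The smallest eigenvalue. -/
def muMin {n : Type*} [Fintype n] (A : Matrix n n ℝ) : ℝ := sInf (eigenvalueSet A)

/-- The condition number `κ(A) = |A| |A⁻¹|` in the matrix norm induced by the Euclidean norm. -/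
def cond {n : Type*} [Fintype n] [DecidableEq n] (A : Matrix n n ℝ) : ℝ := ‖A‖ * ‖A⁻¹‖

end FSI

end

/-! `W` is symmetric and block diagonal, so it suffices to bound the quadratic form of each block
from both sides by multiples of |c|² (`spectral_bounds`). For a finite element field v with
coefficients c, each form is ρ‖v‖² + τ(2ν‖D(v)‖² + λ‖∇·v‖²), where τ = Δt and λ = 0 for the fluid
and τ = Δt² for the structure (`exists_block_bounds`).

Transport to the reference element, where all norms on the coefficient space are equivalent, gives
‖v‖² ~ h^d |c|² and ‖∇v‖² ≲ h^(d-2) |c|² (`mass_lower`, `field_bounds`, `setIntegral_le`). The term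
τ in the lower bound needs in addition a Korn–Poincaré inequality ‖v‖ ≤ C‖D(v)‖ with C independent
of the mesh (`IsRegular.controlled`).

That inequality is obtained by integration along segments. The derivative of ⟨v, e⟩ along a line of
direction e is eᵀD(v)e, so the strain controls ⟨v(x) - v(y), x - y⟩ (`Admissible.sq_inner_sub_le`).
Some facet of a cell meets the Dirichlet boundary in positive measure. Near a density point of this
part there is a set of positive measure whose points see the Dirichlet boundary along spanning
directions, which controls v on that set (`controlled_interior_of_facet`). Control spreads from a
set of positive measure to every bounded convex subset of Ω that contains it
(`Controlled.of_subset_convex`), hence through the connected set Ω by overlapping balls, and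
finitely many cell interiors cover Ω up to a null set. One triangulation is used to find the
constant, but `Controlled` quantifies over all exceptional sets and all admissible fields, so the
same constant serves every mesh. -/

noncomputable section

namespace FSI

/-! ### Spectral bounds from bounds of the quadratic form -/

section Spectral

variable {n : Type*} [Fintype n]

theorem dotProduct_self_pos_of_ne_zero {v : n → ℝ} (hv : v ≠ 0) : 0 < v ⬝ᵥ v := by
  have h := Matrix.dotProduct_star_self_pos_iff (v := v) |>.2 hv
  simpa using h

theorem posDef_of_quadratic_bound {A : Matrix n n ℝ} (hA : A.IsSymm) {lo : ℝ} (hlo : 0 < lo)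
    (h : ∀ v : n → ℝ, lo * (v ⬝ᵥ v) ≤ v ⬝ᵥ A *ᵥ v) : A.PosDef := by
  refine Matrix.PosDef.of_dotProduct_mulVec_pos ?_ fun v hv => ?_
  · rw [Matrix.IsHermitian, Matrix.conjTranspose_eq_transpose_of_trivial]
    exact hA
  · have := mul_pos hlo (dotProduct_self_pos_of_ne_zero hv)
    simpa using this.trans_le (h v)

theorem eigenvalueSet_bounds {A : Matrix n n ℝ} {lo hi : ℝ}
    (h1 : ∀ v : n → ℝ, lo * (v ⬝ᵥ v) ≤ v ⬝ᵥ A *ᵥ v)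
    (h2 : ∀ v : n → ℝ, v ⬝ᵥ A *ᵥ v ≤ hi * (v ⬝ᵥ v)) {μ : ℝ} (hμ : μ ∈ eigenvalueSet A) :
    lo ≤ μ ∧ μ ≤ hi := by
  obtain ⟨v, hv, hAv⟩ := hμ
  have hp := dotProduct_self_pos_of_ne_zero hv
  have h1 := h1 v
  have h2 := h2 v
  rw [hAv, dotProduct_smul, smul_eq_mul] at h1 h2
  exact ⟨le_of_mul_le_mul_right h1 hp, le_of_mul_le_mul_right h2 hp⟩

variable [DecidableEq n]

theorem eigenvalueSet_eq_range {A : Matrix n n ℝ} (hA : A.IsHermitian) :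
    eigenvalueSet A = Set.range hA.eigenvalues := by
  rw [← hA.spectrum_real_eq_range_eigenvalues]
  ext μ
  rw [← Matrix.spectrum_toLin', ← Module.End.hasEigenvalue_iff_mem_spectrum]
  constructor
  · rintro ⟨v, hv, h⟩
    exact Module.End.hasEigenvalue_of_hasEigenvector (x := v)
      ⟨Module.End.mem_eigenspace_iff.2 (by simpa using h), hv⟩
  · intro h
    obtain ⟨v, hv⟩ := h.exists_hasEigenvector
    exact ⟨v, hv.2, by simpa using hv.apply_eq_smul⟩

/-- The operator norm is invariant under unitary conjugation; on the right stands the sup norm of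
the tuple of eigenvalues. -/
theorem norm_eq_norm_eigenvalues {A : Matrix n n ℝ} (hA : A.IsHermitian) :
    ‖A‖ = ‖hA.eigenvalues‖ := by
  conv_lhs => rw [hA.spectral_theorem]
  rw [Unitary.conjStarAlgAut_apply, ← Unitary.coe_star, CStarRing.norm_mul_coe_unitary,
    CStarRing.norm_coe_unitary_mul, Matrix.l2_opNorm_diagonal]
  rfl

theorem norm_inv_eq_norm_inv_eigenvalues {A : Matrix n n ℝ} (hA : A.PosDef) :
    ‖A⁻¹‖ = ‖fun i => (hA.1.eigenvalues i)⁻¹‖ := by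
  have hpos := hA.eigenvalues_pos
  set U := hA.1.eigenvectorUnitary
  have hs : A = (U : Matrix n n ℝ) * Matrix.diagonal hA.1.eigenvalues *
      ((star U : unitary (Matrix n n ℝ)) : Matrix n n ℝ) := by
    conv_lhs => rw [hA.1.spectral_theorem]
    rw [Unitary.conjStarAlgAut_apply, ← Unitary.coe_star]
    rfl
  have hinv : A⁻¹ = (U : Matrix n n ℝ) * Matrix.diagonal (fun i => (hA.1.eigenvalues i)⁻¹) *
      ((star U : unitary (Matrix n n ℝ)) : Matrix n n ℝ) := by
    apply Matrix.inv_eq_right_inv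
    have h1 : ((star U : unitary (Matrix n n ℝ)) : Matrix n n ℝ) * (U : Matrix n n ℝ) = 1 := by
      rw [Unitary.coe_star]; exact Unitary.coe_star_mul_self U
    have h2 : (U : Matrix n n ℝ) * ((star U : unitary (Matrix n n ℝ)) : Matrix n n ℝ) = 1 := by
      rw [Unitary.coe_star]; exact Unitary.coe_mul_star_self U
    have h3 : Matrix.diagonal hA.1.eigenvalues *
        Matrix.diagonal (fun i => (hA.1.eigenvalues i)⁻¹) = 1 := by
      rw [Matrix.diagonal_mul_diagonal]
      simp [fun i => mul_inv_cancel₀ (hpos i).ne']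
    calc _ = (U : Matrix n n ℝ) * (Matrix.diagonal hA.1.eigenvalues *
          (((star U : unitary (Matrix n n ℝ)) : Matrix n n ℝ) * (U : Matrix n n ℝ)) *
          Matrix.diagonal (fun i => (hA.1.eigenvalues i)⁻¹)) *
          ((star U : unitary (Matrix n n ℝ)) : Matrix n n ℝ) := by
            conv_lhs => enter [1]; rw [hs]
            simp only [mul_assoc]
      _ = 1 := by rw [h1, mul_one, h3, mul_one, h2]
  rw [hinv, CStarRing.norm_mul_coe_unitary, CStarRing.norm_coe_unitary_mul,
    Matrix.l2_opNorm_diagonal]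

theorem cond_eq_muMax_div_muMin {A : Matrix n n ℝ} (hA : A.PosDef) :
    cond A = muMax A / muMin A := by
  have hpos := hA.eigenvalues_pos
  rw [cond, muMax, muMin, norm_eq_norm_eigenvalues hA.1, norm_inv_eq_norm_inv_eigenvalues hA,
    eigenvalueSet_eq_range hA.1]
  set f := hA.1.eigenvalues
  -- Without degrees of freedom both norms vanish, and `sSup ∅ = sInf ∅ = 0` with `0 / 0 = 0` keeps
  -- the identity true.
  rcases isEmpty_or_nonempty n with hn | hn
  · simp [Set.range_eq_empty, Pi.norm_def]
  · have hfin : (Set.range f).Finite := Set.finite_range f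
    obtain ⟨i, hi⟩ := (Set.range_nonempty f).csSup_mem hfin
    obtain ⟨j, hj⟩ := (Set.range_nonempty f).csInf_mem hfin
    have hle : ∀ k, f k ≤ f i := fun k => hi ▸ le_csSup hfin.bddAbove ⟨k, rfl⟩
    have hge : ∀ k, f j ≤ f k := fun k => hj ▸ csInf_le hfin.bddBelow ⟨k, rfl⟩
    rw [← hi, ← hj, div_eq_mul_inv]
    congr 1
    · refine le_antisymm ((pi_norm_le_iff_of_nonneg (hpos i).le).2 fun k => ?_) ?_
      · rw [Real.norm_of_nonneg (hpos k).le]; exact hle k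
      · rw [← Real.norm_of_nonneg (hpos i).le]; exact norm_le_pi_norm f i
    · refine le_antisymm ((pi_norm_le_iff_of_nonneg (inv_pos.2 (hpos j)).le).2 fun k => ?_) ?_
      · rw [Real.norm_of_nonneg (inv_pos.2 (hpos k)).le]
        exact inv_anti₀ (hpos j) (hge k)
      · rw [← Real.norm_of_nonneg (inv_pos.2 (hpos j)).le]
        exact norm_le_pi_norm (fun k => (f k)⁻¹) j

omit [DecidableEq n] in
theorem muMax_div_muMin_le {A : Matrix n n ℝ} {lo hi : ℝ} (hlo : 0 < lo) (hhi : 0 ≤ hi)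
    (h : ∀ μ ∈ eigenvalueSet A, lo ≤ μ ∧ μ ≤ hi) : muMax A / muMin A ≤ hi / lo := by
  rw [muMax, muMin]
  rcases (eigenvalueSet A).eq_empty_or_nonempty with he | hne
  · rw [he]; simpa using div_nonneg hhi hlo.le
  · exact div_le_div₀ hhi (csSup_le hne fun μ hμ => (h μ hμ).2) hlo
      (le_csInf hne fun μ hμ => (h μ hμ).1)

theorem spectral_bounds {A : Matrix n n ℝ} (hA : A.IsSymm) {lo hi : ℝ} (hlo : 0 < lo)
    (hhi : 0 ≤ hi) (h1 : ∀ v : n → ℝ, lo * (v ⬝ᵥ v) ≤ v ⬝ᵥ A *ᵥ v)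
    (h2 : ∀ v : n → ℝ, v ⬝ᵥ A *ᵥ v ≤ hi * (v ⬝ᵥ v)) :
    A.PosDef ∧ (∀ μ ∈ eigenvalueSet A, lo ≤ μ ∧ μ ≤ hi) ∧
      cond A = muMax A / muMin A ∧ cond A ≤ hi / lo := by
  have hp := posDef_of_quadratic_bound hA hlo h1
  have he : ∀ μ ∈ eigenvalueSet A, lo ≤ μ ∧ μ ≤ hi := fun μ hμ => eigenvalueSet_bounds h1 h2 hμ
  have hc := cond_eq_muMax_div_muMin hp
  exact ⟨hp, he, hc, hc ▸ muMax_div_muMin_le hlo hhi he⟩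

end Spectral

/-- A positive continuous function which is homogeneous of degree two is bounded below by a
multiple of the square of the norm. -/
theorem exists_pos_mul_sq_le {E : Type*} [NormedAddCommGroup E] [NormedSpace ℝ E]
    [FiniteDimensional ℝ E] {q : E → ℝ} (hq : Continuous q)
    (hom : ∀ (t : ℝ) v, q (t • v) = t ^ 2 * q v) (pos : ∀ v, v ≠ 0 → 0 < q v) :
    ∃ α : ℝ, 0 < α ∧ ∀ v, α * ‖v‖ ^ 2 ≤ q v := by
  rcases (Metric.sphere (0 : E) 1).eq_empty_or_nonempty with he | hne
  · refine ⟨1, one_pos, fun v => ?_⟩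
    have hv : v = 0 := by
      by_contra hv
      have : ‖v‖⁻¹ • v ∈ Metric.sphere (0 : E) 1 := by
        simp [norm_smul, norm_ne_zero_iff.2 hv]
      simp [he] at this
    have := hom 0 0
    rw [smul_zero] at this
    subst hv
    rw [this]; simp
  · obtain ⟨w, hw, hmin⟩ := (isCompact_sphere (0 : E) 1).exists_isMinOn hne hq.continuousOn
    have hw0 : w ≠ 0 := by rintro rfl; simp at hw
    refine ⟨q w, pos w hw0, fun v => ?_⟩
    rcases eq_or_ne v 0 with rfl | hv
    · have := hom 0 0
      rw [smul_zero] at this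
      rw [this]; simp
    · have hn : ‖v‖ ≠ 0 := norm_ne_zero_iff.2 hv
      have h1 : q w ≤ q (‖v‖⁻¹ • v) := hmin (by simp [norm_smul, hn])
      rw [hom, inv_pow, inv_mul_eq_div, le_div_iff₀ (by positivity)] at h1
      exact h1

end FSI

end

/-! ### Strain and increments along segments -/

noncomputable section

namespace FSI

open Set Filter Topology
open scoped ENNReal NNReal RealInnerProductSpace

variable {d : ℕ}

/-- The squared Frobenius norm of the strain tensor. -/
def energy (u : Pt d → Pt d) (x : Pt d) : ℝ := ∑ a, ∑ b, strain u x a b * strain u x a b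

theorem energy_nonneg (u : Pt d → Pt d) (x : Pt d) : 0 ≤ energy u x :=
  Finset.sum_nonneg fun _ _ => Finset.sum_nonneg fun _ _ => mul_self_nonneg _

theorem measurable_partialDeriv (u : Pt d → Pt d) (a b : Fin d) :
    Measurable fun x => partialDeriv u x a b := by
  have h := measurable_fderiv_apply_const ℝ u (EuclideanSpace.single b (1 : ℝ))
  exact (EuclideanSpace.proj (𝕜 := ℝ) a).continuous.measurable.comp h

theorem measurable_strain (u : Pt d → Pt d) (a b : Fin d) :
    Measurable fun x => strain u x a b := by
  simp only [strain, Matrix.of_apply]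
  exact ((measurable_partialDeriv u a b).add (measurable_partialDeriv u b a)).div_const 2

theorem measurable_divergence (u : Pt d → Pt d) : Measurable (divergence u) :=
  Finset.measurable_sum _ fun a _ => measurable_partialDeriv u a a

theorem measurable_energy (u : Pt d → Pt d) : Measurable (energy u) :=
  Finset.measurable_sum _ fun a _ => Finset.measurable_sum _ fun b _ =>
    (measurable_strain u a b).mul (measurable_strain u a b)

/-- Only the symmetric part of a matrix enters its quadratic form. This is why the strain alone,
without the full gradient, governs ⟨v, e⟩ along lines of direction e. -/
theorem inner_fderiv_self (u : Pt d → Pt d) (x e : Pt d) :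
    ⟪fderiv ℝ u x e, e⟫ = ∑ p : Fin d × Fin d, (e p.1 * e p.2) * strain u x p.1 p.2 := by
  have he : e = ∑ b, e b • EuclideanSpace.single b (1 : ℝ) := by
    ext a; simp [Finset.sum_apply, Pi.single_apply]
  have h1 : ∀ a, fderiv ℝ u x e a = ∑ b, e b * partialDeriv u x a b := by
    intro a
    conv_lhs => rw [he]
    simp [partialDeriv]
  have h2 : ⟪fderiv ℝ u x e, e⟫ = ∑ a, ∑ b, e a * e b * partialDeriv u x a b := by
    rw [PiLp.inner_apply]
    refine Finset.sum_congr rfl fun a _ => ?_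
    simp only [h1, RCLike.inner_apply, conj_trivial, Finset.mul_sum]
    exact Finset.sum_congr rfl fun b _ => by ring
  have h3 : ∑ a, ∑ b, e a * e b * partialDeriv u x a b =
      ∑ a, ∑ b, e a * e b * partialDeriv u x b a := by
    rw [Finset.sum_comm]
    exact Finset.sum_congr rfl fun a _ => Finset.sum_congr rfl fun b _ => by ring
  rw [Fintype.sum_prod_type]
  simp only [strain, Matrix.of_apply]
  have h4 : ∑ a, ∑ b, e a * e b * ((partialDeriv u x a b + partialDeriv u x b a) / 2) =
      (∑ a, ∑ b, e a * e b * partialDeriv u x a b +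
        ∑ a, ∑ b, e a * e b * partialDeriv u x b a) / 2 := by
    rw [← Finset.sum_add_distrib, Finset.sum_div]
    refine Finset.sum_congr rfl fun a _ => ?_
    rw [← Finset.sum_add_distrib, Finset.sum_div]
    exact Finset.sum_congr rfl fun b _ => by ring
  rw [h4, ← h3, h2]
  ring

/-- Cauchy–Schwarz over pairs of indices; ‖e‖⁴ is the squared Frobenius norm of e eᵀ. -/
theorem sq_inner_fderiv_self_le (u : Pt d → Pt d) (x e : Pt d) :
    ⟪fderiv ℝ u x e, e⟫ ^ 2 ≤ ‖e‖ ^ 4 * energy u x := by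
  rw [inner_fderiv_self]
  refine (Finset.sum_mul_sq_le_sq_mul_sq _ _ _).trans_eq ?_
  have h1 : ∑ p : Fin d × Fin d, (e p.1 * e p.2) ^ 2 = ‖e‖ ^ 4 := by
    rw [Fintype.sum_prod_type]
    have : ‖e‖ ^ 4 = (‖e‖ ^ 2) * ‖e‖ ^ 2 := by ring
    rw [this, EuclideanSpace.real_norm_sq_eq, Finset.sum_mul_sum]
    simp only [mul_pow]
  rw [h1, energy, Fintype.sum_prod_type]
  simp only [sq]

theorem sq_lintegral_le {α : Type*} [MeasurableSpace α] (μ : Measure α) {f : α → ℝ≥0∞}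
    (hf : AEMeasurable f μ) : (∫⁻ x, f x ∂μ) ^ 2 ≤ μ univ * ∫⁻ x, f x ^ 2 ∂μ := by
  have h := ENNReal.lintegral_mul_le_Lp_mul_Lq μ Real.HolderConjugate.two_two
    (f := fun _ => 1) (g := f) aemeasurable_const hf
  simp only [Pi.mul_apply, one_mul, ENNReal.one_rpow, lintegral_const] at h
  have h2 := pow_le_pow_left' h 2
  refine h2.trans_eq ?_
  rw [mul_pow, ← ENNReal.rpow_mul_natCast, ← ENNReal.rpow_mul_natCast]
  norm_num

/-- Continuous vector fields on `closure Ω` which vanish on `Γ` and have a bounded derivative on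
`Ω` off a null set `Z` that is met by lines through points outside of `Z` in countable sets. -/
structure Admissible (Ω Γ Z : Set (Pt d)) (v : Pt d → Pt d) : Prop where
  continuousOn : ContinuousOn v (closure Ω)
  vanish : ∀ x ∈ Γ, v x = 0
  null : volume Z = 0
  countable : ∀ x ∉ Z, ∀ e : Pt d, {t : ℝ | x + t • e ∈ Z}.Countable
  differentiableAt : ∀ x ∈ Ω \ Z, DifferentiableAt ℝ v x
  bounded : ∃ M : ℝ, ∀ x ∈ Ω \ Z, ‖fderiv ℝ v x‖ ≤ M

variable {Ω Γ Z : Set (Pt d)} {v : Pt d → Pt d}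

/-- Fundamental theorem of calculus for σ ↦ ⟨v(x - σe), e⟩, which tolerates countably many points
without derivative, followed by Cauchy–Schwarz in σ. The end points need only lie in the closure, so
that a segment may end on the Dirichlet boundary. -/
theorem Admissible.sq_inner_sub_le (hv : Admissible Ω Γ Z v) {x e : Pt d} {s : ℝ} (hs : 0 < s)
    (hx : x ∉ Z) (hc : ∀ σ ∈ Icc 0 s, x - σ • e ∈ closure Ω)
    (hi : ∀ σ ∈ Ioo 0 s, x - σ • e ∈ Ω) :
    ENNReal.ofReal (⟪v x - v (x - s • e), e⟫ ^ 2) ≤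
      ENNReal.ofReal (s * ‖e‖ ^ 4) *
        ∫⁻ σ in Ioo 0 s, ENNReal.ofReal (energy v (x - σ • e)) := by
  obtain ⟨M, hM⟩ := hv.bounded
  set f : ℝ → ℝ := fun σ => ⟪v (x - σ • e), e⟫ with hf
  set f' : ℝ → ℝ := fun σ => -⟪fderiv ℝ v (x - σ • e) e, e⟫ with hf'
  set S : Set ℝ := {t | x - t • e ∈ Z} with hS
  have hScount : S.Countable := by
    have := hv.countable x hx (-e)
    simpa [hS, sub_eq_add_neg] using this
  have hpath : Continuous fun σ : ℝ => x - σ • e := by fun_prop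
  have hmeas : Measurable f' := by
    have h1 := (measurable_fderiv_apply_const ℝ v e).comp hpath.measurable
    exact (h1.inner_const).neg
  have hfc : ContinuousOn f (Icc 0 s) := by
    refine ContinuousOn.inner (hv.continuousOn.comp hpath.continuousOn hc) continuousOn_const
  have hder : ∀ σ ∈ Ioo 0 s \ S, HasDerivAt f (f' σ) σ := by
    intro σ hσ
    have hd := (hv.differentiableAt _ ⟨hi σ hσ.1, hσ.2⟩).hasFDerivAt
    have hp : HasDerivAt (fun σ : ℝ => x - σ • e) (-e) σ := by
      simpa using ((hasDerivAt_id σ).smul_const e).const_sub x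
    have h2 := (hd.comp_hasDerivAt σ hp).inner ℝ (hasDerivAt_const σ e)
    simpa [hf, hf'] using! h2
  -- The bound on the derivative is used only to make `f'` integrable; it does not enter the final
  -- constant.
  have hae : ∀ᵐ σ ∂(volume.restrict (Ioc 0 s)), ‖f' σ‖ ≤ M * ‖e‖ * ‖e‖ := by
    have h0 : volume (S ∪ {s}) = 0 := (hScount.union (countable_singleton s)).measure_zero _
    have h1 : ∀ᵐ σ ∂(volume.restrict (Ioc 0 s)), σ ∉ S ∪ {s} :=
      ae_restrict_of_ae (measure_eq_zero_iff_ae_notMem.1 h0)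
    filter_upwards [h1, ae_restrict_mem measurableSet_Ioc] with σ h2 h3
    simp only [mem_union, mem_singleton_iff, not_or] at h2
    have hmem : x - σ • e ∈ Ω \ Z := ⟨hi σ ⟨h3.1, lt_of_le_of_ne h3.2 h2.2⟩, h2.1⟩
    rw [hf', norm_neg]
    refine (norm_inner_le_norm _ _).trans ?_
    gcongr
    exact ((fderiv ℝ v (x - σ • e)).le_opNorm e).trans (by gcongr; exact hM _ hmem)
  have hint : IntervalIntegrable f' volume 0 s := by
    rw [intervalIntegrable_iff_integrableOn_Ioc_of_le hs.le]
    exact Measure.integrableOn_of_bounded (by simp) hmeas.aestronglyMeasurable hae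
  have hftc := MeasureTheory.integral_eq_of_hasDerivAt_off_countable_of_le f f' hs.le hScount
    hfc hder hint
  rw [intervalIntegral.integral_of_le hs.le, integral_Ioc_eq_integral_Ioo] at hftc
  have h0 : ⟪v x - v (x - s • e), e⟫ = -(f s - f 0) := by
    simp [hf, inner_sub_left]
  rw [h0, ← hftc, neg_sq]
  have h1 : ENNReal.ofReal ((∫ σ in Ioo 0 s, f' σ) ^ 2) ≤ (∫⁻ σ in Ioo 0 s, ‖f' σ‖ₑ) ^ 2 := by
    rw [← sq_abs, ENNReal.ofReal_pow (abs_nonneg _)]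
    refine pow_le_pow_left' ?_ 2
    rw [← Real.norm_eq_abs, ofReal_norm]
    exact enorm_integral_le_lintegral_enorm _
  refine h1.trans ((sq_lintegral_le _ hmeas.enorm.aemeasurable).trans ?_)
  rw [Measure.restrict_apply_univ, Real.volume_Ioo, sub_zero, ENNReal.ofReal_mul hs.le, mul_assoc]
  gcongr
  rw [← lintegral_const_mul' _ _ ENNReal.ofReal_ne_top]
  refine lintegral_mono fun σ => ?_
  rw [← ENNReal.ofReal_mul (by positivity), ← ofReal_norm,
    ← ENNReal.ofReal_pow (norm_nonneg _)]
  refine ENNReal.ofReal_le_ofReal ?_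
  rw [Real.norm_eq_abs, sq_abs, hf', neg_sq]
  exact sq_inner_fderiv_self_le v _ e

end FSI

end

/-! ### Propagation of control to convex sets -/

noncomputable section

namespace FSI

open Set Filter Topology
open scoped ENNReal NNReal RealInnerProductSpace

variable {d : ℕ} {Ω Γ Z : Set (Pt d)} {v : Pt d → Pt d}

/-- The `L²` norm on `A` is controlled by the strain on `Ω`, uniformly in admissible fields. -/
def Controlled (Ω Γ A : Set (Pt d)) : Prop :=
  ∃ C : ℝ≥0, ∀ Z v, Admissible Ω Γ Z v →
    ∫⁻ x in A, ‖v x‖ₑ ^ 2 ≤ C * ∫⁻ x in Ω, ENNReal.ofReal (energy v x)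

theorem Controlled.mono {A B : Set (Pt d)} (hB : Controlled Ω Γ B) (h : A ⊆ B) :
    Controlled Ω Γ A := by
  obtain ⟨C, hC⟩ := hB
  exact ⟨C, fun Z v hv => (lintegral_mono_set h).trans (hC Z v hv)⟩

theorem volume_affine_zero_eq_zero {s : Pt d →ᵃ[ℝ] ℝ} (hs : s.linear ≠ 0) :
    volume {x | s x = 0} = 0 := by
  have h : {x | s x = 0} = (AffineSubspace.comap s (AffineSubspace.mk' 0 ⊥) : Set (Pt d)) := by
    ext x; simp [AffineSubspace.mem_mk']
  rw [h]
  refine Measure.addHaar_affineSubspace volume _ fun htop => hs ?_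
  have hz : ∀ x, s x = 0 := fun x => by
    have : x ∈ AffineSubspace.comap s (AffineSubspace.mk' (0 : ℝ) ⊥) := by rw [htop]; trivial
    simpa [AffineSubspace.mem_mk'] using this
  ext w
  have h1 := s.linearMap_vsub w 0
  simpa [hz] using h1

/-- The form (w, b) ↦ ∫ (b - ⟨w, y⟩)² dy is positive definite because a set of positive measure lies
in no hyperplane. Leaving b free, and then setting b = ⟨w, x⟩, makes the bound uniform in x. -/
theorem exists_covariance_bound {A : Set (Pt d)} (hA : IsCompact A) (hA0 : volume A ≠ 0) :
    ∃ c : ℝ, 0 < c ∧ ∀ x w : Pt d,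
      ENNReal.ofReal (c * ‖w‖ ^ 2) ≤ ∫⁻ y in A, ENNReal.ofReal (⟪w, x - y⟫ ^ 2) := by
  set q : Pt d × ℝ → ℝ := fun p => ∫ y in A, (p.2 - ⟪p.1, y⟫) ^ 2 with hq
  have hint : ∀ p : Pt d × ℝ, IntegrableOn (fun y => (p.2 - ⟪p.1, y⟫) ^ 2) A := fun p =>
    (Continuous.continuousOn (by fun_prop)).integrableOn_compact hA
  have hcont : Continuous q := by
    refine continuous_parametric_integral_of_continuous (μ := volume) (s := A)
      (f := fun (p : Pt d × ℝ) y => (p.2 - ⟪p.1, y⟫) ^ 2) ?_ hA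
    fun_prop
  obtain ⟨c, hc, h⟩ := exists_pos_mul_sq_le hcont
    (fun t p => by
      simp only [hq, Prod.smul_fst, Prod.smul_snd, smul_eq_mul, real_inner_smul_left]
      rw [← integral_const_mul]
      congr 1; ext y; ring)
    (fun p hp => by
      refine lt_of_le_of_ne (integral_nonneg fun y => sq_nonneg _) fun h0 => ?_
      have h1 := (setIntegral_eq_zero_iff_of_nonneg_ae
        (Eventually.of_forall fun y => sq_nonneg _) (hint p)).1 h0.symm
      have h2 : volume {y | y ∈ A ∧ p.2 - ⟪p.1, y⟫ ≠ 0} = 0 := by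
        have := (ae_restrict_iff' hA.measurableSet).1 h1
        rw [ae_iff] at this
        refine measure_mono_null ?_ this
        rintro y ⟨hy, hne⟩
        simpa [hy] using hne
      set s : Pt d →ᵃ[ℝ] ℝ :=
        AffineMap.const ℝ _ p.2 - (innerSL ℝ p.1).toLinearMap.toAffineMap with hs
      have hsapp : ∀ y, s y = p.2 - ⟪p.1, y⟫ := fun y => by simp [hs]
      have h3 : volume {y | s y = 0} ≠ 0 := by
        intro h3
        refine hA0 (measure_mono_null ?_ (measure_union_null h2 h3))
        intro y hy
        by_cases hy0 : s y = 0
        · exact Or.inr hy0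
        · exact Or.inl ⟨hy, by rwa [hsapp] at hy0⟩
      have h4 : p.1 = 0 := by
        by_contra hne
        refine h3 (volume_affine_zero_eq_zero fun hl => hne ?_)
        have := congrArg (fun l => l p.1) hl
        simpa [hs] using this
      -- With w = 0 the function `s` is a nonzero constant, so its zero set is empty.
      have h5 : p.2 ≠ 0 := fun h5 => hp (Prod.ext h4 h5)
      refine h3 ?_
      simp [hsapp, h4, h5])
  refine ⟨c, hc, fun x w => ?_⟩
  have h1 := h (w, ⟪w, x⟫)
  have h2 : c * ‖w‖ ^ 2 ≤ ∫ y in A, ⟪w, x - y⟫ ^ 2 := by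
    refine le_trans ?_ (h1.trans_eq ?_)
    -- The norm of the pair (w, b) is a maximum and dominates ‖w‖.
    · gcongr; exact le_max_left _ _
    · simp only [hq, inner_sub_right]
  refine (ENNReal.ofReal_le_ofReal h2).trans_eq ?_
  refine ofReal_integral_eq_lintegral_ofReal ?_ (Eventually.of_forall fun y => sq_nonneg _)
  have h3 := hint (w, ⟪w, x⟫)
  simp only [← inner_sub_right] at h3
  exact h3

theorem lintegral_comp_smul_add_le {g : Pt d → ℝ≥0∞} (hg : Measurable g) {t : ℝ}
    (ht : 1 / 2 ≤ t) (z : Pt d) : ∫⁻ x, g (t • x + z) ≤ 2 ^ d * ∫⁻ x, g x := by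
  have ht0 : 0 < t := by linarith
  have h1 : ∫⁻ x, g (t • x + z) =
      ∫⁻ x, g (x + z) ∂(Measure.map (fun x : Pt d => t • x) volume) := by
    rw [lintegral_map (by fun_prop) (by fun_prop)]
  rw [h1, Measure.map_addHaar_smul _ ht0.ne', lintegral_smul_measure,
    lintegral_add_right_eq_self, smul_eq_mul]
  gcongr
  rw [finrank_euclideanSpace_fin, abs_of_pos (by positivity)]
  refine ENNReal.ofReal_le_of_le_toReal ?_
  rw [ENNReal.toReal_pow, ENNReal.toReal_ofNat, ← inv_pow]
  refine pow_le_pow_left₀ (by positivity) ?_ d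
  rw [inv_le_comm₀ ht0 two_pos]
  linarith

/-- The point x - σ(x - y) = (1 - σ)x + σy is a dilation of x with factor at least 1/2 if σ ≤ 1/2,
and of y otherwise. Integrating first in that variable costs at most 2^d, uniformly in σ. -/
theorem lintegral_segment_le {g : Pt d → ℝ≥0∞} (hg : Measurable g) (A C : Set (Pt d)) :
    ∫⁻ x in C, ∫⁻ y in A, ∫⁻ σ in Ioo (0 : ℝ) 1, g (x - σ • (x - y)) ≤
      2 ^ d * (volume A + volume C) * ∫⁻ x, g x := by
  have hm : Measurable fun p : (Pt d × Pt d) × ℝ => g (p.1.1 - p.2 • (p.1.1 - p.1.2)) :=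
    hg.comp (by fun_prop)
  have key : ∀ σ : ℝ, ∫⁻ x in C, ∫⁻ y in A, g (x - σ • (x - y)) ≤
      2 ^ d * (volume A + volume C) * ∫⁻ x, g x := by
    intro σ
    rcases le_total σ (1 / 2) with h | h
    · rw [lintegral_lintegral_swap (by
        refine Measurable.aemeasurable ?_
        exact hg.comp (by fun_prop))]
      calc ∫⁻ y in A, ∫⁻ x in C, g (x - σ • (x - y))
          ≤ ∫⁻ y in A, 2 ^ d * ∫⁻ x, g x := by
            refine lintegral_mono fun y => (setLIntegral_le_lintegral _ _).trans ?_
            refine le_trans (le_of_eq ?_)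
              (lintegral_comp_smul_add_le hg (t := 1 - σ) (by linarith) (σ • y))
            congr 1; ext x; congr 1; module
        _ = 2 ^ d * volume A * ∫⁻ x, g x := by
            rw [lintegral_const, Measure.restrict_apply_univ]; ring
        _ ≤ _ := by gcongr; exact le_self_add
    · calc ∫⁻ x in C, ∫⁻ y in A, g (x - σ • (x - y))
          ≤ ∫⁻ x in C, 2 ^ d * ∫⁻ x, g x := by
            refine lintegral_mono fun x => (setLIntegral_le_lintegral _ _).trans ?_
            refine le_trans (le_of_eq ?_)
              (lintegral_comp_smul_add_le hg (t := σ) (by linarith) ((1 - σ) • x))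
            congr 1; ext y; congr 1; module
        _ = 2 ^ d * volume C * ∫⁻ x, g x := by
            rw [lintegral_const, Measure.restrict_apply_univ]; ring
        _ ≤ _ := by gcongr; exact le_add_self
  calc ∫⁻ x in C, ∫⁻ y in A, ∫⁻ σ in Ioo (0 : ℝ) 1, g (x - σ • (x - y))
      = ∫⁻ x in C, ∫⁻ σ in Ioo (0 : ℝ) 1, ∫⁻ y in A, g (x - σ • (x - y)) := by
        refine lintegral_congr fun x => lintegral_lintegral_swap ?_
        exact (hm.comp (f := fun p : Pt d × ℝ => ((x, p.1), p.2)) (by fun_prop)).aemeasurable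
    _ = ∫⁻ σ in Ioo (0 : ℝ) 1, ∫⁻ x in C, ∫⁻ y in A, g (x - σ • (x - y)) := by
        refine lintegral_lintegral_swap (Measurable.aemeasurable ?_)
        refine Measurable.lintegral_prod_right' (f := fun p : (Pt d × ℝ) × Pt d =>
          g (p.1.1 - p.1.2 • (p.1.1 - p.2))) ?_
        exact hm.comp (f := fun p : (Pt d × ℝ) × Pt d => ((p.1.1, p.2), p.1.2)) (by fun_prop)
    _ ≤ ∫⁻ σ in Ioo (0 : ℝ) 1, 2 ^ d * (volume A + volume C) * ∫⁻ x, g x :=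
        lintegral_mono fun σ => key σ
    _ = _ := by
        rw [lintegral_const, Measure.restrict_apply_univ, Real.volume_Ioo]; simp

/-- Control propagates from a set of positive measure to a convex set which contains it. -/
theorem Controlled.of_subset_convex {A C : Set (Pt d)} (hA : Controlled Ω Γ A)
    (hAm : MeasurableSet A) (hA0 : volume A ≠ 0) (hAC : A ⊆ C) (hC : Convex ℝ C)
    (hCb : Bornology.IsBounded C) (hCm : MeasurableSet C) (hΩ : MeasurableSet Ω) (hCΩ : C ⊆ Ω) :
    Controlled Ω Γ C := by
  -- Inner regularity: the covariance bound requires a compact set.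
  obtain ⟨B, hBA, hB, hB0⟩ := hAm.exists_lt_isCompact (pos_iff_ne_zero.2 hA0)
  obtain ⟨K, hK⟩ := hA.mono hBA
  have hBC := hBA.trans hAC
  obtain ⟨c, hc, hcov⟩ := exists_covariance_bound hB hB0.ne'
  obtain ⟨D, hD⟩ := hCb.exists_norm_le
  have hCvol : volume C ≠ ∞ := hCb.measure_lt_top.ne
  have hBvol : volume B ≠ ∞ := hB.measure_lt_top.ne
  -- Both constants use ‖x - y‖ ≤ 2D and (a + b)² ≤ 2a² + 2b²: `c1` goes with ⟨v y, x - y⟩², `c2`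
  -- with the increment along the segment, which carries ‖x - y‖⁴.
  obtain ⟨c1, hc1⟩ : ∃ c, c = ENNReal.ofReal (2 * (2 * D) ^ 2) := ⟨_, rfl⟩
  obtain ⟨c2, hc2⟩ : ∃ c, c = ENNReal.ofReal (2 * (2 * D) ^ 4) := ⟨_, rfl⟩
  have hc1top : c1 ≠ ∞ := hc1 ▸ ENNReal.ofReal_ne_top
  have hc2top : c2 ≠ ∞ := hc2 ▸ ENNReal.ofReal_ne_top
  set c3 : ℝ≥0∞ := (ENNReal.ofReal c)⁻¹ *
    (volume C * (c1 * K) + c2 * (2 ^ d * (volume B + volume C))) with hc3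
  have hc0 : ENNReal.ofReal c ≠ 0 := by simpa using hc
  have hc3top : c3 ≠ ∞ := by
    refine ENNReal.mul_ne_top (ENNReal.inv_ne_top.2 hc0) (ENNReal.add_ne_top.2 ⟨?_, ?_⟩)
    · exact ENNReal.mul_ne_top hCvol (ENNReal.mul_ne_top hc1top ENNReal.coe_ne_top)
    · exact ENNReal.mul_ne_top hc2top (ENNReal.mul_ne_top (by simp)
        (ENNReal.add_ne_top.2 ⟨hBvol, hCvol⟩))
  refine ⟨c3.toNNReal, fun Z v hv => ?_⟩
  rw [ENNReal.coe_toNNReal hc3top]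
  have hKv := hK Z v hv
  set E := ∫⁻ x in Ω, ENNReal.ofReal (energy v x) with hE
  -- Extension by zero, so that changes of variables can be made on the whole space.
  set g : Pt d → ℝ≥0∞ := Ω.indicator fun x => ENNReal.ofReal (energy v x) with hg
  have hgm : Measurable g := (measurable_energy v).ennreal_ofReal.indicator hΩ
  have hgE : ∫⁻ x, g x = E := lintegral_indicator hΩ _
  have hpt : ∀ x ∈ C \ Z, ∀ y ∈ B, ENNReal.ofReal (⟪v x, x - y⟫ ^ 2) ≤
      c1 * ‖v y‖ₑ ^ 2 + c2 * ∫⁻ σ in Ioo (0 : ℝ) 1, g (x - σ • (x - y)) := by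
    intro x hx y hy
    have hseg : ∀ σ ∈ Icc (0 : ℝ) 1, x - σ • (x - y) ∈ C := by
      intro σ hσ
      have := hC hx.1 (hBC hy) (sub_nonneg.2 hσ.2) hσ.1 (by ring)
      convert this using 1
      module
    have h1 := hv.sq_inner_sub_le (e := x - y) one_pos hx.2
      (fun σ hσ => subset_closure (hCΩ (hseg σ hσ)))
      (fun σ hσ => hCΩ (hseg σ ⟨hσ.1.le, hσ.2.le⟩))
    have hxy : x - (1 : ℝ) • (x - y) = y := by simp
    rw [hxy, one_mul] at h1
    have h2 : ∫⁻ σ in Ioo (0 : ℝ) 1, ENNReal.ofReal (energy v (x - σ • (x - y))) =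
        ∫⁻ σ in Ioo (0 : ℝ) 1, g (x - σ • (x - y)) := by
      refine setLIntegral_congr_fun measurableSet_Ioo fun σ hσ => ?_
      rw [hg, indicator_of_mem (hCΩ (hseg σ ⟨hσ.1.le, hσ.2.le⟩))]
    rw [h2] at h1
    have hn : ‖x - y‖ ≤ 2 * D := by
      refine (norm_sub_le _ _).trans ?_
      linarith [hD x hx.1, hD y (hBC hy)]
    have h3 : ⟪v x, x - y⟫ ^ 2 ≤ 2 * (2 * D) ^ 2 * ‖v y‖ ^ 2 + 2 * ⟪v x - v y, x - y⟫ ^ 2 := by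
      have h4 : ⟪v x, x - y⟫ = ⟪v y, x - y⟫ + ⟪v x - v y, x - y⟫ := by
        rw [← inner_add_left]; congr 1; abel
      have h5 : ⟪v y, x - y⟫ ^ 2 ≤ (2 * D) ^ 2 * ‖v y‖ ^ 2 := by
        rw [← sq_abs, ← mul_pow, mul_comm]
        refine pow_le_pow_left₀ (abs_nonneg _) ((abs_real_inner_le_norm _ _).trans ?_) 2
        gcongr
      rw [h4]
      nlinarith [sq_nonneg (⟪v y, x - y⟫ - ⟪v x - v y, x - y⟫)]
    refine (ENNReal.ofReal_le_ofReal h3).trans ?_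
    rw [ENNReal.ofReal_add (by positivity) (by positivity), ENNReal.ofReal_mul (by positivity),
      ENNReal.ofReal_pow (norm_nonneg _), ofReal_norm, ← hc1,
      ENNReal.ofReal_mul (p := 2) two_pos.le]
    refine add_le_add_right ?_ _
    calc ENNReal.ofReal 2 * ENNReal.ofReal (⟪v x - v y, x - y⟫ ^ 2)
        ≤ ENNReal.ofReal 2 * (ENNReal.ofReal (‖x - y‖ ^ 4) *
          ∫⁻ σ in Ioo (0 : ℝ) 1, g (x - σ • (x - y))) := by gcongr
      _ ≤ c2 * ∫⁻ σ in Ioo (0 : ℝ) 1, g (x - σ • (x - y)) := by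
          rw [← mul_assoc, hc2, ENNReal.ofReal_mul two_pos.le]
          gcongr
  -- Averaging over y ∈ B recovers the full vector v(x) from its components along x - y.
  have hx : ∀ x ∈ C \ Z, ENNReal.ofReal c * ‖v x‖ₑ ^ 2 ≤
      c1 * (K * E) + c2 * ∫⁻ y in B, ∫⁻ σ in Ioo (0 : ℝ) 1, g (x - σ • (x - y)) := by
    intro x hx
    calc ENNReal.ofReal c * ‖v x‖ₑ ^ 2 = ENNReal.ofReal (c * ‖v x‖ ^ 2) := by
          rw [ENNReal.ofReal_mul hc.le, ENNReal.ofReal_pow (norm_nonneg _), ofReal_norm]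
      _ ≤ ∫⁻ y in B, ENNReal.ofReal (⟪v x, x - y⟫ ^ 2) := hcov x (v x)
      _ ≤ ∫⁻ y in B, (c1 * ‖v y‖ₑ ^ 2 + c2 * ∫⁻ σ in Ioo (0 : ℝ) 1, g (x - σ • (x - y))) :=
          setLIntegral_mono' hB.measurableSet fun y hy => hpt x hx y hy
      _ = c1 * (∫⁻ y in B, ‖v y‖ₑ ^ 2) +
          c2 * ∫⁻ y in B, ∫⁻ σ in Ioo (0 : ℝ) 1, g (x - σ • (x - y)) := by
          have hmm : Measurable fun y => ∫⁻ σ in Ioo (0 : ℝ) 1, g (x - σ • (x - y)) :=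
            Measurable.lintegral_prod_right' (f := fun p : Pt d × ℝ => g (x - p.2 • (x - p.1)))
              (hgm.comp (by fun_prop))
          rw [lintegral_add_right _ (hmm.const_mul _), lintegral_const_mul' _ _ hc1top,
            lintegral_const_mul' _ _ hc2top]
      _ ≤ _ := by gcongr
  have hfin : ENNReal.ofReal c * ∫⁻ x in C, ‖v x‖ₑ ^ 2 ≤
      (volume C * (c1 * K) + c2 * (2 ^ d * (volume B + volume C))) * E := by
    have hZ : ∀ᵐ x ∂(volume.restrict C), x ∉ Z :=
      ae_restrict_of_ae (measure_eq_zero_iff_ae_notMem.1 hv.null)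
    calc ENNReal.ofReal c * ∫⁻ x in C, ‖v x‖ₑ ^ 2
        = ∫⁻ x in C, ENNReal.ofReal c * ‖v x‖ₑ ^ 2 :=
          (lintegral_const_mul' _ _ ENNReal.ofReal_ne_top).symm
      _ ≤ ∫⁻ x in C, (c1 * (K * E) +
          c2 * ∫⁻ y in B, ∫⁻ σ in Ioo (0 : ℝ) 1, g (x - σ • (x - y))) := by
          refine lintegral_mono_ae ?_
          filter_upwards [hZ, ae_restrict_mem hCm] with x h1 h2 using hx x ⟨h2, h1⟩
      _ = c1 * (K * E) * volume C +
          c2 * ∫⁻ x in C, ∫⁻ y in B, ∫⁻ σ in Ioo (0 : ℝ) 1, g (x - σ • (x - y)) := by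
          rw [lintegral_add_left measurable_const, lintegral_const, Measure.restrict_apply_univ,
            lintegral_const_mul' _ _ hc2top]
      _ ≤ c1 * (K * E) * volume C + c2 * (2 ^ d * (volume B + volume C) * E) := by
          gcongr
          rw [← hgE]
          exact lintegral_segment_le hgm B C
      _ = _ := by ring
  rw [hc3, mul_assoc]
  rwa [mul_comm (ENNReal.ofReal c)⁻¹, ← div_eq_mul_inv,
    ENNReal.le_div_iff_mul_le (Or.inl hc0) (Or.inl ENNReal.ofReal_ne_top), mul_comm]

end FSI

end

/-! ### Chains of balls, and cylinders over sets in a hyperplane -/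

noncomputable section

namespace FSI

open Set Filter Topology
open scoped ENNReal NNReal RealInnerProductSpace

variable {d : ℕ} {Ω Γ Z : Set (Pt d)} {v : Pt d → Pt d}

/-- The set of centres of controlled balls is open. It is also closed in Ω: a ball about a limit
point overlaps a controlled ball in a nonempty open set, from which control spreads to the whole
ball. -/
theorem Controlled.exists_ball_of_isPreconnected (hΩ : IsOpen Ω) (hc : IsPreconnected Ω)
    (h : ∃ x ∈ Ω, ∃ r > 0, Metric.ball x r ⊆ Ω ∧ Controlled Ω Γ (Metric.ball x r)) :
    ∀ x ∈ Ω, ∃ r > 0, Metric.ball x r ⊆ Ω ∧ Controlled Ω Γ (Metric.ball x r) := by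
  set S : Set (Pt d) := {x | ∃ r > 0, Metric.ball x r ⊆ Ω ∧ Controlled Ω Γ (Metric.ball x r)}
    with hS
  have hSo : IsOpen S := by
    refine Metric.isOpen_iff.2 fun x ⟨r, hr, hsub, hcon⟩ => ⟨r, hr, fun y hy => ?_⟩
    have hsub' : Metric.ball y (r - dist y x) ⊆ Metric.ball x r :=
      Metric.ball_subset_ball' (by linarith)
    exact ⟨r - dist y x, sub_pos.2 hy, hsub'.trans hsub, hcon.mono hsub'⟩
  obtain ⟨x₀, hx₀, hx₀'⟩ := h
  refine hc.subset_of_closure_inter_subset hSo ⟨x₀, hx₀, hx₀'⟩ ?_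
  rintro x ⟨hxc, hxΩ⟩
  obtain ⟨r, hr, hsub⟩ := Metric.isOpen_iff.1 hΩ x hxΩ
  obtain ⟨y, hy, hyx⟩ := Metric.mem_closure_iff.1 hxc r hr
  obtain ⟨ρ, hρ, -, hcon⟩ := hy
  have hyb : y ∈ Metric.ball x r := by rwa [Metric.mem_ball, dist_comm]
  have hopen : IsOpen (Metric.ball y ρ ∩ Metric.ball x r) :=
    Metric.isOpen_ball.inter Metric.isOpen_ball
  exact ⟨r, hr, hsub, (hcon.mono inter_subset_left).of_subset_convex hopen.measurableSet
    (hopen.measure_pos volume ⟨y, Metric.mem_ball_self hρ, hyb⟩).ne' inter_subset_right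
    (convex_ball x r) Metric.isBounded_ball measurableSet_ball hΩ.measurableSet hsub⟩

theorem Controlled.of_isOpen_convex (hΩ : IsOpen Ω) (hc : IsPreconnected Ω)
    (h : ∃ x ∈ Ω, ∃ r > 0, Metric.ball x r ⊆ Ω ∧ Controlled Ω Γ (Metric.ball x r))
    {C : Set (Pt d)} (hCo : IsOpen C) (hC : Convex ℝ C) (hCb : Bornology.IsBounded C)
    (hCΩ : C ⊆ Ω) : Controlled Ω Γ C := by
  rcases C.eq_empty_or_nonempty with rfl | ⟨x, hx⟩
  · exact ⟨0, fun Z v _ => by simp⟩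
  obtain ⟨ρ, hρ, -, hcon⟩ := Controlled.exists_ball_of_isPreconnected hΩ hc h x (hCΩ hx)
  have hopen : IsOpen (Metric.ball x ρ ∩ C) := Metric.isOpen_ball.inter hCo
  exact (hcon.mono inter_subset_left).of_subset_convex hopen.measurableSet
    (hopen.measure_pos volume ⟨x, Metric.mem_ball_self hρ, hx⟩).ne' inter_subset_right
    hC hCb hCo.measurableSet hΩ.measurableSet hCΩ

theorem Controlled.of_ae_cover {ι : Type*} [Finite ι] {A : ι → Set (Pt d)}
    (hA : ∀ i, Controlled Ω Γ (A i)) {B : Set (Pt d)} (hB : volume (B \ ⋃ i, A i) = 0) :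
    Controlled Ω Γ B := by
  cases nonempty_fintype ι
  choose C hC using hA
  refine ⟨∑ i, C i, fun Z v hv => ?_⟩
  calc ∫⁻ x in B, ‖v x‖ₑ ^ 2 ≤ ∫⁻ x in (⋃ i, A i) ∪ (B \ ⋃ i, A i), ‖v x‖ₑ ^ 2 :=
        lintegral_mono_set (by rw [union_sdiff_self]; exact subset_union_right)
    _ ≤ (∫⁻ x in ⋃ i, A i, ‖v x‖ₑ ^ 2) + ∫⁻ x in B \ ⋃ i, A i, ‖v x‖ₑ ^ 2 :=
        lintegral_union_le _ _ _
    _ = ∫⁻ x in ⋃ i, A i, ‖v x‖ₑ ^ 2 := by rw [setLIntegral_measure_zero _ _ hB, add_zero]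
    _ ≤ ∑' i, ∫⁻ x in A i, ‖v x‖ₑ ^ 2 := lintegral_iUnion_le _ _
    _ = ∑ i, ∫⁻ x in A i, ‖v x‖ₑ ^ 2 := tsum_fintype _
    _ ≤ ∑ i, C i * ∫⁻ x in Ω, ENNReal.ofReal (energy v x) :=
        Finset.sum_le_sum fun i _ => hC i Z v hv
    _ = _ := by rw [← Finset.sum_mul]; push_cast; rfl

/-- A set of positive `n`-dimensional Hausdorff measure in a hyperplane of `ℝ^(n+1)` spans a
cylinder of positive volume. -/
theorem exists_volume_cylinder_ne_zero {n : ℕ} {s : Pt (n + 1) →ᵃ[ℝ] ℝ} (hs : s.linear ≠ 0)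
    {G : Set (Pt (n + 1))} (hG : ∀ x ∈ G, s x = 0)
    (hG0 : Measure.hausdorffMeasure (n : ℝ) G ≠ 0) :
    ∃ e : Pt (n + 1), s.linear e = 1 ∧ volume {x | x - s x • e ∈ G} ≠ 0 := by
  -- A coordinate axis transversal to the hyperplane; `e` is its unit vector rescaled to satisfy
  -- `s.linear e = 1`.
  obtain ⟨a, ha⟩ : ∃ a, s.linear (EuclideanSpace.single a 1) ≠ 0 := by
    by_contra! h
    refine hs ((EuclideanSpace.basisFun (Fin (n + 1)) ℝ).toBasis.ext fun a => ?_)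
    simpa using h a
  set u : Pt (n + 1) := EuclideanSpace.single a 1 with hu
  set e : Pt (n + 1) := (s.linear u)⁻¹ • u with he
  refine ⟨e, by simp [he, ha], fun h0 => hG0 ?_⟩
  -- `proj` forgets the coordinate a and `emb` lifts back to the hyperplane along `e`. If the
  -- cylinder were null, Fubini would make `proj '' G` null, and then G, contained in its Lipschitz
  -- image under `emb`, would have Hausdorff measure zero.
  set proj : Pt (n + 1) → (Fin n → ℝ) := fun x => a.removeNth x.ofLp with hproj
  set emb : (Fin n → ℝ) → Pt (n + 1) := fun z =>
    WithLp.toLp 2 (a.insertNth (0 : ℝ) z) - s (WithLp.toLp 2 (a.insertNth (0 : ℝ) z)) • e with hemb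
  have hsadd : ∀ (x : Pt (n + 1)) (t : ℝ), s (x + t • u) = s x + t * s.linear u := by
    intro x t
    have := s.map_vadd x (t • u)
    rw [vadd_eq_add, vadd_eq_add, map_smul, smul_eq_mul] at this
    rw [add_comm x, this, add_comm]
  have hue : ∀ t : ℝ, (t * s.linear u) • e = t • u := by
    intro t
    rw [he, smul_smul, mul_assoc, mul_inv_cancel₀ ha, mul_one]
  have hPadd : ∀ (x : Pt (n + 1)) (t : ℝ),
      (x + t • u) - s (x + t • u) • e = x - s x • e := by
    intro x t
    rw [hsadd, add_smul, hue]; abel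
  have hdiff : ∀ x y : Pt (n + 1), proj x = proj y → x = y + (x a - y a) • u := by
    intro x y hxy
    ext j
    rcases eq_or_ne j a with rfl | hj
    · simp [hu]
    · obtain ⟨k, rfl⟩ := Fin.exists_succAbove_eq hj
      have := congrFun hxy k
      simp only [hproj, Fin.removeNth_apply] at this
      simp [hu, this]
  have hG1 : ∀ g ∈ G, emb (proj g) = g := by
    intro g hg
    have h1 : WithLp.toLp 2 (a.insertNth (0 : ℝ) (proj g)) = g + (0 - g a) • u := by
      have := hdiff (WithLp.toLp 2 (a.insertNth (0 : ℝ) (proj g))) g (by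
        ext k; simp [hproj, Fin.removeNth_apply])
      simpa using! this
    simp only [hemb]
    rw [h1, hPadd, hG g hg]; simp
  have hsub : proj ⁻¹' (proj '' G) ⊆ {x | x - s x • e ∈ G} := by
    rintro x ⟨g, hg, hgx⟩
    rw [mem_ofPred_eq, hdiff x g hgx.symm, hPadd, hG g hg]
    simpa using hg
  have hvol : volume (proj '' G) = 0 := by
    have h1 := measure_mono_null hsub h0
    have hmp : MeasurePreserving
        (fun x : Pt (n + 1) => MeasurableEquiv.piFinSuccAbove (fun _ => ℝ) a x.ofLp)
        volume volume :=
      (volume_preserving_piFinSuccAbove (fun _ : Fin (n + 1) => ℝ) a).comp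
        (PiLp.volume_preserving_ofLp (Fin (n + 1)))
    have hmp' : volume ((fun x : Pt (n + 1) =>
        MeasurableEquiv.piFinSuccAbove (fun _ => ℝ) a x.ofLp) ⁻¹' (univ ×ˢ (proj '' G))) =
        volume ((univ : Set ℝ) ×ˢ (proj '' G)) :=
      hmp.measure_preimage_emb (((MeasurableEquiv.piFinSuccAbove (fun _ => ℝ) a).measurableEmbedding).comp
        (MeasurableEquiv.toLp 2 (Fin (n + 1) → ℝ)).symm.measurableEmbedding) _
    have h2 : (fun x : Pt (n + 1) =>
        MeasurableEquiv.piFinSuccAbove (fun _ => ℝ) a x.ofLp) ⁻¹' (univ ×ˢ (proj '' G)) =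
        proj ⁻¹' (proj '' G) := by
      ext x
      simp [hproj, MeasurableEquiv.piFinSuccAbove, Fin.insertNthEquiv]
    rw [h2, h1, Measure.volume_eq_prod, Measure.prod_prod] at hmp'
    simpa using hmp'.symm
  obtain ⟨K, hK⟩ : ∃ K, LipschitzWith K emb := by
    have h1 : LipschitzWith 1 fun z : Fin n → ℝ => (a.insertNth (0 : ℝ) z : Fin (n + 1) → ℝ) := by
      refine LipschitzWith.of_dist_le_mul fun z w => ?_
      rw [NNReal.coe_one, one_mul]
      refine (dist_pi_le_iff dist_nonneg).2 fun j => ?_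
      refine Fin.succAboveCases a ?_ (fun k => ?_) j
      · simp
      · simpa using dist_le_pi_dist z w k
    have h2 := (PiLp.lipschitzWith_toLp 2 (fun _ : Fin (n + 1) => ℝ)).comp h1
    set P : Pt (n + 1) →L[ℝ] Pt (n + 1) := ContinuousLinearMap.id ℝ _ -
      (LinearMap.toContinuousLinearMap s.linear).smulRight e with hP
    have h3 : LipschitzWith ‖P‖₊ fun x : Pt (n + 1) => x - s x • e := by
      refine LipschitzWith.of_dist_le_mul fun x y => ?_
      have : (x - s x • e) - (y - s y • e) = P (x - y) := by
        have h4 := s.linearMap_vsub x y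
        simp only [vsub_eq_sub] at h4
        simp only [hP, sub_apply, ContinuousLinearMap.id_apply,
          ContinuousLinearMap.smulRight_apply, LinearMap.coe_toContinuousLinearMap', h4]
        module
      rw [dist_eq_norm, this, dist_eq_norm]
      exact P.le_opNorm _
    exact ⟨_, h3.comp h2⟩
  have h5 : G ⊆ emb '' (proj '' G) := fun g hg => ⟨proj g, mem_image_of_mem _ hg, hG1 g hg⟩
  refine measure_mono_null h5 (le_antisymm ?_ zero_le)
  refine (hK.hausdorffMeasure_image_le (d := (n : ℝ)) (by positivity) _).trans ?_
  -- On `Fin n → ℝ` with its sup metric the n-dimensional Hausdorff measure is exactly Lebesgue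
  -- measure.
  have h6 : (Measure.hausdorffMeasure (n : ℝ) : Measure (Fin n → ℝ)) = volume := by
    have := hausdorffMeasure_pi_real (ι := Fin n)
    simpa using this
  rw [h6, hvol, mul_zero]

end FSI

end

/-! ### Density points seen along several directions -/

noncomputable section

namespace FSI

open Set Filter Topology
open scoped ENNReal NNReal RealInnerProductSpace

variable {d : ℕ} {Ω Γ Z : Set (Pt d)} {v : Pt d → Pt d}

/-- Reflection exchanges the two open half balls, and the dividing hyperplane is null. -/
theorem volume_closedBall_le_two_mul_half {l : Pt d →ₗ[ℝ] ℝ} (hl : l ≠ 0) (r : ℝ) :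
    volume (Metric.closedBall (0 : Pt d) r) ≤
      2 * volume {w | w ∈ Metric.closedBall (0 : Pt d) r ∧ 0 < l w} := by
  set H := {w | w ∈ Metric.closedBall (0 : Pt d) r ∧ 0 < l w} with hH
  have h0 : volume {w | l w = 0} = 0 := by
    have := volume_affine_zero_eq_zero (d := d) (s := l.toAffineMap) (by simpa using hl)
    simpa using this
  have hneg : volume ((fun w : Pt d => -w) ⁻¹' H) = volume H := by
    rw [← Set.neg_preimage.symm]
    exact Measure.measure_preimage_neg volume H
  have hsub : Metric.closedBall (0 : Pt d) r ⊆
      (H ∪ (fun w : Pt d => -w) ⁻¹' H) ∪ {w | l w = 0} := by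
    intro w hw
    rcases lt_trichotomy (l w) 0 with h | h | h
    · refine Or.inl (Or.inr ⟨by simpa using hw, by simpa using h⟩)
    · exact Or.inr h
    · exact Or.inl (Or.inl ⟨hw, h⟩)
  calc _ ≤ volume ((H ∪ (fun w : Pt d => -w) ⁻¹' H) ∪ {w | l w = 0}) := measure_mono hsub
    _ ≤ volume (H ∪ (fun w : Pt d => -w) ⁻¹' H) + 0 := by
        rw [← h0]; exact measure_union_le _ _
    _ ≤ volume H + volume H := by
        rw [add_zero]; exact (measure_union_le _ _).trans (by rw [hneg])
    _ = _ := (two_mul _).symm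

/-- If the origin is a density point of a cylinder over a subset `G` of the hyperplane `l = 0`, then
for every finite family of directions, a set of positive measure of points above the hyperplane and
close to the origin is projected into `G` along all of these directions. -/
theorem volume_inter_cylinders_ne_zero_of_density {l : Pt d →ₗ[ℝ] ℝ} {e₀ : Pt d} (he₀ : l e₀ = 1)
    {G : Set (Pt d)}
    (hdens : ∀ ε : ℝ, 0 < ε → ∀ᶠ r in 𝓝[>] (0 : ℝ),
      volume (Metric.closedBall 0 r \ {w | w - l w • e₀ ∈ G}) ≤
        ENNReal.ofReal ε * volume (Metric.closedBall (0 : Pt d) r))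
    {ι : Type*} [Fintype ι] {e : ι → Pt d} (he : ∀ i, l (e i) = 1) {ρ : ℝ} (hρ : 0 < ρ) :
    volume {w | w ∈ Metric.ball (0 : Pt d) ρ ∧ 0 < l w ∧ ∀ i, w - l w • e i ∈ G} ≠ 0 := by
  intro hzero
  have hl : l ≠ 0 := by rintro rfl; simp at he₀
  set D := {w | w - l w • e₀ ∈ G} with hD
  set lc := LinearMap.toContinuousLinearMap l with hlc
  -- The shear `p i` sends w + l(w)(e₀ - eᵢ) back to w. The projection of the former along e₀ is the
  -- projection of w along eᵢ, so failures in direction eᵢ are sheared images of failures in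
  -- direction e₀.
  set p : ι → Pt d →ₗ[ℝ] Pt d := fun i => LinearMap.id + l.smulRight (e i - e₀) with hp
  -- `M` bounds how far the inverse shears enlarge a ball; `T` is twice the resulting total volume
  -- factor, and density with ε = 1/(T + 1) leaves the fraction T/(T + 1) < 1.
  set M : ℝ := 1 + ∑ i, ‖lc‖ * ‖e₀ - e i‖ with hM
  have hM1 : 1 ≤ M := by
    rw [hM]; have : 0 ≤ ∑ i, ‖lc‖ * ‖e₀ - e i‖ := by positivity
    linarith
  have hM0 : 0 < M := by linarith
  set T : ℝ := 2 * ((∑ i, |LinearMap.det (p i)|) * M ^ d) with hT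
  have hT0 : 0 ≤ T := by positivity
  have h1 : ∀ᶠ r in 𝓝[>] (0 : ℝ), volume (Metric.closedBall 0 (M * r) \ D) ≤
      ENNReal.ofReal (T + 1)⁻¹ * volume (Metric.closedBall (0 : Pt d) (M * r)) := by
    have ht : Tendsto (fun r : ℝ => M * r) (𝓝[>] 0) (𝓝[>] 0) := by
      refine tendsto_nhdsWithin_iff.2 ⟨?_, ?_⟩
      · have : Tendsto (fun r : ℝ => M * r) (𝓝 0) (𝓝 (M * 0)) := by
          exact (continuous_const.mul continuous_id).tendsto 0
        rw [mul_zero] at this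
        exact this.mono_left nhdsWithin_le_nhds
      · filter_upwards [self_mem_nhdsWithin] with r hr using mul_pos hM0 hr
    exact ht.eventually (hdens (T + 1)⁻¹ (by positivity))
  obtain ⟨r, hr, hr0, hrρ⟩ := (h1.and (Ioo_mem_nhdsGT hρ)).exists
  set V := volume (Metric.closedBall (0 : Pt d) r) with hV
  have hV0 : V ≠ 0 := (Metric.measure_closedBall_pos volume 0 hr0).ne'
  have hVtop : V ≠ ∞ := (isCompact_closedBall _ _).measure_lt_top.ne
  set H := {w | w ∈ Metric.closedBall (0 : Pt d) r ∧ 0 < l w} with hH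
  have hsub : H ⊆ {w | w ∈ Metric.ball (0 : Pt d) ρ ∧ 0 < l w ∧ ∀ i, w - l w • e i ∈ G} ∪
      ⋃ i, p i '' (Metric.closedBall 0 (M * r) \ D) := by
    rintro w ⟨hw, hlw⟩
    by_cases hall : ∀ i, w - l w • e i ∈ G
    · exact Or.inl ⟨Metric.closedBall_subset_ball hrρ hw, hlw, hall⟩
    · push Not at hall
      obtain ⟨i, hi⟩ := hall
      refine Or.inr (mem_iUnion.2 ⟨i, w + l w • (e₀ - e i), ⟨?_, ?_⟩, ?_⟩)
      · rw [mem_closedBall_zero_iff] at hw ⊢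
        have h2 : ‖l w • (e₀ - e i)‖ ≤ (‖lc‖ * ‖e₀ - e i‖) * r := by
          rw [norm_smul]
          calc ‖l w‖ * ‖e₀ - e i‖ ≤ (‖lc‖ * r) * ‖e₀ - e i‖ := by
                gcongr
                exact (lc.le_opNorm w).trans (by gcongr)
            _ = _ := by ring
        have h3 : ‖lc‖ * ‖e₀ - e i‖ ≤ ∑ i, ‖lc‖ * ‖e₀ - e i‖ :=
          Finset.single_le_sum (f := fun i => ‖lc‖ * ‖e₀ - e i‖) (fun _ _ => by positivity)
            (Finset.mem_univ i)
        calc ‖w + l w • (e₀ - e i)‖ ≤ r + (‖lc‖ * ‖e₀ - e i‖) * r :=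
              (norm_add_le _ _).trans (add_le_add hw h2)
          _ ≤ M * r := by rw [hM, add_mul, one_mul]; gcongr
      · intro hmem
        apply hi
        have h4 : l (w + l w • (e₀ - e i)) = l w := by simp [he₀, he i]
        simp only [hD, mem_ofPred_eq, h4] at hmem
        convert hmem using 1
        module
      · have h4 : l (w + l w • (e₀ - e i)) = l w := by simp [he₀, he i]
        simp only [hp, LinearMap.add_apply, LinearMap.id_apply, LinearMap.smulRight_apply, h4]
        module
  have hHle : volume H ≤ ENNReal.ofReal ((∑ i, |LinearMap.det (p i)|) * M ^ d * (T + 1)⁻¹) * V := by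
    calc volume H ≤ 0 + ∑ i, volume (p i '' (Metric.closedBall 0 (M * r) \ D)) := by
          refine (measure_mono hsub).trans ((measure_union_le _ _).trans ?_)
          rw [hzero]
          gcongr
          exact measure_iUnion_fintype_le _ _
      _ = ∑ i, ENNReal.ofReal |LinearMap.det (p i)| * volume (Metric.closedBall 0 (M * r) \ D) := by
          simp only [Measure.addHaar_image_linearMap, zero_add]
      _ ≤ ∑ i, ENNReal.ofReal |LinearMap.det (p i)| *
            (ENNReal.ofReal (T + 1)⁻¹ * (ENNReal.ofReal (M ^ d) * V)) := by
          refine Finset.sum_le_sum fun i _ => ?_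
          gcongr
          refine hr.trans_eq ?_
          rw [Measure.addHaar_closedBall_mul volume 0 hM0.le hr0.le, finrank_euclideanSpace_fin]
      _ = _ := by
          rw [← Finset.sum_mul, ← ENNReal.ofReal_sum_of_nonneg (fun _ _ => abs_nonneg _),
            ENNReal.ofReal_mul (by positivity), ENNReal.ofReal_mul (by positivity)]
          ring
  have hfin : V ≤ ENNReal.ofReal (T * (T + 1)⁻¹) * V := by
    refine (volume_closedBall_le_two_mul_half hl r).trans ?_
    refine (mul_le_mul_right hHle 2).trans_eq ?_
    rw [← mul_assoc]
    congr 1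
    have : T * (T + 1)⁻¹ = 2 * ((∑ i, |LinearMap.det (p i)|) * M ^ d * (T + 1)⁻¹) := by
      rw [hT]; ring
    rw [this, ENNReal.ofReal_mul two_pos.le, ENNReal.ofReal_ofNat]
  have hlt : ENNReal.ofReal (T * (T + 1)⁻¹) * V < 1 * V := by
    rw [ENNReal.mul_lt_mul_iff_left hV0 hVtop, ENNReal.ofReal_lt_one, ← div_eq_mul_inv,
      div_lt_one (by positivity)]
    linarith
  rw [one_mul] at hlt
  exact absurd hfin (not_le.2 hlt)

/-- The point y is the projection along e₀ of a Lebesgue density point of the cylinder over G. It is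
fixed before the directions are given, so these may later be aimed from y at points inside a cell.
-/
theorem exists_forall_volume_inter_cylinders_ne_zero {n : ℕ} {s : Pt (n + 1) →ᵃ[ℝ] ℝ}
    (hs : s.linear ≠ 0) {G : Set (Pt (n + 1))} (hGc : IsClosed G) (hG : ∀ x ∈ G, s x = 0)
    (hG0 : Measure.hausdorffMeasure (n : ℝ) G ≠ 0) :
    ∃ y ∈ G, ∀ (ι : Type) [Fintype ι] (e : ι → Pt (n + 1)), (∀ i, s.linear (e i) = 1) →
      ∀ ρ > 0, volume {x | x ∈ Metric.ball y ρ ∧ 0 < s x ∧ ∀ i, x - s x • e i ∈ G} ≠ 0 := by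
  obtain ⟨e₀, he₀, hvol⟩ := exists_volume_cylinder_ne_zero hs hG hG0
  set D := {x | x - s x • e₀ ∈ G} with hD
  have hsadd : ∀ x w : Pt (n + 1), s (x + w) = s x + s.linear w := by
    intro x w
    have := s.map_vadd x w
    rw [vadd_eq_add, vadd_eq_add] at this
    rw [add_comm x, this, add_comm]
  have hDclosed : IsClosed D :=
    hGc.preimage (continuous_id.sub (s.continuous_of_finiteDimensional.smul continuous_const))
  have hae := Besicovitch.ae_tendsto_measure_inter_div volume D
  have hne : (ae (volume.restrict D)).NeBot := by
    rw [ae_neBot]; simpa [Measure.restrict_eq_zero] using hvol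
  obtain ⟨z, hz, hzD⟩ := (hae.and (ae_restrict_mem hDclosed.measurableSet)).exists
  refine ⟨z - s z • e₀, hzD, fun ι _ e he ρ hρ => ?_⟩
  set y := z - s z • e₀ with hy
  have hsy : s y = 0 := hG y hzD
  have hsyw : ∀ w, s (y + w) = s.linear w := fun w => by rw [hsadd, hsy, zero_add]
  set G' : Set (Pt (n + 1)) := (fun w => y + w) ⁻¹' G with hG'
  -- The cylinder is invariant under translation along e₀, so density at z carries over to density
  -- at its projection y.
  have hmemD : ∀ w, w - s.linear w • e₀ ∈ G' ↔ z + w ∈ D := by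
    intro w
    rw [hG', mem_preimage, hD, mem_ofPred_eq, hsadd]
    have : y + (w - s.linear w • e₀) = z + w - (s z + s.linear w) • e₀ := by
      rw [hy]; module
    rw [this]
  have hdens : ∀ ε : ℝ, 0 < ε → ∀ᶠ r in 𝓝[>] (0 : ℝ),
      volume (Metric.closedBall 0 r \ {w | w - s.linear w • e₀ ∈ G'}) ≤
        ENNReal.ofReal ε * volume (Metric.closedBall (0 : Pt (n + 1)) r) := by
    intro ε hε
    have hlt : 1 - ENNReal.ofReal ε < 1 :=
      ENNReal.sub_lt_self ENNReal.one_ne_top one_ne_zero (by simpa using hε)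
    filter_upwards [hz.eventually (lt_mem_nhds hlt), self_mem_nhdsWithin] with r hr hr0
    have hVtop : volume (Metric.closedBall z r) ≠ ∞ := (isCompact_closedBall _ _).measure_lt_top.ne
    have hV0 : volume (Metric.closedBall z r) ≠ 0 := (Metric.measure_closedBall_pos volume z hr0).ne'
    have heq : Metric.closedBall 0 r \ {w | w - s.linear w • e₀ ∈ G'} =
        (fun w => z + w) ⁻¹' (Metric.closedBall z r \ D) := by
      ext w
      simp only [Set.mem_sdiff, mem_ofPred_eq, hmemD, mem_preimage, Metric.mem_closedBall,
        dist_self_add_left, dist_zero_right]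
    rw [heq, measure_preimage_add, ← Measure.addHaar_closedBall_center volume z]
    have h1 : 1 ≤ volume (D ∩ Metric.closedBall z r) / volume (Metric.closedBall z r) +
        ENNReal.ofReal ε := tsub_le_iff_right.1 hr.le
    have h2 : volume (Metric.closedBall z r) ≤ volume (D ∩ Metric.closedBall z r) +
        ENNReal.ofReal ε * volume (Metric.closedBall z r) := by
      have := mul_le_mul_left h1 (volume (Metric.closedBall z r))
      rwa [one_mul, add_mul, ENNReal.div_mul_cancel hV0 hVtop] at this
    have h3 : volume (Metric.closedBall z r \ D) + volume (D ∩ Metric.closedBall z r) =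
        volume (Metric.closedBall z r) := by
      rw [inter_comm]; exact measure_sdiff_add_inter _ hDclosed.measurableSet
    have h4 : volume (D ∩ Metric.closedBall z r) ≠ ∞ :=
      ne_top_of_le_ne_top hVtop (measure_mono inter_subset_right)
    refine (ENNReal.add_le_add_iff_left h4).1 (le_trans (le_of_eq ?_) h2)
    rw [add_comm, h3]
  have hmain := volume_inter_cylinders_ne_zero_of_density he₀ hdens he hρ
  have heq : (fun w => y + w) ⁻¹'
      {x | x ∈ Metric.ball y ρ ∧ 0 < s x ∧ ∀ i, x - s x • e i ∈ G} =
      {w | w ∈ Metric.ball (0 : Pt (n + 1)) ρ ∧ 0 < s.linear w ∧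
        ∀ i, w - s.linear w • e i ∈ G'} := by
    ext w
    simp only [mem_preimage, mem_ofPred_eq, hsyw, Metric.mem_ball, dist_self_add_left,
      dist_zero_right, hG', add_sub_assoc]
  rw [← heq, measure_preimage_add] at hmain
  exact hmain

end FSI

end

/-! ### Control near a Dirichlet facet -/

noncomputable section

namespace FSI

open Set Filter Topology
open scoped ENNReal NNReal RealInnerProductSpace

/-- Control of admissible fields on a convex body of which a facet meets the Dirichlet boundary in
a set of positive measure. -/
theorem controlled_interior_of_facet {n : ℕ} {Ω Γ K G : Set (Pt (n + 1))}
    {s : Pt (n + 1) →ᵃ[ℝ] ℝ} (hs : s.linear ≠ 0) (hΩ : MeasurableSet Ω) (hK : Convex ℝ K)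
    (hKb : Bornology.IsBounded K)
    (hKΩ : K ⊆ closure Ω) (hiKΩ : interior K ⊆ Ω) (hsK : ∀ x ∈ interior K, 0 < s x)
    (hKne : (interior K).Nonempty) (hGc : IsClosed G) (hGΓ : G ⊆ Γ) (hGK : G ⊆ K)
    (hG : ∀ x ∈ G, s x = 0) (hG0 : Measure.hausdorffMeasure (n : ℝ) G ≠ 0) :
    Controlled Ω Γ (interior K) := by
  obtain ⟨y₀, hy₀, hcyl⟩ := exists_forall_volume_inter_cylinders_ne_zero hs hGc hG hG0
  obtain ⟨q₀, hq₀⟩ := hKne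
  obtain ⟨δ, hδ, hball⟩ := Metric.isOpen_iff.1 isOpen_interior q₀ hq₀
  -- Targets inside K: q₀ and one neighbour along each axis. Differences of the vectors q o - y₀ are
  -- multiples of the unit vectors, so the directions `e o` span.
  set q : Option (Fin (n + 1)) → Pt (n + 1) := fun o =>
    o.elim q₀ fun i => q₀ + (δ / 2) • EuclideanSpace.single i (1 : ℝ) with hq
  have hqK : ∀ o, q o ∈ interior K := by
    rintro (_ | i)
    · exact hq₀
    · refine hball ?_
      simp only [hq, Option.elim, Metric.mem_ball, dist_self_add_left, norm_smul]
      simp only [Real.norm_eq_abs, abs_of_pos (half_pos hδ), PiLp.norm_single, norm_one, mul_one]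
      linarith
  have hsq : ∀ o, 0 < s (q o) := fun o => hsK _ (hqK o)
  set e : Option (Fin (n + 1)) → Pt (n + 1) := fun o => (s (q o))⁻¹ • (q o - y₀) with he
  have hse : ∀ o, s.linear (e o) = 1 := by
    intro o
    have h1 := s.linearMap_vsub (q o) y₀
    rw [vsub_eq_sub, vsub_eq_sub, hG y₀ hy₀, sub_zero] at h1
    rw [he, map_smul, h1, smul_eq_mul, inv_mul_cancel₀ (hsq o).ne']
  have hscont : Continuous s := s.continuous_of_finiteDimensional
  -- Near y₀, the foot of x along `e o` can still be shifted by q o - y₀ into the interior, and x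
  -- lies lower than q o. Both facts are needed to place the segment from the foot to x inside K by
  -- convexity.
  have hev : ∀ᶠ x in 𝓝 y₀, ∀ o, (x - s x • e o) + (q o - y₀) ∈ interior K ∧ s x < s (q o) := by
    rw [eventually_all]
    intro o
    refine Eventually.and ?_ ?_
    · have hc : Continuous fun x => (x - s x • e o) + (q o - y₀) := by fun_prop
      refine hc.continuousAt.eventually_mem (isOpen_interior.mem_nhds ?_)
      rw [hG y₀ hy₀]
      simpa using hqK o
    · refine hscont.continuousAt.eventually_lt continuousAt_const ?_
      rw [hG y₀ hy₀]; exact hsq o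
  obtain ⟨ρ, hρ, hρball⟩ := Metric.eventually_nhds_iff_ball.1 hev
  set A : Set (Pt (n + 1)) :=
    {x | x ∈ Metric.ball y₀ ρ ∧ 0 < s x ∧ ∀ o, x - s x • e o ∈ G} with hA
  have hA0 : volume A ≠ 0 := hcyl _ e hse ρ hρ
  have hAm : MeasurableSet A := by
    have : {x | ∀ o, x - s x • e o ∈ G} = ⋂ o, (fun x => x - s x • e o) ⁻¹' G := by
      ext x; simp
    have hm : MeasurableSet {x | ∀ o, x - s x • e o ∈ G} := by
      rw [this]
      exact MeasurableSet.iInter fun o => (hGc.preimage (by fun_prop)).measurableSet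
    exact measurableSet_ball.inter ((isOpen_lt continuous_const hscont).measurableSet.inter hm)
  have hseg : ∀ x ∈ A, ∀ o, ∀ σ ∈ Ico 0 (s x), x - σ • e o ∈ interior K := by
    rintro x ⟨hx, hsx, hxG⟩ o σ hσ
    obtain ⟨h1, h2⟩ := hρball x hx o
    have h3 := hK.add_smul_mem_interior (hGK (hxG o)) h1
      (t := (s x - σ) / s (q o)) ⟨div_pos (by linarith [hσ.2]) (hsq o),
        (div_le_one (hsq o)).2 (by linarith [hσ.1])⟩
    have h4 : x - s x • e o + ((s x - σ) / s (q o)) • (q o - y₀) = x - σ • e o := by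
      have : ((s x - σ) / s (q o)) • (q o - y₀) = (s x - σ) • e o := by
        rw [he, div_eq_mul_inv, mul_smul]
      rw [this]; module
    rwa [h4] at h3
  have hAK : A ⊆ interior K := by
    intro x hx
    simpa using hseg x hx none 0 ⟨le_rfl, hx.2.1⟩
  -- The spanning directions recover ‖w‖ from the components ⟨w, e o⟩.
  obtain ⟨c, hc, hcoer⟩ : ∃ c : ℝ, 0 < c ∧ ∀ w : Pt (n + 1), c * ‖w‖ ^ 2 ≤ ∑ o, ⟪w, e o⟫ ^ 2 := by
    refine exists_pos_mul_sq_le (by fun_prop) (fun t w => ?_) fun w hw => ?_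
    · simp only [real_inner_smul_left, mul_pow, Finset.mul_sum]
    · refine lt_of_le_of_ne (Finset.sum_nonneg fun _ _ => sq_nonneg _) fun h0 => hw ?_
      have h1 : ∀ o, ⟪w, q o - y₀⟫ = 0 := by
        intro o
        have h2 := (Finset.sum_eq_zero_iff_of_nonneg (fun _ _ => sq_nonneg _)).1 h0.symm o
          (Finset.mem_univ o)
        rw [sq_eq_zero_iff, he, real_inner_smul_right] at h2
        exact (mul_eq_zero.1 h2).resolve_left (inv_pos.2 (hsq o)).ne'
      ext i
      have h2 : ⟪w, q (some i) - y₀⟫ - ⟪w, q none - y₀⟫ = δ / 2 * w i := by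
        rw [← inner_sub_right]
        have : q (some i) - y₀ - (q none - y₀) = (δ / 2) • EuclideanSpace.single i (1 : ℝ) := by
          simp only [hq, Option.elim]; abel
        rw [this, real_inner_smul_right, EuclideanSpace.inner_single_right]
        simp
      rw [h1, h1, sub_zero] at h2
      simpa [hδ.ne'] using h2.symm
  -- `R` exceeds s(x) for all x ∈ A, so a common range of integration (0, R) decouples σ from x and
  -- translation invariance applies.
  set R : ℝ := s (q none) with hR
  have hR0 : 0 < R := hsq none
  set C : ℝ≥0∞ := (ENNReal.ofReal c)⁻¹ *
    ∑ o, ENNReal.ofReal (R * ‖e o‖ ^ 4) * ENNReal.ofReal R with hC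
  have hc0 : ENNReal.ofReal c ≠ 0 := by simpa using hc
  have hCtop : C ≠ ∞ := ENNReal.mul_ne_top (ENNReal.inv_ne_top.2 hc0)
    (ENNReal.sum_ne_top.2 fun o _ => ENNReal.mul_ne_top ENNReal.ofReal_ne_top ENNReal.ofReal_ne_top)
  have hAcon : Controlled Ω Γ A := by
    refine ⟨C.toNNReal, fun Z v hv => ?_⟩
    rw [ENNReal.coe_toNNReal hCtop]
    set E := ∫⁻ x in Ω, ENNReal.ofReal (energy v x) with hE
    set g : Pt (n + 1) → ℝ≥0∞ := Ω.indicator fun x => ENNReal.ofReal (energy v x) with hg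
    have hgm : Measurable g := (measurable_energy v).ennreal_ofReal.indicator hΩ
    have hgE : ∫⁻ x, g x = E := lintegral_indicator hΩ _
    have hpt : ∀ x ∈ A \ Z, ∀ o, ENNReal.ofReal (⟪v x, e o⟫ ^ 2) ≤
        ENNReal.ofReal (R * ‖e o‖ ^ 4) * ∫⁻ σ in Ioo 0 R, g (x - σ • e o) := by
      intro x hx o
      have hxR : s x < R := (hρball x hx.1.1 none).2
      have h1 := hv.sq_inner_sub_le (e := e o) hx.1.2.1 hx.2
        (fun σ hσ => by
          rcases hσ.2.eq_or_lt with h | h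
          · rw [h]; exact hKΩ (hGK (hx.1.2.2 o))
          · exact hKΩ (interior_subset (hseg x hx.1 o σ ⟨hσ.1, h⟩)))
        (fun σ hσ => hiKΩ (hseg x hx.1 o σ ⟨hσ.1.le, hσ.2⟩))
      -- The foot of the segment lies in Γ, where v vanishes, so the increment is ⟨v x, e o⟩ itself.
      rw [hv.vanish _ (hGΓ (hx.1.2.2 o)), sub_zero] at h1
      refine h1.trans (mul_le_mul' (ENNReal.ofReal_le_ofReal (by gcongr)) ?_)
      calc ∫⁻ σ in Ioo 0 (s x), ENNReal.ofReal (energy v (x - σ • e o))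
          = ∫⁻ σ in Ioo 0 (s x), g (x - σ • e o) := by
            refine setLIntegral_congr_fun measurableSet_Ioo fun σ hσ => ?_
            rw [hg, indicator_of_mem (hiKΩ (hseg x hx.1 o σ ⟨hσ.1.le, hσ.2⟩))]
        _ ≤ _ := lintegral_mono_set (Ioo_subset_Ioo_right hxR.le)
    have hdir : ∀ o, ∫⁻ x in A, ∫⁻ σ in Ioo 0 R, g (x - σ • e o) ≤ ENNReal.ofReal R * E := by
      intro o
      rw [lintegral_lintegral_swap (by
        refine Measurable.aemeasurable ?_
        exact hgm.comp (by fun_prop))]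
      calc ∫⁻ σ in Ioo 0 R, ∫⁻ x in A, g (x - σ • e o) ≤ ∫⁻ σ in Ioo 0 R, E := by
            refine lintegral_mono fun σ => (setLIntegral_le_lintegral _ _).trans_eq ?_
            rw [lintegral_sub_right_eq_self (fun x => g x), hgE]
        _ = _ := by
            rw [lintegral_const, Measure.restrict_apply_univ, Real.volume_Ioo, sub_zero, mul_comm]
    have hZ : ∀ᵐ x ∂(volume.restrict A), x ∉ Z :=
      ae_restrict_of_ae (measure_eq_zero_iff_ae_notMem.1 hv.null)
    have hfin : ENNReal.ofReal c * ∫⁻ x in A, ‖v x‖ₑ ^ 2 ≤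
        (∑ o, ENNReal.ofReal (R * ‖e o‖ ^ 4) * ENNReal.ofReal R) * E := by
      calc ENNReal.ofReal c * ∫⁻ x in A, ‖v x‖ₑ ^ 2
          = ∫⁻ x in A, ENNReal.ofReal c * ‖v x‖ₑ ^ 2 :=
            (lintegral_const_mul' _ _ ENNReal.ofReal_ne_top).symm
        _ ≤ ∫⁻ x in A, ∑ o, ENNReal.ofReal (R * ‖e o‖ ^ 4) *
              ∫⁻ σ in Ioo 0 R, g (x - σ • e o) := by
            refine lintegral_mono_ae ?_
            filter_upwards [hZ, ae_restrict_mem hAm] with x h1 h2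
            calc ENNReal.ofReal c * ‖v x‖ₑ ^ 2 = ENNReal.ofReal (c * ‖v x‖ ^ 2) := by
                  rw [ENNReal.ofReal_mul hc.le, ENNReal.ofReal_pow (norm_nonneg _), ofReal_norm]
              _ ≤ ENNReal.ofReal (∑ o, ⟪v x, e o⟫ ^ 2) := ENNReal.ofReal_le_ofReal (hcoer _)
              _ = ∑ o, ENNReal.ofReal (⟪v x, e o⟫ ^ 2) :=
                  ENNReal.ofReal_sum_of_nonneg fun _ _ => sq_nonneg _
              _ ≤ _ := Finset.sum_le_sum fun o _ => hpt x ⟨h2, h1⟩ o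
        _ = ∑ o, ENNReal.ofReal (R * ‖e o‖ ^ 4) *
              ∫⁻ x in A, ∫⁻ σ in Ioo 0 R, g (x - σ • e o) := by
            have hmm : ∀ o, Measurable fun x => ∫⁻ σ in Ioo 0 R, g (x - σ • e o) := fun o =>
              Measurable.lintegral_prod_right' (f := fun p : Pt (n + 1) × ℝ => g (p.1 - p.2 • e o))
                (hgm.comp (by fun_prop))
            rw [lintegral_finsetSum _ fun o _ => (hmm o).const_mul _]
            exact Finset.sum_congr rfl fun o _ =>
              lintegral_const_mul' _ _ ENNReal.ofReal_ne_top
        _ ≤ ∑ o, ENNReal.ofReal (R * ‖e o‖ ^ 4) * (ENNReal.ofReal R * E) :=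
            Finset.sum_le_sum fun o _ => by gcongr; exact hdir o
        _ = _ := by simp only [Finset.sum_mul, mul_assoc]
    rw [hC, mul_assoc]
    rwa [mul_comm (ENNReal.ofReal c)⁻¹, ← div_eq_mul_inv,
      ENNReal.le_div_iff_mul_le (Or.inl hc0) (Or.inl ENNReal.ofReal_ne_top), mul_comm]
  exact hAcon.of_subset_convex hAm hA0 hAK hK.interior (hKb.subset interior_subset)
    isOpen_interior.measurableSet hΩ hiKΩ

end FSI

end

noncomputable section

namespace FSI

open Set Filter Topology
open scoped ENNReal NNReal RealInnerProductSpace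

/-! ### The reference element -/

section Reference

variable {d : ℕ}

/-- The barycentric coordinates of the reference simplex. -/
def refBary (d : ℕ) : Option (Fin d) → Pt d →ᵃ[ℝ] ℝ := fun o =>
  o.elim (AffineMap.const ℝ _ 1 - (∑ a, (EuclideanSpace.proj (𝕜 := ℝ) a : Pt d →L[ℝ] ℝ)).toLinearMap.toAffineMap)
    fun a => (EuclideanSpace.proj (𝕜 := ℝ) a : Pt d →L[ℝ] ℝ).toLinearMap.toAffineMap

@[simp]
theorem refBary_none (x : Pt d) : refBary d none x = 1 - ∑ a, x a := by
  simp [refBary]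

@[simp]
theorem refBary_some (a : Fin d) (x : Pt d) : refBary d (some a) x = x a := by
  simp [refBary]

theorem mem_refSimplex_iff {x : Pt d} : x ∈ refSimplex d ↔ ∀ o, 0 ≤ refBary d o x := by
  simp [refSimplex, Option.forall, and_comm]

theorem refBary_linear_ne_zero (hd : 0 < d) (o : Option (Fin d)) :
    (refBary d o).linear ≠ 0 := by
  intro h
  have key : ∀ x y, refBary d o x = refBary d o y := by
    intro x y
    have := (refBary d o).linearMap_vsub x y
    rw [h] at this
    exact sub_eq_zero.1 (by simpa using this.symm)
  rcases o with _ | a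
  · have := key 0 (EuclideanSpace.single ⟨0, hd⟩ 1)
    simp at this
  · have := key 0 (EuclideanSpace.single a 1)
    simp at this

theorem norm_le_one_of_mem_refSimplex {x : Pt d} (hx : x ∈ refSimplex d) : ‖x‖ ≤ 1 := by
  have h1 : ∀ a, x a ≤ 1 := fun a =>
    (Finset.single_le_sum (fun b _ => hx.1 b) (Finset.mem_univ a)).trans hx.2
  rw [← abs_of_nonneg (norm_nonneg x), ← sq_le_one_iff_abs_le_one, EuclideanSpace.real_norm_sq_eq]
  refine le_trans (Finset.sum_le_sum fun a _ => ?_) hx.2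
  nlinarith [h1 a, hx.1 a]

theorem isCompact_refSimplex : IsCompact (refSimplex d) := by
  refine Metric.isCompact_of_isClosed_isBounded ?_ ?_
  · have : refSimplex d = ⋂ o, {x | 0 ≤ refBary d o x} := by
      ext x; simp only [mem_refSimplex_iff, mem_iInter, mem_ofPred_eq]
    rw [this]
    exact isClosed_iInter fun o =>
      isClosed_le continuous_const (refBary d o).continuous_of_finiteDimensional
  · exact (Metric.isBounded_closedBall (x := (0 : Pt d)) (r := 1)).subset fun x hx =>
      mem_closedBall_zero_iff.2 (norm_le_one_of_mem_refSimplex hx)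

/-- The open reference simplex. -/
def refInterior (d : ℕ) : Set (Pt d) := {x | ∀ o, 0 < refBary d o x}

theorem isOpen_refInterior : IsOpen (refInterior d) := by
  have : refInterior d = ⋂ o, {x | 0 < refBary d o x} := by
    ext x; simp [refInterior]
  rw [this]
  exact isOpen_iInter_of_finite fun o =>
    isOpen_lt continuous_const (refBary d o).continuous_of_finiteDimensional

theorem refInterior_subset : refInterior d ⊆ refSimplex d := fun _ hx =>
  mem_refSimplex_iff.2 fun o => (hx o).le

/-- A small open cube inside the simplex: it provides an interior point and a product of infinite
sets on which polynomials can be tested. -/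
theorem mem_refInterior_of_forall_lt {x : Pt d} (h0 : ∀ a, 0 < x a) (h1 : ∀ a, x a < (d + 1 : ℝ)⁻¹) :
    x ∈ refInterior d := by
  rintro (_ | a)
  · rw [refBary_none, sub_pos]
    calc ∑ a, x a ≤ ∑ _a : Fin d, (d + 1 : ℝ)⁻¹ := Finset.sum_le_sum fun a _ => (h1 a).le
      _ = d * (d + 1 : ℝ)⁻¹ := by simp
      _ < 1 := by
        rw [← div_eq_mul_inv, div_lt_one (by positivity)]; linarith
  · simpa using h0 a

theorem refInterior_nonempty : (refInterior d).Nonempty := by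
  refine ⟨WithLp.toLp 2 fun _ => (d + 1 : ℝ)⁻¹ / 2, mem_refInterior_of_forall_lt (fun a => ?_) fun a => ?_⟩
  · simp only; positivity
  · simp only; exact half_lt_self (by positivity)

variable (R : RefElement d)

/-- The reference shape functions. -/
def refShape (j : Fin R.m) (x : Pt d) : ℝ := MvPolynomial.eval (fun a => x a) (R.shape j)

theorem contDiff_refShape (j : Fin R.m) : ContDiff ℝ 1 (refShape R j) := by
  unfold refShape
  induction R.shape j using MvPolynomial.induction_on with
  | C a => simp only [MvPolynomial.eval_C]; exact contDiff_const
  | add p q hp hq => simp only [map_add]; exact hp.add hq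
  | mul_X p a hp =>
    simp only [map_mul, MvPolynomial.eval_X]
    exact hp.mul (by fun_prop)

/-- The vector field on the reference simplex with coefficients `a`. -/
def refField (a : Fin R.m × Fin d → ℝ) (x : Pt d) : Pt d :=
  ∑ q, a q • (refShape R q.1 x • EuclideanSpace.single q.2 (1 : ℝ))

theorem contDiff_refField (a : Fin R.m × Fin d → ℝ) : ContDiff ℝ 1 (refField R a) :=
  ContDiff.sum fun q _ => ((contDiff_refShape R q.1).smul contDiff_const).const_smul _

theorem refField_apply (a : Fin R.m × Fin d → ℝ) (x : Pt d) (l : Fin d) :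
    refField R a x l = ∑ j, a (j, l) * refShape R j x := by
  simp [refField, Fintype.sum_prod_type, Finset.sum_apply, Pi.single_apply]

theorem norm_sq_sum_smul_le {ι E : Type*} [Fintype ι] [NormedAddCommGroup E] [NormedSpace ℝ E]
    (a : ι → ℝ) (b : ι → E) : ‖∑ q, a q • b q‖ ^ 2 ≤ (∑ q, ‖b q‖ ^ 2) * ∑ q, a q ^ 2 := by
  calc ‖∑ q, a q • b q‖ ^ 2 ≤ (∑ q, |a q| * ‖b q‖) ^ 2 := by
        gcongr
        exact (norm_sum_le _ _).trans_eq (by simp [norm_smul])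
    _ ≤ (∑ q, |a q| ^ 2) * ∑ q, ‖b q‖ ^ 2 := Finset.sum_mul_sq_le_sq_mul_sq _ _ _
    _ = _ := by simp only [sq_abs]; ring

theorem exists_refField_bound : ∃ B : ℝ, 0 < B ∧ ∀ (a : Fin R.m × Fin d → ℝ), ∀ x ∈ refSimplex d,
    ‖refField R a x‖ ^ 2 ≤ B * ∑ q, a q ^ 2 ∧
      ‖fderiv ℝ (refField R a) x‖ ^ 2 ≤ B * ∑ q, a q ^ 2 := by
  set b : Fin R.m × Fin d → Pt d → Pt d := fun q x =>
    refShape R q.1 x • EuclideanSpace.single q.2 (1 : ℝ) with hb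
  have hbd : ∀ q, ContDiff ℝ 1 (b q) := fun q => (contDiff_refShape R q.1).smul contDiff_const
  have hc1 : Continuous fun x => ∑ q, ‖b q x‖ ^ 2 :=
    continuous_finsetSum _ fun q _ => ((hbd q).continuous.norm.pow 2)
  have hc2 : Continuous fun x => ∑ q, ‖fderiv ℝ (b q) x‖ ^ 2 :=
    continuous_finsetSum _ fun q _ => (((hbd q).continuous_fderiv one_ne_zero).norm.pow 2)
  obtain ⟨B1, hB1⟩ := isCompact_refSimplex.exists_bound_of_continuousOn hc1.continuousOn
  obtain ⟨B2, hB2⟩ := isCompact_refSimplex.exists_bound_of_continuousOn hc2.continuousOn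
  refine ⟨max 1 (max B1 B2), by positivity, fun a x hx => ⟨?_, ?_⟩⟩
  · refine (norm_sq_sum_smul_le a fun q => b q x).trans ?_
    gcongr
    exact (le_abs_self _).trans ((hB1 x hx).trans ((le_max_left _ _).trans (le_max_right _ _)))
  · have hfd : fderiv ℝ (refField R a) x = ∑ q, a q • fderiv ℝ (b q) x := by
      have h1 : ∀ q, HasFDerivAt (fun x => a q • b q x) (a q • fderiv ℝ (b q) x) x := fun q =>
        (((hbd q).differentiable one_ne_zero).differentiableAt.hasFDerivAt).const_smul (a q)
      exact (HasFDerivAt.fun_sum fun q _ => h1 q).fderiv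
    rw [hfd]
    refine (norm_sq_sum_smul_le a fun q => fderiv ℝ (b q) x).trans ?_
    gcongr
    exact (le_abs_self _).trans ((hB2 x hx).trans ((le_max_right _ _).trans (le_max_right _ _)))

/-- Componentwise, a polynomial that vanishes on a product of infinite sets is zero; then linear
independence of the shape functions applies. -/
theorem refField_eq_zero {a : Fin R.m × Fin d → ℝ}
    (h : ∀ x ∈ refInterior d, refField R a x = 0) : a = 0 := by
  have key : ∀ l, ∑ j, a (j, l) • R.shape j = 0 := by
    intro l
    refine MvPolynomial.funext_set (fun _ => Ioo (0 : ℝ) (d + 1 : ℝ)⁻¹)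
      (fun _ => Ioo_infinite (by positivity)) fun x hx => ?_
    have h1 := h (WithLp.toLp 2 x) (mem_refInterior_of_forall_lt (fun a => (hx a trivial).1)
      fun a => (hx a trivial).2)
    have h2 := refField_apply R a (WithLp.toLp 2 x) l
    rw [h1] at h2
    simpa [MvPolynomial.smul_eval, refShape] using h2.symm
  ext ⟨j, l⟩
  exact Fintype.linearIndependent_iff.1 R.linearIndependent _ (key l) j

/-- Equivalence of norms on the finite-dimensional coefficient space. The Euclidean norm is used
there so that its square is the sum of squares. -/
theorem exists_refField_lower : ∃ α : ℝ, 0 < α ∧ ∀ (a : Fin R.m × Fin d → ℝ),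
    α * ∑ q, a q ^ 2 ≤ ∫ x in refSimplex d, ‖refField R a x‖ ^ 2 := by
  have hcont : ∀ a : Fin R.m × Fin d → ℝ, Continuous fun x => ‖refField R a x‖ ^ 2 := fun a =>
    (contDiff_refField R a).continuous.norm.pow 2
  have hint : ∀ a : Fin R.m × Fin d → ℝ,
      IntegrableOn (fun x => ‖refField R a x‖ ^ 2) (refSimplex d) := fun a =>
    (hcont a).continuousOn.integrableOn_compact isCompact_refSimplex
  obtain ⟨α, hα, h⟩ := exists_pos_mul_sq_le (E := EuclideanSpace ℝ (Fin R.m × Fin d))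
    (q := fun a => ∫ x in refSimplex d, ‖refField R a.ofLp x‖ ^ 2)
    (by
      refine continuous_parametric_integral_of_continuous (μ := volume) (s := refSimplex d)
        (f := fun (a : EuclideanSpace ℝ (Fin R.m × Fin d)) x => ‖refField R a.ofLp x‖ ^ 2) ?_
        isCompact_refSimplex
      have hs : ∀ j, Continuous (refShape R j) := fun j => (contDiff_refShape R j).continuous
      unfold Function.uncurry refField
      fun_prop)
    (fun t a => by
      rw [← integral_const_mul]
      congr 1; ext x
      have : refField R (t • a).ofLp x = t • refField R a.ofLp x := by
        simp [refField, Finset.smul_sum, smul_smul, mul_assoc]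
      rw [this, norm_smul, mul_pow, Real.norm_eq_abs, sq_abs])
    (fun a ha => by
      refine lt_of_le_of_ne (integral_nonneg fun x => sq_nonneg _) fun h0 => ha ?_
      have h1 := (setIntegral_eq_zero_iff_of_nonneg_ae
        (Eventually.of_forall fun y => sq_nonneg _) (hint a.ofLp)).1 h0.symm
      have h2 : (fun x => ‖refField R a.ofLp x‖ ^ 2) =ᵐ[volume.restrict (refInterior d)] 0 :=
        ae_restrict_of_ae_restrict_of_subset refInterior_subset h1
      have h3 := Measure.eqOn_open_of_ae_eq h2 isOpen_refInterior (hcont a.ofLp).continuousOn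
        continuousOn_const
      have h4 := refField_eq_zero R (a := a.ofLp) fun x hx => by simpa using h3 hx
      ext q
      exact congrFun h4 q)
  refine ⟨α, hα, fun a => ?_⟩
  have := h (WithLp.toLp 2 a)
  rwa [EuclideanSpace.real_norm_sq_eq] at this

end Reference

end FSI

end

noncomputable section

namespace FSI

open Set Filter Topology
open scoped ENNReal NNReal RealInnerProductSpace

variable {d : ℕ}

/-! ### Affine images of the reference simplex -/

theorem hasFDerivAt_affineMap (f : Pt d →ᵃ[ℝ] Pt d) (x : Pt d) :
    HasFDerivAt f (LinearMap.toContinuousLinearMap f.linear) x := by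
  have h : (f : Pt d → Pt d) = fun y => LinearMap.toContinuousLinearMap f.linear y + f 0 := by
    rw [AffineMap.decomp f]; ext; simp
  rw [h]
  exact (LinearMap.toContinuousLinearMap f.linear).hasFDerivAt.add_const _

/-- Differences of points of the ball, up to scaling, give every vector, so the linear part is onto;
in finite dimension it is then injective. -/
theorem bijective_of_closedBall_subset_image {f : Pt d →ᵃ[ℝ] Pt d} {S : Set (Pt d)} {c : Pt d}
    {r : ℝ} (hr : 0 < r) (h : Metric.closedBall c r ⊆ f '' S) : Function.Bijective f := by
  have hsurj : Function.Surjective f.linear := by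
    intro w
    obtain ⟨p, -, hp⟩ := h (Metric.mem_closedBall_self hr.le)
    rcases eq_or_ne w 0 with rfl | hw
    · exact ⟨0, map_zero _⟩
    have hn : 0 < ‖w‖ := norm_pos_iff.2 hw
    obtain ⟨q, -, hq⟩ := h (show c + (r / ‖w‖) • w ∈ Metric.closedBall c r by
      rw [mem_closedBall_iff_norm, add_sub_cancel_left, norm_smul, norm_div, norm_norm,
        div_mul_cancel₀ _ hn.ne', Real.norm_of_nonneg hr.le])
    refine ⟨(‖w‖ / r) • (q - p), ?_⟩
    have h1 := f.linearMap_vsub q p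
    rw [vsub_eq_sub, vsub_eq_sub, hq, hp, add_sub_cancel_left] at h1
    rw [map_smul, h1, smul_smul, div_mul_div_cancel₀ hr.ne', div_self hn.ne', one_smul]
  rw [← f.linear_bijective_iff]
  exact ⟨LinearMap.injective_iff_surjective.2 hsurj, hsurj⟩

section AffineImage

variable (F : Pt d ≃ᵃ[ℝ] Pt d)

/-- The barycentric coordinates of the image of the reference simplex. -/
def bary (o : Option (Fin d)) : Pt d →ᵃ[ℝ] ℝ := (refBary d o).comp (F.symm : Pt d →ᵃ[ℝ] Pt d)

theorem bary_apply (o : Option (Fin d)) (x : Pt d) : bary F o x = refBary d o (F.symm x) := rfl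

theorem bary_linear_ne_zero (hd : 0 < d) (o : Option (Fin d)) : (bary F o).linear ≠ 0 := by
  intro h
  refine refBary_linear_ne_zero hd o (LinearMap.ext fun w => ?_)
  have := congrArg (fun l => l (F.linear w)) h
  simpa [bary] using! this

theorem mem_image_refSimplex_iff {x : Pt d} :
    x ∈ F '' refSimplex d ↔ ∀ o, 0 ≤ bary F o x := by
  simp only [bary_apply, ← mem_refSimplex_iff]
  constructor
  · rintro ⟨y, hy, rfl⟩; simpa using hy
  · intro h; exact ⟨F.symm x, h, by simp⟩

theorem interior_image_refSimplex (hd : 0 < d) :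
    interior (F '' refSimplex d) = {x | ∀ o, 0 < bary F o x} := by
  have hcont : ∀ o, Continuous (bary F o) := fun o => (bary F o).continuous_of_finiteDimensional
  refine Subset.antisymm (fun x hx o => ?_) (interior_maximal ?_ ?_)
  · have hx0 := (mem_image_refSimplex_iff F).1 (interior_subset hx) o
    refine lt_of_le_of_ne hx0 fun h0 => bary_linear_ne_zero F hd o (LinearMap.ext fun w => ?_)
    -- At an interior point where a barycentric coordinate vanishes, that coordinate would have a
    -- local minimum; being affine, it would be constant.
    have key : ∀ w, 0 ≤ (bary F o).linear w := by
      intro w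
      have hc : Continuous fun t : ℝ => x + t • w := by fun_prop
      have hev : ∀ᶠ t : ℝ in 𝓝 0, x + t • w ∈ interior (F '' refSimplex d) :=
        hc.continuousAt.eventually_mem (isOpen_interior.mem_nhds (by simpa using hx))
      obtain ⟨ε, hε, hball⟩ := Metric.eventually_nhds_iff_ball.1 hev
      have hmem := hball (ε / 2) (by
        rw [mem_ball_zero_iff, Real.norm_of_nonneg (half_pos hε).le]; linarith)
      have h1 := (mem_image_refSimplex_iff F).1 (interior_subset hmem) o
      have h2 := (bary F o).map_vadd x ((ε / 2) • w)
      rw [vadd_eq_add, vadd_eq_add, map_smul, smul_eq_mul, ← h0, add_zero, add_comm] at h2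
      rw [h2] at h1
      exact nonneg_of_mul_nonneg_right h1 (half_pos hε)
    have h3 := key (-w)
    rw [map_neg] at h3
    exact le_antisymm (show (bary F o).linear w ≤ 0 by linarith) (key w)
  · exact fun x hx => (mem_image_refSimplex_iff F).2 fun o => (hx o).le
  · have : {x | ∀ o, 0 < bary F o x} = ⋂ o, {x | 0 < bary F o x} := by ext x; simp
    rw [this]
    exact isOpen_iInter_of_finite fun o => isOpen_lt continuous_const (hcont o)

theorem interior_image_refSimplex_eq_image (hd : 0 < d) :
    interior (F '' refSimplex d) = F '' refInterior d := by
  rw [interior_image_refSimplex F hd]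
  ext x
  constructor
  · intro h; exact ⟨F.symm x, h, by simp⟩
  · rintro ⟨y, hy, rfl⟩; simpa [bary_apply] using! hy

/-- The absolute value of the determinant of the linear part. -/
def jac : ℝ := |(LinearMap.toContinuousLinearMap (F : Pt d →ᵃ[ℝ] Pt d).linear).det|

theorem lintegral_image_refSimplex (g : Pt d → ℝ≥0∞) :
    ∫⁻ x in F '' refSimplex d, g x = ENNReal.ofReal (jac F) * ∫⁻ x in refSimplex d, g (F x) := by
  have h := lintegral_image_eq_lintegral_abs_det_fderiv_mul volume
    (isCompact_refSimplex (d := d)).measurableSet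
    (fun x _ => (hasFDerivAt_affineMap (F : Pt d →ᵃ[ℝ] Pt d) x).hasFDerivWithinAt)
    F.injective.injOn g
  rw [lintegral_const_mul' _ _ ENNReal.ofReal_ne_top] at h
  exact h

theorem jac_nonneg : 0 ≤ jac F := abs_nonneg _

theorem integral_image_refSimplex (g : Pt d → ℝ) :
    ∫ x in F '' refSimplex d, g x = jac F * ∫ x in refSimplex d, g (F x) := by
  have h := integral_image_eq_integral_abs_det_fderiv_smul volume
    (isCompact_refSimplex (d := d)).measurableSet
    (fun x _ => (hasFDerivAt_affineMap (F : Pt d →ᵃ[ℝ] Pt d) x).hasFDerivWithinAt)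
    F.injective.injOn g
  simp only [smul_eq_mul] at h
  rw [integral_const_mul] at h
  exact h

theorem volume_image_refSimplex :
    volume (F '' refSimplex d) = ENNReal.ofReal (jac F) * volume (refSimplex d) := by
  simpa using lintegral_image_refSimplex F 1

/-- Two points at distance r in the ball have preimages in the reference simplex, which lies in the
unit ball, hence at distance at most 2. -/
theorem norm_symm_linear_le {c : Pt d} {r : ℝ} (hr : 0 < r)
    (h : Metric.closedBall c r ⊆ F '' refSimplex d) :
    ‖LinearMap.toContinuousLinearMap (F.symm : Pt d →ᵃ[ℝ] Pt d).linear‖ ≤ 2 / r := by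
  refine ContinuousLinearMap.opNorm_le_bound _ (by positivity) fun w => ?_
  rcases eq_or_ne w 0 with rfl | hw
  · simp
  have hn : 0 < ‖w‖ := norm_pos_iff.2 hw
  have hmem : ∀ y ∈ Metric.closedBall c r, ‖F.symm y‖ ≤ 1 := by
    intro y hy
    obtain ⟨z, hz, rfl⟩ := h hy
    simpa using norm_le_one_of_mem_refSimplex hz
  have h1 := hmem c (Metric.mem_closedBall_self hr.le)
  have h2 := hmem (c + (r / ‖w‖) • w) (by
      rw [mem_closedBall_iff_norm, add_sub_cancel_left, norm_smul, norm_div, norm_norm,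
        div_mul_cancel₀ _ hn.ne', Real.norm_of_nonneg hr.le])
  have h3 := (F.symm : Pt d →ᵃ[ℝ] Pt d).linearMap_vsub (c + (r / ‖w‖) • w) c
  rw [vsub_eq_sub, vsub_eq_sub, add_sub_cancel_left, map_smul] at h3
  have h4 : ‖(r / ‖w‖) • (F.symm : Pt d →ᵃ[ℝ] Pt d).linear w‖ ≤ 2 := by
    rw [h3]
    refine (norm_sub_le _ _).trans ?_
    simpa using! (add_le_add h2 h1).trans (by norm_num)
  rw [norm_smul, Real.norm_of_nonneg (by positivity), div_mul_eq_mul_div, div_le_iff₀ hn] at h4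
  rw [LinearMap.coe_toContinuousLinearMap', div_mul_eq_mul_div, le_div_iff₀ hr, mul_comm]
  exact h4

end AffineImage

/-! ### Triangulations -/

namespace Triangulation

variable {Ω : Set (Pt d)} (T : Triangulation Ω)

theorem finite_cells : T.cells.Finite := T.finite_faces.subset fun _ h => h.1

theorem closure_eq_biUnion_cells :
    closure Ω = ⋃ K ∈ T.cells, convexHull ℝ (K : Set (Pt d)) := by
  rw [← T.space_eq]
  ext x
  simp only [Geometry.SimplicialComplex.mem_space_iff, mem_iUnion, exists_prop]
  constructor
  · rintro ⟨s, hs, hx⟩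
    obtain ⟨K, hK, hsK, hcard⟩ := T.pure s hs
    exact ⟨K, ⟨hK, hcard⟩, convexHull_mono (by exact_mod_cast hsK) hx⟩
  · rintro ⟨K, hK, hx⟩
    exact ⟨K, hK.1, hx⟩

theorem convexHull_subset_closure {K : Finset (Pt d)} (hK : K ∈ T.cells) :
    convexHull ℝ (K : Set (Pt d)) ⊆ closure Ω := by
  rw [T.closure_eq_biUnion_cells]
  exact subset_biUnion_of_mem (u := fun K : Finset (Pt d) => convexHull ℝ (K : Set (Pt d))) hK

theorem isCompact_convexHull (K : Finset (Pt d)) : IsCompact (convexHull ℝ (K : Set (Pt d))) :=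
  K.finite_toSet.isCompact_convexHull ℝ

include T in
theorem isCompact_closure : IsCompact (closure Ω) := by
  rw [T.closure_eq_biUnion_cells]
  exact T.finite_cells.isCompact_biUnion fun K _ => isCompact_convexHull K

/-- Distinct cells meet inside the hull of at most d common vertices, which spans a proper affine
subspace. -/
theorem aedisjoint_cells (hd : 0 < d) {K L : Finset (Pt d)} (hK : K ∈ T.cells) (hL : L ∈ T.cells)
    (hne : K ≠ L) :
    AEDisjoint volume (convexHull ℝ (K : Set (Pt d))) (convexHull ℝ (L : Set (Pt d))) := by
  classical
  have h1 := T.complex.inter_subset_convexHull hK.1 hL.1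
  refine measure_mono_null (h1.trans (convexHull_subset_affineSpan _))
    (Measure.addHaar_affineSubspace volume _ fun htop => ?_)
  rw [← Finset.coe_inter] at htop
  have hlt : (K ∩ L).card < d + 1 := by
    rw [← hK.2]
    refine Finset.card_lt_card (Finset.inter_subset_left.ssubset_of_ne fun h => hne ?_)
    exact Finset.eq_of_subset_of_card_le (Finset.inter_eq_left.1 h) (by rw [hK.2, hL.2])
  have hdir : vectorSpan ℝ ((K ∩ L : Finset (Pt d)) : Set (Pt d)) = ⊤ := by
    rw [← direction_affineSpan, htop, AffineSubspace.direction_top]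
  -- The dimension count `card - 1` needs a common vertex; without one the span is trivial, which is
  -- excluded by d > 0.
  rcases Nat.eq_zero_or_pos (K ∩ L).card with h0 | h0
  · rw [Finset.card_eq_zero.1 h0] at hdir
    simp only [Finset.coe_empty, vectorSpan_empty] at hdir
    have : Nonempty (Fin d) := ⟨⟨0, hd⟩⟩
    exact bot_ne_top hdir
  · have h2 := finrank_vectorSpan_image_finset_le ℝ (id : Pt d → Pt d) (K ∩ L)
      (n := (K ∩ L).card - 1) (by omega)
    rw [Finset.image_id, hdir, finrank_top, finrank_euclideanSpace_fin] at h2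
    omega

theorem cellDiam_le_meshSize {K : Finset (Pt d)} (hK : K ∈ T.cells) :
    cellDiam K ≤ T.meshSize :=
  le_csSup (T.finite_cells.image _).bddAbove (mem_image_of_mem _ hK)

theorem dist_le_meshSize {K : Finset (Pt d)} (hK : K ∈ T.cells) {x y : Pt d}
    (hx : x ∈ convexHull ℝ (K : Set (Pt d))) (hy : y ∈ convexHull ℝ (K : Set (Pt d))) :
    dist x y ≤ T.meshSize :=
  (Metric.dist_le_diam_of_mem (isCompact_convexHull K).isBounded hx hy).trans
    (T.cellDiam_le_meshSize hK)

theorem cells_nonempty (hΩ : Ω.Nonempty) : T.cells.Nonempty := by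
  obtain ⟨x, hx⟩ := hΩ
  have := subset_closure hx
  rw [T.closure_eq_biUnion_cells] at this
  simp only [mem_iUnion, exists_prop] at this
  obtain ⟨K, hK, -⟩ := this
  exact ⟨K, hK⟩

theorem meshSize_pos (hd : 0 < d) (hΩ : Ω.Nonempty) : 0 < T.meshSize := by
  obtain ⟨K, hK⟩ := T.cells_nonempty hΩ
  obtain ⟨x, hx, y, hy, hxy⟩ := Finset.one_lt_card.1 (show 1 < K.card by rw [hK.2]; omega)
  exact (dist_pos.2 hxy).trans_le (T.dist_le_meshSize hK (subset_convexHull ℝ _ hx)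
    (subset_convexHull ℝ _ hy))

end Triangulation

/-- Both parts of quasi-uniformity merge into one constant through h ≤ τ h_K ≤ 2στ r. -/
theorem QuasiUniform.exists_closedBall_subset {Ω : Set (Pt d)} {ι : Type*}
    {T : ι → Triangulation Ω} (h : QuasiUniform T) :
    ∃ θ : ℝ, 0 < θ ∧ ∀ i, ∀ K ∈ (T i).cells, ∃ c : Pt d,
      Metric.closedBall c (θ * (T i).meshSize) ⊆ convexHull ℝ (K : Set (Pt d)) := by
  obtain ⟨σ, τ, hσ, hτ, h⟩ := h
  refine ⟨1 / (2 * σ * τ), by positivity, fun i K hK => ?_⟩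
  obtain ⟨⟨c, r, hball, hr⟩, hm⟩ := h i K hK
  refine ⟨c, (Metric.closedBall_subset_closedBall ?_).trans hball⟩
  rw [div_mul_eq_mul_div, one_mul, div_le_iff₀ (by positivity)]
  calc (T i).meshSize ≤ τ * Triangulation.cellDiam K := hm
    _ ≤ τ * (σ * (2 * r)) := by gcongr
    _ = _ := by ring

end FSI

end

/-! ### Finite element fields on a mesh and the Korn–Poincaré inequality -/

noncomputable section

namespace FSI

open Set Filter Topology
open scoped ENNReal NNReal RealInnerProductSpace

namespace FESpace

variable {d : ℕ} {R : RefElement d} {Ω ΓD : Set (Pt d)} (V : FESpace R Ω ΓD)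

/-- Every cell contains a ball of radius `θ h`. -/
def IsRegular (θ : ℝ) : Prop :=
  ∀ K ∈ V.mesh.cells, ∃ c, Metric.closedBall c (θ * V.h) ⊆ convexHull ℝ (K : Set (Pt d))

/-- The points on the boundary hyperplanes of some cell. -/
def skeleton : Set (Pt d) :=
  ⋃ K ∈ V.mesh.cells, V.cellMap K '' {x | ∃ o, refBary d o x = 0}

/-- The finite element function with coefficients `c`. -/
def field (c : Fin V.N × Fin d → ℝ) (x : Pt d) : Pt d := ∑ p, c p • V.basisField p x

theorem field_single (p : Fin V.N × Fin d) : V.field (Pi.single p 1) = V.basisField p := by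
  classical
  ext1 x
  rw [field, Finset.sum_eq_single p] <;> simp +contextual

theorem field_apply (c : Fin V.N × Fin d → ℝ) (x : Pt d) (l : Fin d) :
    V.field c x l = ∑ i, c (i, l) * V.φ i x := by
  simp [field, basisField, Fintype.sum_prod_type, Finset.sum_apply, Pi.single_apply]

open Classical in
/-- The coefficients of a finite element function on a cell. -/
def localCoeff (K : Finset (Pt d)) (c : Fin V.N × Fin d → ℝ) : Fin R.m × Fin d → ℝ :=
  fun q => ∑ i, if V.carrier i ⊆ K ∧ V.localIndex K i = q.1 then c (i, q.2) else 0

open Classical in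
/-- The sum of the squares of the coefficients which belong to a cell. -/
def localSq (K : Finset (Pt d)) (c : Fin V.N × Fin d → ℝ) : ℝ :=
  ∑ p, if V.carrier p.1 ⊆ K then c p ^ 2 else 0

theorem field_cellMap {K : Finset (Pt d)} (hK : K ∈ V.mesh.cells) (c : Fin V.N × Fin d → ℝ)
    {x : Pt d} (hx : x ∈ refSimplex d) :
    V.field c (V.cellMap K x) = refField R (V.localCoeff K c) x := by
  classical
  ext l
  rw [field_apply, refField_apply]
  simp only [localCoeff, Finset.sum_mul]
  rw [Finset.sum_comm]
  refine Finset.sum_congr rfl fun i _ => ?_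
  by_cases hi : V.carrier i ⊆ K
  · rw [V.φ_on_cell K hK i hi x hx, Finset.sum_eq_single (V.localIndex K i)]
    · simp [hi, refShape]
    · intro j _ hj
      simp [hj.symm]
    · simp
  · rw [V.φ_off_carrier K hK i hi _ (V.cellMap_image K hK ▸ mem_image_of_mem _ hx)]
    simp [hi]

/-- By injectivity of the local numbering at most one global index feeds each local coefficient, so
no cross terms arise. -/
theorem sum_sq_localCoeff {K : Finset (Pt d)} (hK : K ∈ V.mesh.cells)
    (c : Fin V.N × Fin d → ℝ) : ∑ q, V.localCoeff K c q ^ 2 = V.localSq K c := by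
  classical
  have key : ∀ q : Fin R.m × Fin d, V.localCoeff K c q ^ 2 =
      ∑ i, if V.carrier i ⊆ K ∧ V.localIndex K i = q.1 then c (i, q.2) ^ 2 else 0 := by
    intro q
    rw [localCoeff, sq, Finset.sum_mul_sum]
    refine Finset.sum_congr rfl fun i _ => ?_
    rw [Finset.sum_eq_single i]
    · split_ifs <;> ring
    · intro k _ hki
      by_cases h1 : V.carrier i ⊆ K ∧ V.localIndex K i = q.1
      · by_cases h2 : V.carrier k ⊆ K ∧ V.localIndex K k = q.1
        · exact absurd (V.localIndex_injOn K hK h2.1 h1.1 (h2.2.trans h1.2.symm)) hki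
        · rw [if_neg h2, mul_zero]
      · rw [if_neg h1, zero_mul]
    · simp
  simp only [key, localSq, Fintype.sum_prod_type]
  rw [Finset.sum_comm]
  conv_rhs => rw [Finset.sum_comm]
  refine Finset.sum_congr rfl fun l _ => ?_
  rw [Finset.sum_comm]
  refine Finset.sum_congr rfl fun i _ => ?_
  by_cases hi : V.carrier i ⊆ K <;> simp [hi]

variable {V}

/-- The inscribed ball yields both scalings: the inverse linear part is O(1/h), and comparing
volumes bounds the Jacobian below by a multiple of h^d. -/
theorem IsRegular.exists_affineEquiv {θ : ℝ} (hV : V.IsRegular θ) (hh : 0 < θ * V.h)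
    {K : Finset (Pt d)} (hK : K ∈ V.mesh.cells) :
    ∃ F : Pt d ≃ᵃ[ℝ] Pt d, (∀ x, F x = V.cellMap K x) ∧
      F '' refSimplex d = convexHull ℝ (K : Set (Pt d)) ∧
      ‖LinearMap.toContinuousLinearMap (F.symm : Pt d →ᵃ[ℝ] Pt d).linear‖ ≤ 2 / (θ * V.h) ∧
      ENNReal.ofReal ((θ * V.h) ^ d) * volume (Metric.ball (0 : Pt d) 1) ≤
        ENNReal.ofReal (jac F) * volume (refSimplex d) := by
  obtain ⟨c, hc⟩ := hV K hK
  have hc' := hc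
  rw [← V.cellMap_image K hK] at hc'
  set F := AffineEquiv.ofBijective (bijective_of_closedBall_subset_image hh hc') with hF
  have h1 : ∀ x, F x = V.cellMap K x := fun x => rfl
  have h2 : F '' refSimplex d = convexHull ℝ (K : Set (Pt d)) := V.cellMap_image K hK
  refine ⟨F, h1, h2, norm_symm_linear_le F hh (h2 ▸ hc), ?_⟩
  rw [← volume_image_refSimplex, h2]
  refine le_trans (le_of_eq ?_) (measure_mono hc)
  rw [Measure.addHaar_closedBall volume c hh.le, finrank_euclideanSpace_fin]

theorem cellMap_image_eq {K : Finset (Pt d)} {F : Pt d ≃ᵃ[ℝ] Pt d}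
    (hF : ∀ x, F x = V.cellMap K x) :
    V.cellMap K '' {x | ∃ o, refBary d o x = 0} = {x | ∃ o, bary F o x = 0} := by
  ext x
  constructor
  · rintro ⟨y, ⟨o, hy⟩, rfl⟩
    exact ⟨o, by rw [bary_apply, ← hF]; simpa using hy⟩
  · rintro ⟨o, hx⟩
    exact ⟨F.symm x, ⟨o, hx⟩, by rw [← hF]; simp⟩

section Regular

variable {θ : ℝ} (hd : 0 < d) (hV : V.IsRegular θ) (hh : 0 < θ * V.h)

include hd hV hh

theorem IsRegular.volume_skeleton : volume V.skeleton = 0 := by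
  refine (measure_biUnion_null_iff V.mesh.finite_cells.countable).2 fun K hK => ?_
  obtain ⟨F, hF, -⟩ := hV.exists_affineEquiv hh hK
  rw [cellMap_image_eq hF]
  have : {x | ∃ o, bary F o x = 0} = ⋃ o, {x | bary F o x = 0} := by ext; simp
  rw [this]
  exact measure_iUnion_null fun o => volume_affine_zero_eq_zero (bary_linear_ne_zero F hd o)

omit hd in
-- The skeleton is made of entire hyperplanes, so a line through a point off all of them meets each
-- at most once. With bare facets a line could run inside one.
theorem IsRegular.countable_line_inter_skeleton {x : Pt d} (hx : x ∉ V.skeleton) (e : Pt d) :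
    {t : ℝ | x + t • e ∈ V.skeleton}.Countable := by
  have : {t : ℝ | x + t • e ∈ V.skeleton} =
      ⋃ K ∈ V.mesh.cells, {t : ℝ | x + t • e ∈ V.cellMap K '' {x | ∃ o, refBary d o x = 0}} := by
    ext t; simp only [skeleton, mem_iUnion, mem_ofPred_eq]
  rw [this]
  refine V.mesh.finite_cells.countable.biUnion fun K hK => ?_
  obtain ⟨F, hF, -⟩ := hV.exists_affineEquiv hh hK
  have hxK : ∀ o, bary F o x ≠ 0 := by
    intro o ho
    refine hx (mem_biUnion hK ?_)
    rw [cellMap_image_eq hF]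
    exact ⟨o, ho⟩
  rw [cellMap_image_eq hF]
  have : {t : ℝ | x + t • e ∈ {x | ∃ o, bary F o x = 0}} =
      ⋃ o, {t : ℝ | bary F o (x + t • e) = 0} := by ext; simp
  rw [this]
  refine countable_iUnion fun o => (Set.Subsingleton.countable ?_)
  have hlin : ∀ t : ℝ, bary F o (x + t • e) = t * (bary F o).linear e + bary F o x := by
    intro t
    have := (bary F o).map_vadd x (t • e)
    rw [vadd_eq_add, vadd_eq_add, map_smul, smul_eq_mul] at this
    rw [add_comm x, this]
  intro t ht u hu
  simp only [mem_ofPred_eq, hlin] at ht hu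
  have hne : (bary F o).linear e ≠ 0 := by
    intro h
    rw [h, mul_zero, zero_add] at ht
    exact hxK o ht
  exact mul_right_cancel₀ hne (by linarith)

theorem IsRegular.exists_cell_of_notMem_skeleton {x : Pt d} (hx : x ∈ closure Ω)
    (hxs : x ∉ V.skeleton) :
    ∃ K ∈ V.mesh.cells, x ∈ interior (convexHull ℝ (K : Set (Pt d))) := by
  rw [V.mesh.closure_eq_biUnion_cells] at hx
  simp only [mem_iUnion, exists_prop] at hx
  obtain ⟨K, hK, hxK⟩ := hx
  refine ⟨K, hK, ?_⟩
  obtain ⟨F, hF, himg, -⟩ := hV.exists_affineEquiv hh hK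
  rw [← himg] at hxK ⊢
  rw [interior_image_refSimplex F hd]
  intro o
  refine lt_of_le_of_ne ((mem_image_refSimplex_iff F).1 hxK o) fun h0 => hxs (mem_biUnion hK ?_)
  rw [cellMap_image_eq hF]
  exact ⟨o, h0.symm⟩

omit hd hV hh in
theorem interior_cell_subset (hreg : interior (closure Ω) = Ω) {K : Finset (Pt d)}
    (hK : K ∈ V.mesh.cells) : interior (convexHull ℝ (K : Set (Pt d))) ⊆ Ω := by
  conv_rhs => rw [← hreg]
  exact interior_mono (V.mesh.convexHull_subset_closure hK)

theorem IsRegular.closure_diff_subset (hreg : interior (closure Ω) = Ω) :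
    closure Ω \ Ω ⊆ V.skeleton := by
  rintro x ⟨hx, hxΩ⟩
  by_contra hxs
  obtain ⟨K, hK, hxK⟩ := hV.exists_cell_of_notMem_skeleton hd hh hx hxs
  exact hxΩ (interior_cell_subset hreg hK hxK)

/-- Chain rule on the cell: the gradient gains one factor ‖F⁻¹‖, whence h⁻² after squaring. -/
theorem IsRegular.field_bounds {B : ℝ}
    (hB : ∀ (a : Fin R.m × Fin d → ℝ), ∀ x ∈ refSimplex d,
      ‖refField R a x‖ ^ 2 ≤ B * ∑ q, a q ^ 2 ∧
        ‖fderiv ℝ (refField R a) x‖ ^ 2 ≤ B * ∑ q, a q ^ 2)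
    (c : Fin V.N × Fin d → ℝ) {K : Finset (Pt d)} (hK : K ∈ V.mesh.cells) {x : Pt d}
    (hx : x ∈ interior (convexHull ℝ (K : Set (Pt d)))) :
    DifferentiableAt ℝ (V.field c) x ∧ ‖V.field c x‖ ^ 2 ≤ B * V.localSq K c ∧
      ‖fderiv ℝ (V.field c) x‖ ^ 2 ≤ (2 / (θ * V.h)) ^ 2 * (B * V.localSq K c) := by
  obtain ⟨F, hF, himg, hnorm, -⟩ := hV.exists_affineEquiv hh hK
  set a := V.localCoeff K c with ha
  have heq : ∀ y ∈ interior (convexHull ℝ (K : Set (Pt d))),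
      V.field c y = refField R a (F.symm y) ∧ F.symm y ∈ refSimplex d := by
    intro y hy
    rw [← himg, interior_image_refSimplex_eq_image F hd] at hy
    obtain ⟨z, hz, rfl⟩ := hy
    have hz' := refInterior_subset hz
    rw [AffineEquiv.symm_apply_apply, hF]
    exact ⟨V.field_cellMap hK c hz', hz'⟩
  obtain ⟨h1, h2⟩ := hB a (F.symm x) (heq x hx).2
  rw [ha, V.sum_sq_localCoeff hK, ← ha] at h1 h2
  have hev : V.field c =ᶠ[𝓝 x] fun y => refField R a (F.symm y) := by
    filter_upwards [isOpen_interior.mem_nhds hx] with y hy using (heq y hy).1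
  have hder : HasFDerivAt (V.field c) ((fderiv ℝ (refField R a) (F.symm x)).comp
      (LinearMap.toContinuousLinearMap (F.symm : Pt d →ᵃ[ℝ] Pt d).linear)) x := by
    refine HasFDerivAt.congr_of_eventuallyEq ?_ hev
    exact (((contDiff_refField R a).differentiable one_ne_zero).differentiableAt.hasFDerivAt).comp x
      (hasFDerivAt_affineMap (F.symm : Pt d →ᵃ[ℝ] Pt d) x)
  refine ⟨hder.differentiableAt, by rw [(heq x hx).1]; exact h1, ?_⟩
  rw [hder.fderiv]
  calc _ ≤ (‖fderiv ℝ (refField R a) (F.symm x)‖ *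
        ‖LinearMap.toContinuousLinearMap (F.symm : Pt d →ᵃ[ℝ] Pt d).linear‖) ^ 2 := by
        gcongr; exact ContinuousLinearMap.opNorm_comp_le _ _
    _ = ‖LinearMap.toContinuousLinearMap (F.symm : Pt d →ᵃ[ℝ] Pt d).linear‖ ^ 2 *
        ‖fderiv ℝ (refField R a) (F.symm x)‖ ^ 2 := by ring
    _ ≤ _ := by gcongr

/-- The gradient bound found here depends on h and c, which is harmless since `Controlled` requires
only its existence. Vanishing passes to the closure of `ΓD` by continuity, as the density argument
works with closed sets. -/
theorem IsRegular.admissible (hreg : interior (closure Ω) = Ω) (hΓ : ΓD ⊆ frontier Ω)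
    (c : Fin V.N × Fin d → ℝ) : Admissible Ω (closure ΓD) V.skeleton (V.field c) := by
  have hopen : IsOpen Ω := hreg ▸ isOpen_interior
  obtain ⟨B, hB0, hB⟩ := exists_refField_bound R
  have hcell : ∀ x ∈ Ω \ V.skeleton, ∃ K ∈ V.mesh.cells,
      x ∈ interior (convexHull ℝ (K : Set (Pt d))) := fun x hx =>
    hV.exists_cell_of_notMem_skeleton hd hh (subset_closure hx.1) hx.2
  have hcont : ContinuousOn (V.field c) (closure Ω) :=
    continuousOn_finsetSum _ fun p _ =>
      ((V.continuousOn p.1).smul continuousOn_const).const_smul (c p)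
  refine ⟨hcont, ?_, hV.volume_skeleton hd hh, fun x hx e =>
    hV.countable_line_inter_skeleton hh hx e, fun x hx => ?_,
    Real.sqrt ((2 / (θ * V.h)) ^ 2 * (B * ∑ p, c p ^ 2)), fun x hx => ?_⟩
  · have hsub : closure ΓD ⊆ closure Ω :=
      closure_minimal (hΓ.trans frontier_subset_closure) isClosed_closure
    have h0 : ∀ x ∈ ΓD, V.field c x = 0 := fun x hx => by
      simp [field, basisField, V.vanish _ x hx]
    intro x hx
    have hc := (hcont x (hsub hx)).mono (subset_closure.trans hsub)
    have := hc.mem_closure_image hx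
    have himg : V.field c '' ΓD ⊆ {0} := by
      rintro _ ⟨y, hy, rfl⟩; exact h0 y hy
    simpa using closure_mono himg this
  · obtain ⟨K, hK, hxK⟩ := hcell x hx
    exact (hV.field_bounds hd hh hB c hK hxK).1
  · obtain ⟨K, hK, hxK⟩ := hcell x hx
    refine Real.le_sqrt_of_sq_le ((hV.field_bounds hd hh hB c hK hxK).2.2.trans ?_)
    gcongr
    classical
    exact Finset.sum_le_sum fun p _ => by split_ifs <;> first | exact le_rfl | positivity

/-- **Korn–Poincaré inequality** for admissible fields on a triangulated domain. -/
theorem IsRegular.controlled (hreg : interior (closure Ω) = Ω) (hΩ : IsConnected Ω)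
    (hΓ : ΓD ⊆ frontier Ω) (hΓ0 : Measure.hausdorffMeasure ((d : ℝ) - 1) ΓD ≠ 0) :
    Controlled Ω (closure ΓD) Ω := by
  have hopen : IsOpen Ω := hreg ▸ isOpen_interior
  obtain ⟨n, rfl⟩ : ∃ n, d = n + 1 := ⟨d - 1, by omega⟩
  have hcast : (((n + 1 : ℕ) : ℝ) - 1) = (n : ℝ) := by push_cast; ring
  rw [hcast] at hΓ0
  have hΓc : closure ΓD ⊆ frontier Ω := closure_minimal hΓ isClosed_frontier
  -- Points of the Dirichlet boundary lie in cells but not in their interiors, hence on facets. The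
  -- facets are finite in number, so one of them carries positive measure.
  have hcover : closure ΓD ⊆ ⋃ K ∈ V.mesh.cells, ⋃ o,
      closure ΓD ∩ V.cellMap K '' (refSimplex (n + 1) ∩ {x | refBary (n + 1) o x = 0}) := by
    intro x hx
    have hxc : x ∈ closure Ω := frontier_subset_closure (hΓc hx)
    have hxΩ : x ∉ Ω := by
      have := hΓc hx
      rw [hopen.frontier_eq] at this
      exact this.2
    rw [V.mesh.closure_eq_biUnion_cells] at hxc
    simp only [mem_iUnion, exists_prop] at hxc
    obtain ⟨K, hK, hxK⟩ := hxc
    obtain ⟨F, hF, himg, -⟩ := hV.exists_affineEquiv hh hK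
    have hxi : x ∉ F '' refInterior (n + 1) := by
      intro h
      rw [← interior_image_refSimplex_eq_image F hd, himg] at h
      exact hxΩ (interior_cell_subset hreg hK h)
    rw [← himg] at hxK
    obtain ⟨y, hy, rfl⟩ := hxK
    have hy' : ∃ o, refBary (n + 1) o y = 0 := by
      by_contra! h
      exact hxi ⟨y, fun o => lt_of_le_of_ne (mem_refSimplex_iff.1 hy o) (h o).symm, rfl⟩
    obtain ⟨o, ho⟩ := hy'
    refine mem_biUnion hK (mem_iUnion.2 ⟨o, hx, y, ⟨hy, ho⟩, (hF y).symm⟩)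
  obtain ⟨K, hK, o, hKo⟩ : ∃ K ∈ V.mesh.cells, ∃ o, Measure.hausdorffMeasure (n : ℝ)
      (closure ΓD ∩ V.cellMap K '' (refSimplex (n + 1) ∩ {x | refBary (n + 1) o x = 0})) ≠ 0 := by
    by_contra! h
    refine hΓ0 (measure_mono_null (subset_closure.trans hcover) ?_)
    exact (measure_biUnion_null_iff V.mesh.finite_cells.countable).2 fun K hK =>
      measure_iUnion_null fun o => h K hK o
  obtain ⟨F, hF, himg, -⟩ := hV.exists_affineEquiv hh hK
  have hset : V.cellMap K '' (refSimplex (n + 1) ∩ {x | refBary (n + 1) o x = 0}) =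
      convexHull ℝ (K : Set (Pt (n + 1))) ∩ {x | bary F o x = 0} := by
    rw [← himg]
    ext x
    constructor
    · rintro ⟨y, ⟨hy, hyo⟩, rfl⟩
      rw [← hF]
      exact ⟨mem_image_of_mem _ hy, by rw [mem_ofPred_eq, bary_apply]; simpa using hyo⟩
    · rintro ⟨⟨y, hy, rfl⟩, hyo⟩
      rw [mem_ofPred_eq, bary_apply, AffineEquiv.symm_apply_apply] at hyo
      exact ⟨y, ⟨hy, hyo⟩, (hF y).symm⟩
  rw [hset] at hKo
  have hKc := Triangulation.isCompact_convexHull (d := n + 1) K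
  have hne : (interior (convexHull ℝ (K : Set (Pt (n + 1))))).Nonempty := by
    rw [← himg, interior_image_refSimplex_eq_image F hd]
    exact refInterior_nonempty.image _
  have hstart : Controlled Ω (closure ΓD) (interior (convexHull ℝ (K : Set (Pt (n + 1))))) := by
    refine controlled_interior_of_facet (bary_linear_ne_zero F hd o) hopen.measurableSet
      (convex_convexHull ℝ _) hKc.isBounded (V.mesh.convexHull_subset_closure hK)
      (interior_cell_subset hreg hK) (fun x hx => ?_) hne ?_ inter_subset_left
      (fun x hx => hx.2.1) (fun x hx => hx.2.2) hKo
    · rw [← himg, interior_image_refSimplex F hd] at hx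
      exact hx o
    · exact isClosed_closure.inter (hKc.isClosed.inter
        (isClosed_eq (bary F o).continuous_of_finiteDimensional continuous_const))
  have hball : ∃ x ∈ Ω, ∃ r > 0, Metric.ball x r ⊆ Ω ∧
      Controlled Ω (closure ΓD) (Metric.ball x r) := by
    obtain ⟨x, hx⟩ := hne
    obtain ⟨r, hr, hsub⟩ := Metric.isOpen_iff.1 isOpen_interior x hx
    exact ⟨x, interior_cell_subset hreg hK hx, r, hr, hsub.trans (interior_cell_subset hreg hK),
      hstart.mono hsub⟩
  have := V.mesh.finite_cells.to_subtype
  refine Controlled.of_ae_cover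
    (A := fun L : V.mesh.cells => interior (convexHull ℝ (L.1 : Set (Pt (n + 1)))))
    (fun L => Controlled.of_isOpen_convex hopen hΩ.isPreconnected hball isOpen_interior
      (convex_convexHull ℝ _).interior
      ((Triangulation.isCompact_convexHull L.1).isBounded.subset interior_subset)
      (interior_cell_subset hreg L.2)) ?_
  refine measure_mono_null ?_ (hV.volume_skeleton hd hh)
  rintro x ⟨hx, hxn⟩
  by_contra hxs
  obtain ⟨L, hL, hxL⟩ := hV.exists_cell_of_notMem_skeleton hd hh (subset_closure hx) hxs
  exact hxn (mem_iUnion.2 ⟨⟨L, hL⟩, hxL⟩)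

end Regular

end FESpace

end FSI

end

/-! ### Upper and lower bounds in terms of the coefficients -/

noncomputable section

namespace FSI

open Set Filter Topology
open scoped ENNReal NNReal RealInnerProductSpace

variable {d : ℕ}

theorem abs_partialDeriv_le (u : Pt d → Pt d) (x : Pt d) (a b : Fin d) :
    |partialDeriv u x a b| ≤ ‖fderiv ℝ u x‖ := by
  have h1 := (PiLp.norm_apply_le (fderiv ℝ u x (EuclideanSpace.single b (1 : ℝ))) a).trans
    ((fderiv ℝ u x).le_opNorm _)
  simpa [partialDeriv] using h1

theorem abs_strain_le (u : Pt d → Pt d) (x : Pt d) (a b : Fin d) :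
    |strain u x a b| ≤ ‖fderiv ℝ u x‖ := by
  simp only [strain, Matrix.of_apply]
  rw [abs_div, abs_two, div_le_iff₀ two_pos]
  refine (abs_add_le _ _).trans ?_
  linarith [abs_partialDeriv_le u x a b, abs_partialDeriv_le u x b a]

theorem abs_divergence_le (u : Pt d → Pt d) (x : Pt d) :
    |divergence u x| ≤ d * ‖fderiv ℝ u x‖ := by
  refine (Finset.abs_sum_le_sum_abs _ _).trans
    ((Finset.sum_le_sum fun a _ => abs_partialDeriv_le u x a a).trans_eq ?_)
  simp

theorem energy_le (u : Pt d → Pt d) (x : Pt d) : energy u x ≤ d ^ 2 * ‖fderiv ℝ u x‖ ^ 2 := by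
  calc energy u x ≤ ∑ _a : Fin d, ∑ _b : Fin d, ‖fderiv ℝ u x‖ ^ 2 := by
        refine Finset.sum_le_sum fun a _ => Finset.sum_le_sum fun b _ => ?_
        rw [← sq, ← sq_abs]
        exact pow_le_pow_left₀ (abs_nonneg _) (abs_strain_le u x a b) 2
    _ = _ := by simp; ring

namespace FESpace

variable {R : RefElement d} {Ω ΓD : Set (Pt d)} {V : FESpace R Ω ΓD}

/-- Purity of the complex: every carrier is contained in some cell. -/
theorem sum_sq_le_sum_localSq (V : FESpace R Ω ΓD) (c : Fin V.N × Fin d → ℝ) :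
    ∑ p, c p ^ 2 ≤ ∑ K ∈ V.mesh.finite_cells.toFinset, V.localSq K c := by
  classical
  simp only [localSq]
  rw [Finset.sum_comm]
  refine Finset.sum_le_sum fun p _ => ?_
  obtain ⟨K, hK, hsub, hcard⟩ := V.mesh.pure _ (V.carrier_mem p.1)
  have hmem : K ∈ V.mesh.finite_cells.toFinset :=
    V.mesh.finite_cells.mem_toFinset.2 ⟨hK, hcard⟩
  calc c p ^ 2 = if V.carrier p.1 ⊆ K then c p ^ 2 else 0 := by rw [if_pos hsub]
    _ ≤ _ := Finset.single_le_sum (f := fun K => if V.carrier p.1 ⊆ K then c p ^ 2 else 0)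
      (fun K _ => by positivity) hmem

section Regular

variable {θ : ℝ} (hd : 0 < d) (hV : V.IsRegular θ) (hh : 0 < θ * V.h)

include hd hV hh

theorem IsRegular.integrableOn_of_bounded (hreg : interior (closure Ω) = Ω) {f : Pt d → ℝ}
    (hf : Measurable f) {M : ℝ} (hM : ∀ x ∈ Ω \ V.skeleton, |f x| ≤ M) : IntegrableOn f Ω := by
  have hopen : IsOpen Ω := hreg ▸ isOpen_interior
  refine Measure.integrableOn_of_bounded (M := M) ?_ hf.aestronglyMeasurable ?_
  · exact ((measure_mono subset_closure).trans_lt V.mesh.isCompact_closure.measure_lt_top).ne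
  · have h1 : ∀ᵐ x ∂(volume.restrict Ω), x ∉ V.skeleton :=
      ae_restrict_of_ae (measure_eq_zero_iff_ae_notMem.1 (hV.volume_skeleton hd hh))
    filter_upwards [h1, ae_restrict_mem hopen.measurableSet] with x h2 h3 using hM x ⟨h3, h2⟩

/-- All cells containing a given carrier lie within distance h of one of its vertices. Each
coefficient therefore contributes over a ball of volume O(h^d), and no count of cells per vertex is
needed. -/
theorem IsRegular.setIntegral_le (hreg : interior (closure Ω) = Ω) {f : Pt d → ℝ}
    (hf0 : ∀ x, 0 ≤ f x) {C : ℝ} (hC : 0 ≤ C) (c : Fin V.N × Fin d → ℝ)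
    (hf : ∀ K ∈ V.mesh.cells, ∀ x ∈ interior (convexHull ℝ (K : Set (Pt d))),
      f x ≤ C * V.localSq K c) (hVh : 0 ≤ V.h) :
    ∫ x in Ω, f x ≤
      C * (V.h ^ d * (volume (Metric.ball (0 : Pt d) 1)).toReal) * ∑ p, c p ^ 2 := by
  classical
  have hopen : IsOpen Ω := hreg ▸ isOpen_interior
  have hz : ∀ i, ∃ z, z ∈ V.carrier i := fun i =>
    V.mesh.complex.nonempty_of_mem_faces (V.carrier_mem i)
  choose z hz using hz
  set g : Pt d → ℝ := fun x =>
    ∑ p, C * c p ^ 2 * (Metric.closedBall (z p.1) V.h).indicator (fun _ => (1 : ℝ)) x with hg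
  have hind : ∀ y : Pt d,
      Integrable ((Metric.closedBall y V.h).indicator fun _ => (1 : ℝ)) := fun y =>
    (integrable_indicator_iff measurableSet_closedBall).2
      (integrableOn_const (isCompact_closedBall _ _).measure_lt_top.ne)
  have hgi : Integrable g := integrable_finsetSum _ fun p _ => (hind _).const_mul _
  have hg0 : ∀ x, 0 ≤ g x := fun x => Finset.sum_nonneg fun p _ =>
    mul_nonneg (by positivity) (indicator_nonneg (fun _ _ => zero_le_one) x)
  have hfg : f ≤ᵐ[volume.restrict Ω] g := by
    have h1 : ∀ᵐ x ∂(volume.restrict Ω), x ∉ V.skeleton :=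
      ae_restrict_of_ae (measure_eq_zero_iff_ae_notMem.1 (hV.volume_skeleton hd hh))
    filter_upwards [h1, ae_restrict_mem hopen.measurableSet] with x h2 h3
    obtain ⟨K, hK, hx⟩ := hV.exists_cell_of_notMem_skeleton hd hh (subset_closure h3) h2
    refine (hf K hK x hx).trans ?_
    rw [localSq, Finset.mul_sum]
    refine Finset.sum_le_sum fun p _ => ?_
    rw [mul_assoc]
    refine mul_le_mul_of_nonneg_left ?_ hC
    split_ifs with hp
    · rw [indicator_of_mem, mul_one]
      exact V.mesh.dist_le_meshSize hK (interior_subset hx)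
        (subset_convexHull ℝ _ (hp (hz p.1)))
    · exact mul_nonneg (sq_nonneg _) (indicator_nonneg (fun _ _ => zero_le_one) x)
  calc ∫ x in Ω, f x ≤ ∫ x in Ω, g x :=
        integral_mono_of_nonneg (Eventually.of_forall hf0) hgi.integrableOn hfg
    _ ≤ ∫ x, g x := setIntegral_le_integral hgi (Eventually.of_forall hg0)
    _ = ∑ p, C * c p ^ 2 * (V.h ^ d * (volume (Metric.ball (0 : Pt d) 1)).toReal) := by
        rw [integral_finsetSum _ fun p _ => (hind _).const_mul _]
        refine Finset.sum_congr rfl fun p _ => ?_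
        rw [integral_const_mul, integral_indicator measurableSet_closedBall, setIntegral_const,
          smul_eq_mul, mul_one, measureReal_def, Measure.addHaar_closedBall volume _ hVh,
          ENNReal.toReal_mul, finrank_euclideanSpace_fin, ENNReal.toReal_ofReal (by positivity)]
    _ = _ := by rw [← Finset.sum_mul, ← Finset.mul_sum]; ring

/-- On each cell the reference bound is multiplied by a Jacobian of order h^d; the cells overlap in
null sets only, so their contributions add up. -/
theorem IsRegular.mass_lower (hreg : interior (closure Ω) = Ω) {α : ℝ} (hα : 0 < α)
    (hlow : ∀ (a : Fin R.m × Fin d → ℝ),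
      α * ∑ q, a q ^ 2 ≤ ∫ x in refSimplex d, ‖refField R a x‖ ^ 2)
    (c : Fin V.N × Fin d → ℝ) :
    α * ((θ * V.h) ^ d * (volume (Metric.ball (0 : Pt d) 1)).toReal /
      (volume (refSimplex d)).toReal) * ∑ p, c p ^ 2 ≤ ∫ x in Ω, ‖V.field c x‖ ^ 2 := by
  have hopen : IsOpen Ω := hreg ▸ isOpen_interior
  have hcont : ContinuousOn (V.field c) (closure Ω) :=
    continuousOn_finsetSum _ fun p _ =>
      ((V.continuousOn p.1).smul continuousOn_const).const_smul (c p)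
  have hint : IntegrableOn (fun x => ‖V.field c x‖ ^ 2) (closure Ω) :=
    (hcont.norm.pow 2).integrableOn_compact V.mesh.isCompact_closure
  -- The boundary lies in the skeleton and is therefore null, so the integral can be taken over the
  -- union of the closed cells.
  have hcl : ∫ x in Ω, ‖V.field c x‖ ^ 2 = ∫ x in closure Ω, ‖V.field c x‖ ^ 2 := by
    refine setIntegral_congr_set ?_
    refine (ae_eq_set).2 ⟨?_, ?_⟩
    · rw [sdiff_eq_empty.2 subset_closure]; exact measure_empty
    · exact measure_mono_null (hV.closure_diff_subset hd hh hreg) (hV.volume_skeleton hd hh)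
  set vr := (volume (refSimplex d)).toReal with hvr
  have hvr0 : 0 < vr := by
    refine ENNReal.toReal_pos ?_ isCompact_refSimplex.measure_lt_top.ne
    exact ((isOpen_refInterior.measure_pos volume refInterior_nonempty).trans_le
      (measure_mono refInterior_subset)).ne'
  set β := (volume (Metric.ball (0 : Pt d) 1)).toReal with hβ
  have hcell : ∀ K ∈ V.mesh.cells, α * ((θ * V.h) ^ d * β / vr) * V.localSq K c ≤
      ∫ x in convexHull ℝ (K : Set (Pt d)), ‖V.field c x‖ ^ 2 := by
    intro K hK
    obtain ⟨F, hF, himg, -, hjac⟩ := hV.exists_affineEquiv hh hK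
    have hjac' : (θ * V.h) ^ d * β / vr ≤ jac F := by
      rw [div_le_iff₀ hvr0]
      have := ENNReal.toReal_mono (ENNReal.mul_ne_top ENNReal.ofReal_ne_top
        isCompact_refSimplex.measure_lt_top.ne) hjac
      rwa [ENNReal.toReal_mul, ENNReal.toReal_mul, ENNReal.toReal_ofReal (by positivity),
        ENNReal.toReal_ofReal (jac_nonneg F)] at this
    have hchange : ∫ x in convexHull ℝ (K : Set (Pt d)), ‖V.field c x‖ ^ 2 =
        jac F * ∫ x in refSimplex d, ‖refField R (V.localCoeff K c) x‖ ^ 2 := by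
      rw [← himg, integral_image_refSimplex]
      congr 1
      refine setIntegral_congr_fun (isCompact_refSimplex (d := d)).measurableSet fun x hx => ?_
      simp only [hF, V.field_cellMap hK c hx]
    rw [hchange, ← V.sum_sq_localCoeff hK]
    calc _ = ((θ * V.h) ^ d * β / vr) * (α * ∑ q, V.localCoeff K c q ^ 2) := by ring
      _ ≤ jac F * ∫ x in refSimplex d, ‖refField R (V.localCoeff K c) x‖ ^ 2 :=
        mul_le_mul hjac' (hlow _)
          (mul_nonneg hα.le (Finset.sum_nonneg fun _ _ => sq_nonneg _)) (jac_nonneg F)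
  have hunion : ∫ x in closure Ω, ‖V.field c x‖ ^ 2 =
      ∑ K ∈ V.mesh.finite_cells.toFinset,
        ∫ x in convexHull ℝ (K : Set (Pt d)), ‖V.field c x‖ ^ 2 := by
    have hset : closure Ω = ⋃ K ∈ V.mesh.finite_cells.toFinset,
        convexHull ℝ (K : Set (Pt d)) := by
      rw [V.mesh.closure_eq_biUnion_cells]; simp
    have hint' := hint
    rw [hset] at hint' ⊢
    rw [← hset] at hint'
    have h1 := lintegral_biUnion_finset₀ (μ := (volume : Measure (Pt d)))
      (s := V.mesh.finite_cells.toFinset) (t := fun K => convexHull ℝ (K : Set (Pt d)))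
      (fun K hK L hL hne => V.mesh.aedisjoint_cells hd
        (V.mesh.finite_cells.mem_toFinset.1 hK) (V.mesh.finite_cells.mem_toFinset.1 hL) hne)
      (fun K _ => (Triangulation.isCompact_convexHull K).measurableSet.nullMeasurableSet)
      (fun x => ENNReal.ofReal (‖V.field c x‖ ^ 2))
    have hsub : ∀ K ∈ V.mesh.finite_cells.toFinset,
        IntegrableOn (fun x => ‖V.field c x‖ ^ 2) (convexHull ℝ (K : Set (Pt d))) := fun K hK =>
      hint.mono_set (V.mesh.convexHull_subset_closure (V.mesh.finite_cells.mem_toFinset.1 hK))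
    rw [← hset, ← ofReal_integral_eq_lintegral_ofReal hint
      (Eventually.of_forall fun _ => sq_nonneg _)] at h1
    rw [Finset.sum_congr rfl fun K hK => (ofReal_integral_eq_lintegral_ofReal (hsub K hK)
      (Eventually.of_forall fun _ => sq_nonneg _)).symm,
      ← ENNReal.ofReal_sum_of_nonneg fun K _ => integral_nonneg fun _ => sq_nonneg _] at h1
    rw [← hset]
    exact (ENNReal.ofReal_eq_ofReal_iff (integral_nonneg fun _ => sq_nonneg _)
      (Finset.sum_nonneg fun K _ => integral_nonneg fun _ => sq_nonneg _)).1 h1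
  rw [hcl, hunion]
  calc _ ≤ α * ((θ * V.h) ^ d * β / vr) *
        ∑ K ∈ V.mesh.finite_cells.toFinset, V.localSq K c := by
        gcongr
        exact V.sum_sq_le_sum_localSq c
    _ = ∑ K ∈ V.mesh.finite_cells.toFinset,
        α * ((θ * V.h) ^ d * β / vr) * V.localSq K c := Finset.mul_sum _ _ _
    _ ≤ _ := Finset.sum_le_sum fun K hK => hcell K (V.mesh.finite_cells.mem_toFinset.1 hK)

end Regular

end FESpace

end FSI

end

/-! ### Bounds for the bilinear forms and the blocks -/

noncomputable section

namespace FSI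

open Set Filter Topology
open scoped ENNReal NNReal RealInnerProductSpace

variable {d : ℕ}

namespace FESpace

variable {R : RefElement d} {Ω ΓD : Set (Pt d)}

theorem IsRegular.differentiableAt_basisField {V : FESpace R Ω ΓD} {θ : ℝ} (hd : 0 < d)
    (hV : V.IsRegular θ) (hh : 0 < θ * V.h) (hreg : interior (closure Ω) = Ω)
    (hΓ : ΓD ⊆ frontier Ω) (p : Fin V.N × Fin d) {x : Pt d} (hx : x ∈ Ω \ V.skeleton) :
    DifferentiableAt ℝ (V.basisField p) x := by
  rw [← V.field_single p]
  exact (hV.admissible hd hh hreg hΓ _).differentiableAt x hx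

theorem IsRegular.partialDeriv_field {V : FESpace R Ω ΓD} {θ : ℝ} (hd : 0 < d)
    (hV : V.IsRegular θ) (hh : 0 < θ * V.h) (hreg : interior (closure Ω) = Ω)
    (hΓ : ΓD ⊆ frontier Ω) (c : Fin V.N × Fin d → ℝ) {x : Pt d} (hx : x ∈ Ω \ V.skeleton)
    (a b : Fin d) : partialDeriv (V.field c) x a b =
      ∑ p, c p * partialDeriv (V.basisField p) x a b := by
  have h1 : HasFDerivAt (V.field c) (∑ p, c p • fderiv ℝ (V.basisField p) x) x :=
    HasFDerivAt.fun_sum fun p _ =>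
      (hV.differentiableAt_basisField hd hh hreg hΓ p hx).hasFDerivAt.const_smul (c p)
  rw [partialDeriv, h1.fderiv]
  simp [partialDeriv]

/-- Two-sided bounds for the mass, strain and divergence forms on a quasi-uniform family. -/
theorem exists_form_bounds (hd : 0 < d) (hΩ : IsConnected Ω) (hreg : interior (closure Ω) = Ω)
    (hΓ : ΓD ⊆ frontier Ω) (hΓ0 : Measure.hausdorffMeasure ((d : ℝ) - 1) ΓD ≠ 0)
    {ι : Type*} [Nonempty ι] (U : ι → FESpace R Ω ΓD) (hU : QuasiUniform fun i => (U i).mesh) :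
    ∃ θ m M k : ℝ, 0 < θ ∧ 0 < m ∧ 0 < M ∧ 0 < k ∧ ∀ i, (U i).IsRegular θ ∧ 0 < (U i).h ∧
      ∀ c : Fin (U i).N × Fin d → ℝ,
        m * (U i).h ^ d * ∑ p, c p ^ 2 ≤ ∫ x in Ω, ‖(U i).field c x‖ ^ 2 ∧
        ∫ x in Ω, ‖(U i).field c x‖ ^ 2 ≤ M * (U i).h ^ d * ∑ p, c p ^ 2 ∧
        k * ∫ x in Ω, ‖(U i).field c x‖ ^ 2 ≤ ∫ x in Ω, energy ((U i).field c) x ∧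
        ∫ x in Ω, energy ((U i).field c) x ≤
          M * (U i).h ^ d * ((U i).h ^ 2)⁻¹ * ∑ p, c p ^ 2 ∧
        ∫ x in Ω, divergence ((U i).field c) x ^ 2 ≤
          M * (U i).h ^ d * ((U i).h ^ 2)⁻¹ * ∑ p, c p ^ 2 := by
  obtain ⟨θ, hθ, hball⟩ := hU.exists_closedBall_subset
  have hV : ∀ i, (U i).IsRegular θ := fun i K hK => hball i K hK
  have hh : ∀ i, 0 < (U i).h := fun i => (U i).mesh.meshSize_pos hd hΩ.nonempty
  have hθh : ∀ i, 0 < θ * (U i).h := fun i => mul_pos hθ (hh i)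
  obtain ⟨B, hB0, hB⟩ := exists_refField_bound R
  obtain ⟨α, hα, hlow⟩ := exists_refField_lower R
  obtain ⟨i₀⟩ := ‹Nonempty ι›
  -- Only Ω and `ΓD` occur in the controlled statement, so the constant found on one mesh holds for
  -- the whole family.
  obtain ⟨C, hC⟩ := (hV i₀).controlled hd (hθh i₀) hreg hΩ hΓ hΓ0
  set vr := (volume (refSimplex d)).toReal with hvr
  have hvr0 : 0 < vr := by
    refine ENNReal.toReal_pos ?_ isCompact_refSimplex.measure_lt_top.ne
    exact ((isOpen_refInterior.measure_pos volume refInterior_nonempty).trans_le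
      (measure_mono refInterior_subset)).ne'
  set β := (volume (Metric.ball (0 : Pt d) 1)).toReal with hβ
  have hβ0 : 0 < β :=
    ENNReal.toReal_pos (Metric.measure_ball_pos volume _ one_pos).ne' measure_ball_lt_top.ne
  set M1 := B * β + d ^ 2 * ((2 / θ) ^ 2 * B) * β with hM1
  -- `M1` adds the constants of the mass and gradient bounds so as to serve all upper estimates; `C
  -- + 1` avoids inverting a zero constant.
  refine ⟨θ, α * (θ ^ d * β / vr), M1, (C + 1 : ℝ)⁻¹, hθ, by positivity, by positivity,
    by positivity, fun i => ⟨hV i, hh i, fun c => ?_⟩⟩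
  set h := (U i).h with hhdef
  have hhi : 0 < h := hh i
  set S := ∑ p, c p ^ 2 with hS
  have hS0 : 0 ≤ S := Finset.sum_nonneg fun _ _ => sq_nonneg _
  have hopen : IsOpen Ω := hreg ▸ isOpen_interior
  have hadm := (hV i).admissible hd (hθh i) hreg hΓ c
  have hfb := fun (K : Finset (Pt d)) (hK : K ∈ (U i).mesh.cells) (x : Pt d)
    (hx : x ∈ interior (convexHull ℝ (K : Set (Pt d)))) =>
      (hV i).field_bounds hd (hθh i) hB c hK hx
  have hgrad : ∀ K ∈ (U i).mesh.cells, ∀ x ∈ interior (convexHull ℝ (K : Set (Pt d))),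
      d ^ 2 * ‖fderiv ℝ ((U i).field c) x‖ ^ 2 ≤
        (d ^ 2 * ((2 / θ) ^ 2 * B) * (h ^ 2)⁻¹) * (U i).localSq K c := by
    intro K hK x hx
    calc (d : ℝ) ^ 2 * ‖fderiv ℝ ((U i).field c) x‖ ^ 2
        ≤ d ^ 2 * ((2 / (θ * h)) ^ 2 * (B * (U i).localSq K c)) := by
          gcongr; exact (hfb K hK x hx).2.2
      _ = _ := by field_simp
  have hgradbound : ∀ f : Pt d → ℝ, (∀ x, 0 ≤ f x) →
      (∀ x, f x ≤ d ^ 2 * ‖fderiv ℝ ((U i).field c) x‖ ^ 2) →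
      ∫ x in Ω, f x ≤ M1 * h ^ d * (h ^ 2)⁻¹ * S := by
    intro f hf0 hf
    refine ((hV i).setIntegral_le hd (hθh i) hreg hf0 (by positivity) c
      (fun K hK x hx => (hf x).trans (hgrad K hK x hx)) hhi.le).trans ?_
    calc _ = (d ^ 2 * ((2 / θ) ^ 2 * B) * β) * h ^ d * (h ^ 2)⁻¹ * S := by ring
      _ ≤ M1 * h ^ d * (h ^ 2)⁻¹ * S := by
        gcongr
        rw [hM1]
        have : 0 ≤ B * β := by positivity
        linarith
  refine ⟨?_, ?_, ?_, ?_, ?_⟩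
  · refine le_trans (le_of_eq ?_) ((hV i).mass_lower hd (hθh i) hreg hα hlow c)
    rw [mul_pow]; ring
  · refine ((hV i).setIntegral_le hd (hθh i) hreg (fun _ => sq_nonneg _) hB0.le c
      (fun K hK x hx => (hfb K hK x hx).2.1) hhi.le).trans ?_
    calc _ = (B * β) * h ^ d * S := by ring
      _ ≤ M1 * h ^ d * S := by
        gcongr
        rw [hM1]
        have : 0 ≤ d ^ 2 * ((2 / θ) ^ 2 * B) * β := by positivity
        linarith
  · have hK := hC _ _ hadm
    obtain ⟨M, hM⟩ := hadm.bounded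
    have hi1 : IntegrableOn (fun x => ‖(U i).field c x‖ ^ 2) Ω :=
      ((hadm.continuousOn.norm.pow 2).integrableOn_compact
        (U i).mesh.isCompact_closure).mono_set subset_closure
    have hi2 : IntegrableOn (energy ((U i).field c)) Ω := by
      refine (hV i).integrableOn_of_bounded hd (hθh i) hreg (measurable_energy _)
        (M := d ^ 2 * M ^ 2) fun x hx => ?_
      rw [abs_of_nonneg (energy_nonneg _ _)]
      refine (energy_le _ _).trans ?_
      gcongr
      exact hM x hx
    have h1 : ∫⁻ x in Ω, ‖(U i).field c x‖ₑ ^ 2 =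
        ENNReal.ofReal (∫ x in Ω, ‖(U i).field c x‖ ^ 2) := by
      rw [ofReal_integral_eq_lintegral_ofReal hi1 (Eventually.of_forall fun _ => sq_nonneg _)]
      refine lintegral_congr fun x => ?_
      rw [ENNReal.ofReal_pow (norm_nonneg _), ofReal_norm]
    rw [h1, ← ofReal_integral_eq_lintegral_ofReal hi2
      (Eventually.of_forall fun _ => energy_nonneg _ _), ← ENNReal.ofReal_coe_nnreal,
      ← ENNReal.ofReal_mul (NNReal.coe_nonneg C)] at hK
    have hE0 : 0 ≤ ∫ x in Ω, energy ((U i).field c) x :=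
      integral_nonneg fun _ => energy_nonneg _ _
    have hK' := (ENNReal.ofReal_le_ofReal_iff (mul_nonneg (NNReal.coe_nonneg C) hE0)).1 hK
    rw [inv_mul_le_iff₀ (by positivity), add_mul, one_mul]
    linarith
  · exact hgradbound _ (energy_nonneg _) (energy_le _)
  · refine hgradbound _ (fun _ => sq_nonneg _) fun x => ?_
    rw [← mul_pow, ← sq_abs]
    exact pow_le_pow_left₀ (abs_nonneg _) (abs_divergence_le _ _) 2

end FESpace

/-! ### Gram matrices -/

/-- One formula for mass, strain and divergence: k runs over vector components, pairs of indices, or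
a single index. -/
theorem dotProduct_gram_mulVec {ι κ : Type*} [Fintype ι] [Fintype κ] {Ω : Set (Pt d)}
    {f : κ → ι → Pt d → ℝ}
    (hf : ∀ k p q, IntegrableOn (fun x => f k q x * f k p x) Ω) {γ : ℝ} {A : Matrix ι ι ℝ}
    (hA : ∀ p q, A p q = γ * ∫ x in Ω, ∑ k, f k q x * f k p x) (c : ι → ℝ) :
    c ⬝ᵥ A *ᵥ c = γ * ∫ x in Ω, ∑ k, (∑ p, c p * f k p x) ^ 2 := by
  have h1 : ∀ x, ∑ k, (∑ p, c p * f k p x) ^ 2 =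
      ∑ p, ∑ q, (c p * c q) * ∑ k, f k q x * f k p x := by
    intro x
    have h2 : ∀ k, (∑ p, c p * f k p x) ^ 2 = ∑ p, ∑ q, (c p * c q) * (f k q x * f k p x) := by
      intro k
      rw [sq, Finset.sum_mul_sum]
      exact Finset.sum_congr rfl fun p _ => Finset.sum_congr rfl fun q _ => by ring
    simp only [h2]
    rw [Finset.sum_comm]
    refine Finset.sum_congr rfl fun p _ => ?_
    rw [Finset.sum_comm]
    exact Finset.sum_congr rfl fun q _ => (Finset.mul_sum _ _ _).symm
  have hint : ∀ p q, Integrable (fun x => ∑ k, f k q x * f k p x) (volume.restrict Ω) :=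
    fun p q => integrable_finsetSum _ fun k _ => hf k p q
  simp only [h1]
  rw [integral_finsetSum _ fun p _ => integrable_finsetSum _ fun q _ => (hint p q).const_mul _,
    Finset.mul_sum, dotProduct]
  refine Finset.sum_congr rfl fun p _ => ?_
  rw [integral_finsetSum _ fun q _ => (hint p q).const_mul _, Finset.mul_sum, Matrix.mulVec,
    dotProduct, Finset.mul_sum]
  refine Finset.sum_congr rfl fun q _ => ?_
  rw [integral_const_mul, hA]
  ring

namespace FESpace

variable {R : RefElement d} {Ω ΓD : Set (Pt d)} {V : FESpace R Ω ΓD}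

theorem isSymm_massMatrix (ρ : ℝ) : (V.massMatrix ρ).IsSymm := by
  ext p q
  simp only [massMatrix, Matrix.transpose_apply, Matrix.of_apply, real_inner_comm]

theorem isSymm_stiffnessMatrix (ν : ℝ) : (V.stiffnessMatrix ν).IsSymm := by
  ext p q
  simp only [stiffnessMatrix, Matrix.transpose_apply, Matrix.of_apply]
  simp only [mul_comm (strain (V.basisField p) _ _ _)]

theorem isSymm_divMatrix (lam : ℝ) : (V.divMatrix lam).IsSymm := by
  ext p q
  simp only [divMatrix, Matrix.transpose_apply, Matrix.of_apply]
  simp only [mul_comm (divergence (V.basisField p) _)]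

theorem massMatrix_form (ρ : ℝ) (c : Fin V.N × Fin d → ℝ) :
    c ⬝ᵥ V.massMatrix ρ *ᵥ c = ρ * ∫ x in Ω, ‖V.field c x‖ ^ 2 := by
  rw [dotProduct_gram_mulVec (Ω := Ω) (f := fun (l : Fin d) p x => V.basisField p x l) (γ := ρ)]
  · congr 2
    ext x
    rw [EuclideanSpace.real_norm_sq_eq]
    simp [field, Finset.sum_apply]
  · intro l p q
    have hc : ∀ r, ContinuousOn (fun x => V.basisField r x l) (closure Ω) := fun r =>
      (EuclideanSpace.proj (𝕜 := ℝ) l).continuous.comp_continuousOn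
        ((V.continuousOn r.1).smul continuousOn_const)
    exact (((hc q).mul (hc p)).integrableOn_compact V.mesh.isCompact_closure).mono_set
      subset_closure
  · intro p q
    simp only [massMatrix, Matrix.of_apply, PiLp.inner_apply, RCLike.inner_apply, conj_trivial]
    congr 2
    ext x
    exact Finset.sum_congr rfl fun l _ => mul_comm _ _

section Regular

variable {θ : ℝ} (hd : 0 < d) (hV : V.IsRegular θ) (hh : 0 < θ * V.h)
  (hreg : interior (closure Ω) = Ω) (hΓ : ΓD ⊆ frontier Ω)

include hd hV hh hreg hΓ

omit hΓ in
theorem IsRegular.ae_mem : ∀ᵐ x ∂(volume.restrict Ω), x ∈ Ω \ V.skeleton := by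
  have hopen : IsOpen Ω := hreg ▸ isOpen_interior
  filter_upwards [ae_restrict_of_ae (measure_eq_zero_iff_ae_notMem.1 (hV.volume_skeleton hd hh)),
    ae_restrict_mem hopen.measurableSet] with x h1 h2 using ⟨h2, h1⟩

omit hΓ in
theorem IsRegular.integrableOn_mul {f g : Pt d → ℝ} (hf : Measurable f) (hg : Measurable g)
    {u v : Pt d → Pt d} (hu : Admissible Ω (closure ΓD) V.skeleton u)
    (hv : Admissible Ω (closure ΓD) V.skeleton v) {C : ℝ}
    (hfu : ∀ x, |f x| ≤ C * ‖fderiv ℝ u x‖) (hgv : ∀ x, |g x| ≤ C * ‖fderiv ℝ v x‖)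
    (hC : 0 ≤ C) : IntegrableOn (fun x => f x * g x) Ω := by
  obtain ⟨M, hM⟩ := hu.bounded
  obtain ⟨N, hN⟩ := hv.bounded
  refine hV.integrableOn_of_bounded hd hh hreg (hf.mul hg) (M := (C * M) * (C * N)) fun x hx => ?_
  have h1 : |f x| ≤ C * M := (hfu x).trans (by gcongr; exact hM x hx)
  have h2 : |g x| ≤ C * N := (hgv x).trans (by gcongr; exact hN x hx)
  rw [abs_mul]
  exact mul_le_mul h1 h2 (abs_nonneg _) ((abs_nonneg _).trans h1)

theorem IsRegular.admissible_basisField (p : Fin V.N × Fin d) :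
    Admissible Ω (closure ΓD) V.skeleton (V.basisField p) := by
  rw [← V.field_single p]
  exact hV.admissible hd hh hreg hΓ _

theorem IsRegular.stiffnessMatrix_form (ν : ℝ) (c : Fin V.N × Fin d → ℝ) :
    c ⬝ᵥ V.stiffnessMatrix ν *ᵥ c = 2 * ν * ∫ x in Ω, energy (V.field c) x := by
  rw [dotProduct_gram_mulVec (Ω := Ω) (γ := 2 * ν)
    (f := fun (k : Fin d × Fin d) p x => strain (V.basisField p) x k.1 k.2)]
  · congr 1
    refine integral_congr_ae ?_
    filter_upwards [hV.ae_mem hd hh hreg] with x hx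
    rw [energy, Fintype.sum_prod_type]
    refine Finset.sum_congr rfl fun a _ => Finset.sum_congr rfl fun b _ => ?_
    rw [← sq]
    congr 1
    simp only [strain, Matrix.of_apply, hV.partialDeriv_field hd hh hreg hΓ c hx]
    rw [← Finset.sum_add_distrib, Finset.sum_div]
    exact Finset.sum_congr rfl fun p _ => by ring
  · intro k p q
    exact hV.integrableOn_mul hd hh hreg (measurable_strain _ _ _) (measurable_strain _ _ _)
      (hV.admissible_basisField hd hh hreg hΓ q) (hV.admissible_basisField hd hh hreg hΓ p)
      (C := 1) (fun x => by rw [one_mul]; exact abs_strain_le _ _ _ _)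
      (fun x => by rw [one_mul]; exact abs_strain_le _ _ _ _) zero_le_one
  · intro p q
    simp only [stiffnessMatrix, Matrix.of_apply, Fintype.sum_prod_type]

theorem IsRegular.divMatrix_form (lam : ℝ) (c : Fin V.N × Fin d → ℝ) :
    c ⬝ᵥ V.divMatrix lam *ᵥ c = lam * ∫ x in Ω, divergence (V.field c) x ^ 2 := by
  rw [dotProduct_gram_mulVec (Ω := Ω) (γ := lam)
    (f := fun (_ : Unit) p x => divergence (V.basisField p) x)]
  · congr 1
    refine integral_congr_ae ?_
    filter_upwards [hV.ae_mem hd hh hreg] with x hx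
    simp only [Finset.univ_unique, Finset.sum_singleton]
    congr 1
    simp only [divergence, hV.partialDeriv_field hd hh hreg hΓ c hx, Finset.mul_sum]
    exact Finset.sum_comm
  · intro k p q
    exact hV.integrableOn_mul hd hh hreg (measurable_divergence _) (measurable_divergence _)
      (hV.admissible_basisField hd hh hreg hΓ q) (hV.admissible_basisField hd hh hreg hΓ p)
      (abs_divergence_le _) (abs_divergence_le _) (Nat.cast_nonneg d)
  · intro p q
    simp only [divMatrix, Matrix.of_apply, Finset.univ_unique, Finset.sum_singleton]

end Regular

theorem isSymm_fluidBlock (ρ ν Δt : ℝ) : (V.fluidBlock ρ ν Δt).IsSymm :=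
  (isSymm_massMatrix ρ).add ((isSymm_stiffnessMatrix ν).smul Δt)

theorem isSymm_structureBlock (ρ ν lam Δt : ℝ) : (V.structureBlock ρ ν lam Δt).IsSymm :=
  (isSymm_massMatrix ρ).add
    (((isSymm_stiffnessMatrix ν).add (isSymm_divMatrix lam)).smul (Δt ^ 2))

theorem exists_block_bounds (hd : 0 < d) (hΩ : IsConnected Ω) (hreg : interior (closure Ω) = Ω)
    (hΓ : ΓD ⊆ frontier Ω) (hΓ0 : Measure.hausdorffMeasure ((d : ℝ) - 1) ΓD ≠ 0)
    {ι : Type*} (U : ι → FESpace R Ω ΓD) (hU : QuasiUniform fun i => (U i).mesh)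
    {ρ ν lam : ℝ} (hρ : 0 < ρ) (hν : 0 < ν) (hlam : 0 ≤ lam) :
    ∃ cmin cmax : ℝ, 0 < cmin ∧ 0 < cmax ∧ ∀ i, 0 < (U i).h ∧ ∀ τ : ℝ, 0 < τ →
      ∀ c : Fin (U i).N × Fin d → ℝ,
        cmin * (U i).h ^ d * (1 + τ) * (c ⬝ᵥ c) ≤
          c ⬝ᵥ ((U i).massMatrix ρ + τ • ((U i).stiffnessMatrix ν + (U i).divMatrix lam)) *ᵥ c ∧
        c ⬝ᵥ ((U i).massMatrix ρ + τ • ((U i).stiffnessMatrix ν + (U i).divMatrix lam)) *ᵥ c ≤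
          cmax * (U i).h ^ d * (1 + τ * ((U i).h ^ 2)⁻¹) * (c ⬝ᵥ c) := by
  rcases isEmpty_or_nonempty ι with hι | hι
  · exact ⟨1, 1, one_pos, one_pos, fun i => hι.elim i⟩
  obtain ⟨θ, m, M, k, hθ, hm, hM, hk, hbd⟩ := exists_form_bounds hd hΩ hreg hΓ hΓ0 U hU
  -- Korn–Poincaré turns 2νE into at least 2νk times the mass term. The divergence term is dropped
  -- from below and absorbed from above.
  set a := min ρ (2 * ν * k) with ha
  have ha0 : 0 < a := lt_min hρ (by positivity)
  refine ⟨a * m, (ρ + 2 * ν + lam) * M, by positivity, by positivity, fun i => ?_⟩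
  obtain ⟨hV, hh, hc⟩ := hbd i
  refine ⟨hh, fun τ hτ c => ?_⟩
  have hθh : 0 < θ * (U i).h := mul_pos hθ hh
  obtain ⟨h1, h2, h3, h4, h5⟩ := hc c
  rw [Matrix.add_mulVec, dotProduct_add, Matrix.smul_mulVec, dotProduct_smul, Matrix.add_mulVec,
    dotProduct_add, massMatrix_form, hV.stiffnessMatrix_form hd hθh hreg hΓ,
    hV.divMatrix_form hd hθh hreg hΓ, smul_eq_mul]
  have hcc : c ⬝ᵥ c = ∑ p, c p ^ 2 := by simp only [dotProduct, sq]
  rw [hcc]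
  have hL0 : 0 ≤ ∫ x in Ω, divergence ((U i).field c) x ^ 2 := integral_nonneg fun _ => sq_nonneg _
  set h := (U i).h
  set S := ∑ p, c p ^ 2
  set A := ∫ x in Ω, ‖(U i).field c x‖ ^ 2
  set E := ∫ x in Ω, energy ((U i).field c) x
  set L := ∫ x in Ω, divergence ((U i).field c) x ^ 2
  have hA0 : 0 ≤ A := integral_nonneg fun _ => sq_nonneg _
  constructor
  · calc a * m * h ^ d * (1 + τ) * S = a * (1 + τ) * (m * h ^ d * S) := by ring
      _ ≤ a * (1 + τ) * A := by gcongr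
      _ = a * A + τ * (a * A) := by ring
      _ ≤ ρ * A + τ * (2 * ν * (k * A) + lam * L) := by
          have e1 : a * A ≤ ρ * A := by gcongr; exact min_le_left _ _
          have e2 : a * A ≤ 2 * ν * (k * A) + lam * L := by
            have : a * A ≤ 2 * ν * k * A := by gcongr; exact min_le_right _ _
            have : 0 ≤ lam * L := mul_nonneg hlam hL0
            linarith
          gcongr
      _ ≤ _ := by gcongr
  · have hS0 : 0 ≤ S := Finset.sum_nonneg fun _ _ => sq_nonneg _
    set X := M * h ^ d * S with hX
    set Y := M * h ^ d * (h ^ 2)⁻¹ * S with hY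
    have hX0 : 0 ≤ X := by positivity
    have hY0 : 0 ≤ Y := by positivity
    calc ρ * A + τ * (2 * ν * E + lam * L) ≤ ρ * X + τ * (2 * ν * Y + lam * Y) := by gcongr
      _ ≤ (ρ + 2 * ν + lam) * X + τ * ((ρ + 2 * ν + lam) * Y) := by
          have e1 : ρ * X ≤ (ρ + 2 * ν + lam) * X := by gcongr; linarith
          have e2 : 2 * ν * Y + lam * Y ≤ (ρ + 2 * ν + lam) * Y := by
            rw [← add_mul]; gcongr; linarith
          gcongr
      _ = _ := by rw [hX, hY]; ring

end FESpace

theorem dotProduct_fromBlocks_diagonal_mulVec {m n : Type*} [Fintype m] [Fintype n]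
    (A : Matrix m m ℝ) (D : Matrix n n ℝ) (v : m ⊕ n → ℝ) :
    v ⬝ᵥ Matrix.fromBlocks A 0 0 D *ᵥ v =
      (v ∘ Sum.inl) ⬝ᵥ A *ᵥ (v ∘ Sum.inl) + (v ∘ Sum.inr) ⬝ᵥ D *ᵥ (v ∘ Sum.inr) := by
  rw [Matrix.fromBlocks_mulVec, dotProduct, Fintype.sum_sum_type]
  simp [dotProduct]

end FSI

end

/-! ### The theorem -/

theorem lemma5p4 {d : ℕ} (hd : d = 2 ∨ d = 3)
    {Ωf ΓDf Ωs ΓDs : Set (FSI.Pt d)}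
    (hΩf : IsConnected Ωf) (hΩf_reg : interior (closure Ωf) = Ωf)
    (hΓf : ΓDf ⊆ frontier Ωf)
    (hΓf_pos : MeasureTheory.Measure.hausdorffMeasure ((d : ℝ) - 1) ΓDf ≠ 0)
    (hΩs : IsConnected Ωs) (hΩs_reg : interior (closure Ωs) = Ωs)
    (hΓs : ΓDs ⊆ frontier Ωs)
    (hΓs_pos : MeasureTheory.Measure.hausdorffMeasure ((d : ℝ) - 1) ΓDs ≠ 0)
    {Rf Rs : FSI.RefElement d} {ι κ : Type*}
    (U : ι → FSI.FESpace Rf Ωf ΓDf) (X : κ → FSI.FESpace Rs Ωs ΓDs)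
    (hU : FSI.QuasiUniform fun i => (U i).mesh) (hX : FSI.QuasiUniform fun j => (X j).mesh)
    {ρf νf ρs νs lam : ℝ} (hρf : 0 < ρf) (hνf : 0 < νf)
    (hρs : 0 < ρs) (hνs : 0 < νs) (hlam : 0 < lam) :
    ∃ Cminf Cmaxf Cmins Cmaxs : ℝ, 0 < Cminf ∧ 0 < Cmaxf ∧ 0 < Cmins ∧ 0 < Cmaxs ∧
      ∀ (i : ι) (j : κ) (Δt : ℝ), 0 < Δt →
        let h₁ := (U i).h
        let h₂ := (X j).h
        let W := FSI.matrixW (U i) (X j) ρf νf ρs νs lam Δt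
        let lo := min (Cminf * h₁ ^ d * (1 + Δt)) (Cmins * h₂ ^ d * (1 + Δt ^ 2))
        let hi := max (Cmaxf * h₁ ^ d * (1 + Δt * (h₁ ^ 2)⁻¹))
          (Cmaxs * h₂ ^ d * (1 + Δt ^ 2 * (h₂ ^ 2)⁻¹))
        W.PosDef ∧ (∀ μ ∈ FSI.eigenvalueSet W, lo ≤ μ ∧ μ ≤ hi) ∧
          FSI.cond W = FSI.muMax W / FSI.muMin W ∧ FSI.cond W ≤ hi / lo := by
  have hd0 : 0 < d := by omega
  obtain ⟨Cminf, Cmaxf, h1, h2, hf⟩ := FSI.FESpace.exists_block_bounds hd0 hΩf hΩf_reg hΓf hΓf_pos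
    U hU hρf hνf le_rfl
  obtain ⟨Cmins, Cmaxs, h3, h4, hs⟩ := FSI.FESpace.exists_block_bounds hd0 hΩs hΩs_reg hΓs hΓs_pos
    X hX hρs hνs hlam.le
  refine ⟨Cminf, Cmaxf, Cmins, Cmaxs, h1, h2, h3, h4, fun i j Δt hΔt => ?_⟩
  obtain ⟨hh1, hf⟩ := hf i
  obtain ⟨hh2, hs⟩ := hs j
  intro h₁ h₂ W lo hi
  -- The fluid block is the common block form with zero divergence coefficient and τ = Δt; the
  -- structure block takes τ = Δt².
  have hdiv : (U i).divMatrix 0 = 0 := by ext; simp [FSI.FESpace.divMatrix]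
  have hf : ∀ c : Fin (U i).N × Fin d → ℝ, _ := hf Δt hΔt
  have hs : ∀ c : Fin (X j).N × Fin d → ℝ, _ := hs (Δt ^ 2) (by positivity)
  rw [hdiv, add_zero] at hf
  have hlo : 0 < lo := lt_min (by positivity) (by positivity)
  have hhi : 0 ≤ hi := le_max_of_le_left (by positivity)
  have hnn : ∀ {n : Type} [Fintype n] (c : n → ℝ), 0 ≤ c ⬝ᵥ c := fun c =>
    Finset.sum_nonneg fun _ _ => mul_self_nonneg _
  have hsum : ∀ v : (Fin (U i).N × Fin d) ⊕ (Fin (X j).N × Fin d) → ℝ,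
      v ⬝ᵥ v = (v ∘ Sum.inl) ⬝ᵥ (v ∘ Sum.inl) + (v ∘ Sum.inr) ⬝ᵥ (v ∘ Sum.inr) := fun v => by
    simp [dotProduct]
  refine FSI.spectral_bounds ?_ hlo hhi (fun v => ?_) fun v => ?_
  · exact Matrix.IsSymm.fromBlocks (FSI.FESpace.isSymm_fluidBlock _ _ _) (by simp)
      (FSI.FESpace.isSymm_structureBlock _ _ _ _)
  · rw [hsum, mul_add]
    refine le_trans (add_le_add ?_ ?_)
      (FSI.dotProduct_fromBlocks_diagonal_mulVec _ _ v).ge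
    · exact (mul_le_mul_of_nonneg_right (min_le_left _ _) (hnn _)).trans (hf (v ∘ Sum.inl)).1
    · exact (mul_le_mul_of_nonneg_right (min_le_right _ _) (hnn _)).trans (hs (v ∘ Sum.inr)).1
  · rw [hsum, mul_add]
    refine (FSI.dotProduct_fromBlocks_diagonal_mulVec _ _ v).le.trans (add_le_add ?_ ?_)
    · exact (hf (v ∘ Sum.inl)).2.trans (mul_le_mul_of_nonneg_right (le_max_left _ _) (hnn _))
    · exact (hs (v ∘ Sum.inr)).2.trans (mul_le_mul_of_nonneg_right (le_max_right _ _) (hnn _))
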